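/- **One-soliton transmission coefficients of the focusing complex coupled short pulse equation** $\mathbf u_{xt}=\mathbf u+\tfrac12(\|\mathbf u\|^2\mathbf u_x)_x$, $\mathbf u=(u_1,u_2)^T$. *Notation.* $^*$ is complex conjugation, $\|\cdot\|$ the Euclidean norm on $\mathbb C^2$, $v^\perp=(-v_2^*,v_1^*)^T$, $\sigma_2=\begin{pmatrix}0&-i\\ i&0\end{pmatrix}$, $\Sigma_3=\mathrm{diag}(1,1,-1,-1)$, $\theta(\xi,t,k)=k\xi-t/(4k)$. For a $2\times2$ matrix $C$ put $\bar C=-C^\dagger$, $\tilde C=-\sigma_2C^*\sigma_2$, $\bar{\tilde C}=-\sigma_2\bar C^*\sigma_2$. *One-soliton solutions.* Let $k_j$ with $\operatorname{Im}k_j>0$ be the discrete eigenvalue and $C_j$ the norming constant. If $\operatorname{Re}k_j\ne0$, let $M=(M_1,M_2)$ (two $4\times2$ block columns) be the $4\times 4$ matrix function of $k$ (depending on $(\xi,t)\in\mathbb R^2$) with $$M_1(k)=\begin{pmatrix}I_2\\0\end{pmatrix}+\frac{e^{2i\theta(k_j)}}{k-k_j}M_2(k_j)C_j+\frac{e^{2i\theta(-k_j^*)}}{k+k_j^*}M_2(-k_j^*)\tilde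 C_j,$$ $$M_2(k)=\begin{pmatrix}0\\I_2\end{pmatrix}+\frac{e^{-2i\theta(k_j^*)}}{k-k_j^*}M_1(k_j^*)\bar C_j+\frac{e^{-2i\theta(-k_j)}}{k+k_j}M_1(-k_j)\bar{\tilde C}_j .$$ If $k_j$ is purely imaginary (self-symmetric), only the poles $k_j$ in $M_1$ and $k_j^*$ in $M_2$ are present, with constants $C_j,\bar C_j$. With $N(k)=M(0)^{-1}M(k)$ the soliton is given in parametric form by $\mathbf u(\xi,t)=\lim_{k\to0}\frac ik(N_{13},N_{14})^T$, $x(\xi,t)=\xi+\lim_{k\to0}\frac ik(N_{11}-1)$. *Transmission coefficients.* Let $\rho=\partial x/\partial\xi$, $U=\begin{pmatrix}-iu_1&-iu_2\\ iu_2^*&-iu_1^*\end{pmatrix}$, $V_0=\begin{pmatrix}0&U\\U^\dagger&0\end{pmatrix}$, and consider the Lax pair in the variables $(\xi,t)$ $$\Psi_\xi=(-ik\rho\,\Sigma_3+k\Sigma_3V_{0,\xi})\Psi,\qquad \Psi_t=\left(\tfrac{i}{4k}\Sigma_3-\tfrac i2V_0\right)\Psi .$$ For real $k\neq0$ let $\Psi_\pm$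 be its simultaneous solutions with $\Psi_\pm e^{i\theta\Sigma_3}\to I_4$ as $\xi\to\pm\infty$, and let $\Psi_-=\Psi_+S(k)$. Then $a,\bar a$ (inverses of the left transmission coefficients) are the upper-left and lower-right $2\times2$ blocks of $S(k)$, and $\bar c,c$ (inverses of the right transmission coefficients) those of $S(k)^{-1}$. The functions $a,c$ extend analytically to $\operatorname{Im}k>0$ and $\bar a,\bar c$ to $\operatorname{Im}k<0$, continuously up to the whole real line, where off the real line $a=\lim_{\xi\to+\infty}(e^{i\theta}\Psi_{-,1})^{\rm up}$, $c=\lim_{\xi\to-\infty}(e^{-i\theta}\Psi_{+,2})^{\rm dn}$, $\bar a=\lim_{\xi\to+\infty}(e^{-i\theta}\Psi_{-,2})^{\rm dn}$, $\bar c=\lim_{\xi\to-\infty}(e^{i\theta}\Psi_{+,1})^{\rm up}$ (up/dn: upper/lower $2\times 2$ block; $\Psi_{\pm,1},\Psi_{\pm,2}$: the first/second $4\times2$ block column, normalized as above at $\xi\to\pm\infty$). *Result.* In each of the following cases there is exactly one pair $(\mathbf u,x)$ as above, its transmission coefficients exist and are unique, and they are given as follows ($a_j,c_j$ for $\operatorname{Im}k\ge0$;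 $\bar a_j,\bar c_j$ for $\operatorname{Im}k\le0$; the forms containing a factor $[\cdots]$ hold for $k\notin\{\pm k_j,\pm k_j^*\}$). 1. **Fundamental soliton**: $\operatorname{Re}k_j\ne0$, $C_j=(\boldsymbol\gamma_j,\mathbf 0)$, $\boldsymbol\gamma_j\neq0$. With $\mathbf p_j=\boldsymbol\gamma_j^*/\|\boldsymbol\gamma_j\|$, $$a_j(k)=\mathrm{diag}\Big(\tfrac{k_j^*}{k_j}\tfrac{k-k_j}{k-k_j^*},\ \tfrac{k_j}{k_j^*}\tfrac{k+k_j^*}{k+k_j}\Big),\qquad \bar c_j(k)=\mathrm{diag}\Big(\tfrac{k_j}{k_j^*}\tfrac{k-k_j^*}{k-k_j},\ \tfrac{k_j^*}{k_j}\tfrac{k+k_j}{k+k_j^*}\Big),$$ $$\bar a_j(k)=I_2+\tfrac{k}{k_j^*}\tfrac{k_j^*-k_j}{k-k_j}\tfrac{C_j\bar C_j}{\|\boldsymbol\gamma_j\|^2}+\tfrac{k}{k_j}\tfrac{k_j-k_j^*}{k+k_j^*}\tfrac{\tilde C_j\bar{\tilde C}_j}{\|\boldsymbol\gamma_j\|^2}=\tfrac{k_j^*}{k_j}\tfrac{k+k_j}{k+k_j^*}\Big[I_2+\tfrac{k^2(k_j^2-(k_j^*)^2)}{(k_j^*)^2(k^2-k_j^2)}\mathbf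 p_j^*\mathbf p_j^T\Big],$$ $$c_j(k)=I_2+\tfrac{k}{k_j}\tfrac{k_j-k_j^*}{k-k_j^*}\tfrac{C_j\bar C_j}{\|\boldsymbol\gamma_j\|^2}+\tfrac{k}{k_j^*}\tfrac{k_j^*-k_j}{k+k_j}\tfrac{\tilde C_j\bar{\tilde C}_j}{\|\boldsymbol\gamma_j\|^2}=\tfrac{k_j}{k_j^*}\tfrac{k+k_j^*}{k+k_j}\Big[I_2+\tfrac{k^2((k_j^*)^2-k_j^2)}{k_j^2(k^2-(k_j^*)^2)}\mathbf p_j^*\mathbf p_j^T\Big].$$ In particular $a_j,\bar c_j$ are diagonal and independent of the norming constant. 2. **Fundamental breather**: $\operatorname{Re}k_j\ne0$, $C_j=(\mu_j\boldsymbol\gamma_j,\kappa_j\boldsymbol\gamma_j)$, $\boldsymbol\gamma_j\ne0$, $(\mu_j,\kappa_j)\neq(0,0)$. With $\boldsymbol\delta_j=(\mu_j^*,\kappa_j^*)^T$, $\hat{\boldsymbol\delta}_j=\boldsymbol\delta_j^\perp$, $\hat{\boldsymbol\gamma}_j=\boldsymbol\gamma_j^\perp$, $\mathbf p_j=\boldsymbol\gamma_j^*/\|\boldsymbol\gamma_j\|$,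 $\mathbf q_j=\boldsymbol\delta_j^*/\|\boldsymbol\delta_j\|$, $$a_j(k)=I_2-\tfrac{k}{k_j}\tfrac{k_j-k_j^*}{k-k_j^*}\tfrac{\boldsymbol\delta_j\boldsymbol\delta_j^\dagger}{\|\boldsymbol\delta_j\|^2}+\tfrac{k}{k_j^*}\tfrac{k_j-k_j^*}{k+k_j}\tfrac{\hat{\boldsymbol\delta}_j\hat{\boldsymbol\delta}_j^\dagger}{\|\boldsymbol\delta_j\|^2}=\tfrac{k_j}{k_j^*}\tfrac{k+k_j^*}{k+k_j}\Big[I_2+\tfrac{k^2((k_j^*)^2-k_j^2)}{k_j^2(k^2-(k_j^*)^2)}\mathbf q_j^*\mathbf q_j^T\Big],$$ $$\bar c_j(k)=I_2-\tfrac{k}{k_j^*}\tfrac{k_j^*-k_j}{k-k_j}\tfrac{\boldsymbol\delta_j\boldsymbol\delta_j^\dagger}{\|\boldsymbol\delta_j\|^2}+\tfrac{k}{k_j}\tfrac{k_j^*-k_j}{k+k_j^*}\tfrac{\hat{\boldsymbol\delta}_j\hat{\boldsymbol\delta}_j^\dagger}{\|\boldsymbol\delta_j\|^2}=\tfrac{k_j^*}{k_j}\tfrac{k+k_j}{k+k_j^*}\Big[I_2+\tfrac{k^2(k_j^2-(k_j^*)^2)}{(k_j^*)^2(k^2-k_j^2)}\mathbf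 q_j^*\mathbf q_j^T\Big],$$ and $c_j$, $\bar a_j$ are given by the expressions for $a_j$, $\bar c_j$, respectively, with $\boldsymbol\delta_j,\hat{\boldsymbol\delta}_j,\mathbf q_j$ replaced by $\boldsymbol\gamma_j,\hat{\boldsymbol\gamma}_j,\mathbf p_j$. 3. **Self-symmetric soliton**: $k_j=i\nu_j$, $\nu_j>0$, $C_j=(\boldsymbol\gamma_j,-\boldsymbol\gamma_j^\perp)$, $\boldsymbol\gamma_j\neq0$: $$a_j(k)=c_j(k)=\frac{k_j-k}{k_j+k}I_2,\qquad \bar a_j(k)=\bar c_j(k)=\frac{k_j^*-k}{k_j^*+k}I_2,$$ which are scalar multiples of the identity and independent of the norming constant. -/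

import Mathlib

open Filter Topology
open scoped ComplexConjugate Matrix

noncomputable section

/-- `2 × 2` complex matrices. -/
abbrev Mat2 := Matrix (Fin 2) (Fin 2) ℂ

/-- `4 × 4` complex matrices, written in `2 × 2` blocks. -/
abbrev Mat4 := Matrix (Fin 2 ⊕ Fin 2) (Fin 2 ⊕ Fin 2) ℂ

/-- A block column of a `4 × 4` matrix: a `4 × 2` matrix. Its upper and lower blocks are
`Matrix.toRows₁` and `Matrix.toRows₂`. -/
abbrev Mat42 := Matrix (Fin 2 ⊕ Fin 2) (Fin 2) ℂ

/-! ### Vectors and norming constants -/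

/-- The Euclidean norm on `ℂ²`. -/
def euclNorm (v : Fin 2 → ℂ) : ℝ := ‖(WithLp.toLp 2 v : EuclideanSpace ℂ (Fin 2))‖

/-- `v^⊥ = (-v₂^*, v₁^*)^T`. -/
def perp (v : Fin 2 → ℂ) : Fin 2 → ℂ := ![-conj (v 1), conj (v 0)]

/-- The unit polarization vector `v^* / ‖v‖`. -/
def polarization (v : Fin 2 → ℂ) : Fin 2 → ℂ := fun i => conj (v i) / (euclNorm v : ℂ)

/-- The rank-one matrix `v v^†`. -/
def dyad (v : Fin 2 → ℂ) : Mat2 := Matrix.vecMulVec v (star v)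

/-- The rank-one matrix `p^* p^T`. -/
def polDyad (p : Fin 2 → ℂ) : Mat2 := Matrix.vecMulVec (star p) p

/-- The second Pauli matrix. -/
def pauli2 : Mat2 := !![0, -Complex.I; Complex.I, 0]

/-- `C̄ = -C^†`. -/
def normBar (C : Mat2) : Mat2 := -Cᴴ

/-- `C̃ = -σ₂ C^* σ₂`, where `C^*` is the entrywise complex conjugate. -/
def normTilde (C : Mat2) : Mat2 := -(pauli2 * C.map (starRingEnd ℂ) * pauli2)

/-- The norming constant `(γ, 0)` of a fundamental soliton. -/
def fundamentalNorming (γ : Fin 2 → ℂ) : Mat2 := Matrix.of fun i => ![γ i, 0]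

/-- The norming constant `(μ γ, κ γ)` of a fundamental breather. -/
def breatherNorming (γ : Fin 2 → ℂ) (μ κ : ℂ) : Mat2 := Matrix.of fun i => ![μ * γ i, κ * γ i]

/-- The norming constant `(γ, -γ^⊥)` of a self-symmetric soliton. -/
def selfSymmNorming (γ : Fin 2 → ℂ) : Mat2 := Matrix.of fun i => ![γ i, -perp γ i]

/-! ### Pure soliton solutions from the Riemann-Hilbert problem -/

/-- `θ(ξ, t, k) = k ξ - t / (4 k)`. -/
def phase (k : ℂ) (ξ t : ℝ) : ℂ := k * ξ - t / (4 * k)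

/-- The reflectionless Riemann-Hilbert problem at the point `(ξ, t)`. The block columns `M₁, M₂`
of the eigenfunction `(M₁(k), M₂(k))`, normalized to the identity at `k = ∞`, have simple poles at
the points `κ n` (first block column) and `κ' n` (second block column), and
`Res_{k = κ n} M₁ = e^{2iθ(κ n)} M₂(κ n) D n`, `Res_{k = κ' n} M₂ = e^{-2iθ(κ' n)} M₁(κ' n) D' n`. -/
structure IsReflectionlessRHP {N : ℕ} (κ : Fin N → ℂ) (D : Fin N → Mat2) (κ' : Fin N → ℂ)
    (D' : Fin N → Mat2) (ξ t : ℝ) (M₁ M₂ : ℂ → Mat42) : Prop where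
  col₁ : ∀ k : ℂ, (∀ n, k ≠ κ n) →
    M₁ k = Matrix.fromRows 1 0 +
      ∑ n, (Complex.exp (2 * Complex.I * phase (κ n) ξ t) / (k - κ n)) • (M₂ (κ n) * D n)
  col₂ : ∀ k : ℂ, (∀ n, k ≠ κ' n) →
    M₂ k = Matrix.fromRows 0 1 +
      ∑ n, (Complex.exp (-2 * Complex.I * phase (κ' n) ξ t) / (k - κ' n)) • (M₁ (κ' n) * D' n)

/-- The pure soliton solution, in the parametric form `u = u(ξ, t)`, `x = x(ξ, t)`, with the given
poles and norming constants. With `N(k) = M(0)⁻¹ M(k)`, where `M = (M₁, M₂)` solves the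
reflectionless Riemann-Hilbert problem, `u = lim_{k → 0} (i/k) (N₁₃, N₁₄)` and
`x - ξ = lim_{k → 0} (i/k) (N₁₁ - 1)`. -/
def IsPureSoliton {N : ℕ} (κ : Fin N → ℂ) (D : Fin N → Mat2) (κ' : Fin N → ℂ) (D' : Fin N → Mat2)
    (u : ℝ → ℝ → Fin 2 → ℂ) (x : ℝ → ℝ → ℝ) : Prop :=
  ∃ M₁ M₂ : ℝ → ℝ → ℂ → Mat42, ∀ ξ t : ℝ,
    IsReflectionlessRHP κ D κ' D' ξ t (M₁ ξ t) (M₂ ξ t) ∧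
    (∀ j : Fin 2, Tendsto
      (fun k : ℂ => Complex.I / k *
        ((Matrix.fromCols (M₁ ξ t 0) (M₂ ξ t 0) : Mat4)⁻¹ *
          (Matrix.fromCols (M₁ ξ t k) (M₂ ξ t k) : Mat4)) (Sum.inl 0) (Sum.inr j))
      (𝓝[≠] 0) (𝓝 (u ξ t j))) ∧
    Tendsto
      (fun k : ℂ => Complex.I / k *
        (((Matrix.fromCols (M₁ ξ t 0) (M₂ ξ t 0) : Mat4)⁻¹ *
          (Matrix.fromCols (M₁ ξ t k) (M₂ ξ t k) : Mat4)) (Sum.inl 0) (Sum.inl 0) - 1))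
      (𝓝[≠] 0) (𝓝 ((x ξ t - ξ : ℝ) : ℂ))

/-- The one-soliton solution of the quartet `{k₁, -k₁^*, k₁^*, -k₁}` with norming constants
`C, C̃, C̄` and the tilde of `C̄`. -/
def IsQuartetSoliton (k₁ : ℂ) (C : Mat2) (u : ℝ → ℝ → Fin 2 → ℂ) (x : ℝ → ℝ → ℝ) : Prop :=
  IsPureSoliton ![k₁, -conj k₁] ![C, normTilde C] ![conj k₁, -k₁]
    ![normBar C, normTilde (normBar C)] u x

/-- The one-soliton solution of the pair `{k₁, k₁^*}`, for a self-symmetric (purely imaginary)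
eigenvalue `k₁`, with norming constants `C, C̄`. -/
def IsSelfSymmetricSoliton (k₁ : ℂ) (C : Mat2) (u : ℝ → ℝ → Fin 2 → ℂ) (x : ℝ → ℝ → ℝ) : Prop :=
  IsPureSoliton ![k₁] ![C] ![conj k₁] ![normBar C] u x

/-! ### Direct scattering -/

/-- The potential matrix `U` built from the vector `w = (w₁, w₂)`. -/
def potU (w : Fin 2 → ℂ) : Mat2 :=
  !![-Complex.I * w 0, -Complex.I * w 1; Complex.I * conj (w 1), -Complex.I * conj (w 0)]

/-- `V₀`, with off-diagonal blocks `U` and `V = U^†`. It is real linear in `w`, so that the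
`ξ`-derivative of `V₀(u)` is `V₀(u_ξ)`. -/
def potV0 (w : Fin 2 → ℂ) : Mat4 := Matrix.fromBlocks 0 (potU w) (potU w)ᴴ 0

/-- `Σ₃ = diag(1, 1, -1, -1)`. -/
def sigma3 : Mat4 := Matrix.fromBlocks 1 0 0 (-1)

/-- The coefficient of the `ξ`-part of the Lax pair, `-i k ρ Σ₃ + k Σ₃ V_{0,ξ}`, `ρ = ∂x/∂ξ`. -/
def laxSpace (u : ℝ → ℝ → Fin 2 → ℂ) (x : ℝ → ℝ → ℝ) (k : ℂ) (ξ t : ℝ) : Mat4 :=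
  (-Complex.I * k * ((deriv (fun s => x s t) ξ : ℝ) : ℂ)) • sigma3 +
    k • (sigma3 * potV0 (fun j => deriv (fun s => u s t j) ξ))

/-- The coefficient of the `t`-part of the Lax pair, `(i / 4k) Σ₃ - (i / 2) V₀`. -/
def laxTime (u : ℝ → ℝ → Fin 2 → ℂ) (k : ℂ) (ξ t : ℝ) : Mat4 :=
  (Complex.I / (4 * k)) • sigma3 - (Complex.I / 2) • potV0 (u ξ t)

/-- Simultaneous solutions of the Lax pair `Ψ_ξ = R Ψ`, `Ψ_t = S Ψ` of the complex coupled short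
pulse equation in the variables `(ξ, t)`, i.e. `Ψ(ξ, t) = Φ(x(ξ, t), t)` for a solution `Φ` of the
Lax pair in `(x, t)` wherever `ρ = ∂x/∂ξ ≠ 0`. -/
structure IsLaxSolution {n : Type} (u : ℝ → ℝ → Fin 2 → ℂ) (x : ℝ → ℝ → ℝ) (k : ℂ)
    (Ψ : ℝ → ℝ → Matrix (Fin 2 ⊕ Fin 2) n ℂ) : Prop where
  space : ∀ ξ t i j, HasDerivAt (fun s => Ψ s t i j) ((laxSpace u x k ξ t * Ψ ξ t) i j) ξ
  time : ∀ ξ t i j, HasDerivAt (fun s => Ψ ξ s i j) ((laxTime u k ξ t * Ψ ξ t) i j) t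

/-- `e^{iθ Σ₃}`. -/
def expPhase (k : ℂ) (ξ t : ℝ) : Mat4 :=
  Matrix.fromBlocks (Complex.exp (Complex.I * phase k ξ t) • 1) 0
    0 (Complex.exp (-Complex.I * phase k ξ t) • 1)

/-- The `4 × 4` Jost solution: `Ψ ∼ e^{-iθ Σ₃}` at the end `l` of the `ξ`-axis. -/
def IsJost (u : ℝ → ℝ → Fin 2 → ℂ) (x : ℝ → ℝ → ℝ) (k : ℂ) (l : Filter ℝ)
    (Ψ : ℝ → ℝ → Mat4) : Prop :=
  IsLaxSolution u x k Ψ ∧ ∀ t, Tendsto (fun ξ => Ψ ξ t * expPhase k ξ t) l (𝓝 1)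

/-- The first modified block column `e^{iθ} Ψ` of a `4 × 2` matrix solution `Ψ`. -/
def mod₁ (k : ℂ) (Ψ : ℝ → ℝ → Mat42) (ξ t : ℝ) : Mat42 :=
  Complex.exp (Complex.I * phase k ξ t) • Ψ ξ t

/-- The second modified block column `e^{-iθ} Ψ` of a `4 × 2` matrix solution `Ψ`. -/
def mod₂ (k : ℂ) (Ψ : ℝ → ℝ → Mat42) (ξ t : ℝ) : Mat42 :=
  Complex.exp (-Complex.I * phase k ξ t) • Ψ ξ t

/-- First block column of the Jost solution at the end `l`: `M = e^{iθ} Ψ → (I₂; 0)`. -/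
def IsJostCol₁ (u : ℝ → ℝ → Fin 2 → ℂ) (x : ℝ → ℝ → ℝ) (k : ℂ) (l : Filter ℝ)
    (Ψ : ℝ → ℝ → Mat42) : Prop :=
  IsLaxSolution u x k Ψ ∧ ∀ t, Tendsto (fun ξ => mod₁ k Ψ ξ t) l (𝓝 (Matrix.fromRows 1 0))

/-- Second block column of the Jost solution at the end `l`: `M = e^{-iθ} Ψ → (0; I₂)`. -/
def IsJostCol₂ (u : ℝ → ℝ → Fin 2 → ℂ) (x : ℝ → ℝ → ℝ) (k : ℂ) (l : Filter ℝ)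
    (Ψ : ℝ → ℝ → Mat42) : Prop :=
  IsLaxSolution u x k Ψ ∧ ∀ t, Tendsto (fun ξ => mod₂ k Ψ ξ t) l (𝓝 (Matrix.fromRows 0 1))

/-- `a, ā` are the (inverses of the) left and `c, c̄` the (inverses of the) right transmission
coefficients of the potential `(u, x)`. For real `k ≠ 0` they are the diagonal blocks of the
scattering matrix `S(k)`, defined by `Ψ_- = Ψ_+ S`, and of `S(k)⁻¹`; `a, c` extend analytically to
the upper and `ā, c̄` to the lower half plane, where they are the limits of the corresponding blocks
of the analytic modified Jost columns at the other end of the axis. -/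
structure IsTransmissionData (u : ℝ → ℝ → Fin 2 → ℂ) (x : ℝ → ℝ → ℝ)
    (a abar c cbar : ℂ → Mat2) : Prop where
  analytic_upper : ∀ i j, DiffContOnCl ℂ (fun k => a k i j) {k | 0 < k.im} ∧
    DiffContOnCl ℂ (fun k => c k i j) {k | 0 < k.im}
  analytic_lower : ∀ i j, DiffContOnCl ℂ (fun k => abar k i j) {k | k.im < 0} ∧
    DiffContOnCl ℂ (fun k => cbar k i j) {k | k.im < 0}
  exists_jost : ∀ k : ℝ, k ≠ 0 → (∃ Ψ, IsJost u x k atBot Ψ) ∧ (∃ Ψ, IsJost u x k atTop Ψ)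
  scattering : ∀ k : ℝ, k ≠ 0 → ∀ Ψm Ψp : ℝ → ℝ → Mat4,
    IsJost u x k atBot Ψm → IsJost u x k atTop Ψp →
    ∃ S : Mat4, (∀ ξ t, Ψm ξ t = Ψp ξ t * S) ∧ IsUnit S ∧
      S.toBlocks₁₁ = a k ∧ S.toBlocks₂₂ = abar k ∧
      (S⁻¹).toBlocks₁₁ = cbar k ∧ (S⁻¹).toBlocks₂₂ = c k
  exists_upper : ∀ k : ℂ, 0 < k.im →
    (∃ Ψ, IsJostCol₁ u x k atBot Ψ) ∧ (∃ Ψ, IsJostCol₂ u x k atTop Ψ)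
  exists_lower : ∀ k : ℂ, k.im < 0 →
    (∃ Ψ, IsJostCol₁ u x k atTop Ψ) ∧ (∃ Ψ, IsJostCol₂ u x k atBot Ψ)
  lim_a : ∀ k : ℂ, 0 < k.im → ∀ Ψ, IsJostCol₁ u x k atBot Ψ →
    ∀ t, Tendsto (fun ξ => (mod₁ k Ψ ξ t).toRows₁) atTop (𝓝 (a k))
  lim_c : ∀ k : ℂ, 0 < k.im → ∀ Ψ, IsJostCol₂ u x k atTop Ψ →
    ∀ t, Tendsto (fun ξ => (mod₂ k Ψ ξ t).toRows₂) atBot (𝓝 (c k))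
  lim_abar : ∀ k : ℂ, k.im < 0 → ∀ Ψ, IsJostCol₂ u x k atBot Ψ →
    ∀ t, Tendsto (fun ξ => (mod₂ k Ψ ξ t).toRows₂) atTop (𝓝 (abar k))
  lim_cbar : ∀ k : ℂ, k.im < 0 → ∀ Ψ, IsJostCol₁ u x k atTop Ψ →
    ∀ t, Tendsto (fun ξ => (mod₁ k Ψ ξ t).toRows₁) atBot (𝓝 (cbar k))

/-- The conditions `P` on `(u, x)` are satisfied by exactly one pair, and the (inverses of the)
transmission coefficients of this pair exist and are the functions `A, Abar, Cc, Cbar`: `a = A`,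
`c = Cc` on the closed upper and `ā = Abar`, `c̄ = Cbar` on the closed lower half plane. -/
def HasTransmissionCoefficients
    (P : (ℝ → ℝ → Fin 2 → ℂ) → (ℝ → ℝ → ℝ) → Prop) (A Abar Cc Cbar : ℂ → Mat2) : Prop :=
  (∃! s : (ℝ → ℝ → Fin 2 → ℂ) × (ℝ → ℝ → ℝ), P s.1 s.2) ∧
  ∀ u x, P u x → ∀ a abar c cbar : ℂ → Mat2,
    IsTransmissionData u x a abar c cbar ↔
      (∀ k : ℂ, 0 ≤ k.im → a k = A k ∧ c k = Cc k) ∧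
      (∀ k : ℂ, k.im ≤ 0 → abar k = Abar k ∧ cbar k = Cbar k)

end

/-! ### Block matrices that are diagonal in adapted frames -/

/-! All three families come from a norming constant of rank one, `C = γ δ^†`. The fundamental
soliton has `δ = (1, 0)` and the breather `δ = (μ^*, κ^*)`. The self-symmetric constant is `C + C̃`
for `C = γ (1, 0)`, in the case where the poles `k₁` and `-k₁^*` coincide. Let `E`, `G` be the
unitary frames with columns proportional to `δ, δ^⊥` and `γ, γ^⊥`. Since `C̃ = -γ^⊥ δ^⊥^†`, the
constant `C` links only the first columns of the frames and `C̃` only the second ones. In these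
frames every `2 × 2` block is diagonal (`lift`), and the problem splits into two independent
one-pole problems, with poles `κ_j = k₁, -k₁^*`.

Each one-pole problem is explicit. Let `τ_j` be the suitable multiple of `e^{2iθ(κ_j)}`, `P_j` the
orthogonal projector onto `(1, τ_j)`, and `f_j = κ_j^*(k - κ_j) / (κ_j(k - κ_j^*))`. Then `(1 + (f_j
- 1) P_j) e^{-iθσ₃}` solves the Lax pair of the soliton read off from `P_j` (`dress_space`,
`dress_time`). At fixed `(ξ, t)` the Riemann-Hilbert problem is a linear system of determinant `1 +
|τ_j|² ≠ 0`, hence uniquely solvable (`isQuartetRHP_unique`); expanding `M(0)⁻¹ M(k)` at `k = 0`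
yields the closed form of the soliton (`isQuartetSoliton_iff`).

As `ξ → +∞`, `τ_j → 0` and `P_j → diag(1, 0)`; as `ξ → -∞`, `|τ_j| → ∞` and `P_j → diag(0, 1)`.
After removal of the exponentials the dressed solution therefore tends to `diag(f_j, 1)` and
`diag(1, f_j)`. Comparing the two ends gives `a = E diag(f) E^†` and `c = G diag(f) G^†`, and `1/f`
in place of `f` for the two lower coefficients (`isTransmissionData_sol_iff`). The displayed
formulas are algebra from there.

The coefficients are defined through arbitrary Jost solutions, so these have to be unique. The
spatial Lax operator is `-ikH` with `H` a Hermitian involution, because `ρ² + ‖u_ξ‖² = 1`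
(`exists_laxSpace_eq`). Hence `‖Ψ‖²` grows at rate at most `2|Im k|`, exactly the rate of the Jost
normalization, and the difference of two Jost solutions vanishes (`lax_eq_zero`). -/

/-- The `4 × 4` matrix whose blocks are diagonal with respect to the frames `E` and `G`. -/
def lift (E G : Mat2) (a b c d : Fin 2 → ℂ) : Mat4 :=
  Matrix.fromBlocks (E * Matrix.diagonal a * Eᴴ) (E * Matrix.diagonal b * Gᴴ)
    (G * Matrix.diagonal c * Eᴴ) (G * Matrix.diagonal d * Gᴴ)

lemma frame_mul {E F G : Mat2} (hF : Fᴴ * F = 1) (a b : Fin 2 → ℂ) :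
    (E * Matrix.diagonal a * Fᴴ) * (F * Matrix.diagonal b * Gᴴ) =
      E * Matrix.diagonal (a * b) * Gᴴ := by
  calc (E * Matrix.diagonal a * Fᴴ) * (F * Matrix.diagonal b * Gᴴ)
      = E * Matrix.diagonal a * (Fᴴ * F) * Matrix.diagonal b * Gᴴ := by
        simp only [Matrix.mul_assoc]
    _ = E * (Matrix.diagonal a * Matrix.diagonal b) * Gᴴ := by
        rw [hF]; simp only [Matrix.mul_assoc, Matrix.one_mul]
    _ = _ := by rw [Matrix.diagonal_mul_diagonal]; rfl

lemma frame_add (E G : Mat2) (a b : Fin 2 → ℂ) :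
    E * Matrix.diagonal a * Gᴴ + E * Matrix.diagonal b * Gᴴ =
      E * Matrix.diagonal (a + b) * Gᴴ := by
  rw [← Matrix.add_mul, ← Matrix.mul_add, Matrix.diagonal_add]; rfl

lemma frame_smul (E G : Mat2) (r : ℂ) (a : Fin 2 → ℂ) :
    r • (E * Matrix.diagonal a * Gᴴ) = E * Matrix.diagonal (r • a) * Gᴴ := by
  rw [Matrix.diagonal_smul, Matrix.mul_smul, Matrix.smul_mul]

lemma frame_one {E : Mat2} (hE : Eᴴ * E = 1) : E * Matrix.diagonal 1 * Eᴴ = 1 := by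
  have : E * Eᴴ = 1 := mul_eq_one_comm.mp hE
  rw [show Matrix.diagonal (1 : Fin 2 → ℂ) = 1 from Matrix.diagonal_one, Matrix.mul_one, this]

lemma frame_const {E : Mat2} (hE : Eᴴ * E = 1) (z : ℂ) :
    E * Matrix.diagonal (fun _ => z) * Eᴴ = z • 1 := by
  rw [← frame_one hE, frame_smul]; congr 3; ext; simp

lemma frame_zero (E G : Mat2) : E * Matrix.diagonal (0 : Fin 2 → ℂ) * Gᴴ = 0 := by
  rw [show Matrix.diagonal (0 : Fin 2 → ℂ) = 0 from Matrix.diagonal_zero]; simp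

lemma frame_conjTranspose (E G : Mat2) (a : Fin 2 → ℂ) :
    (E * Matrix.diagonal a * Gᴴ)ᴴ = G * Matrix.diagonal (star a) * Eᴴ := by
  simp [Matrix.conjTranspose_mul, Matrix.diagonal_conjTranspose, Matrix.mul_assoc]

lemma frame_apply (E G : Mat2) (a : Fin 2 → ℂ) (i j : Fin 2) :
    (E * Matrix.diagonal a * Gᴴ) i j = ∑ l, E i l * a l * conj (G j l) := by
  simp [Matrix.mul_apply, Matrix.diagonal_apply]

section lift

variable {E G : Mat2}

/-- Through `lift` a pair of `2 × 2` matrices, one per frame direction, acts as a `4 × 4` matrix.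
Products are taken direction by direction, so all later matrix identities reduce to scalar ones. -/
lemma lift_mul (hE : Eᴴ * E = 1) (hG : Gᴴ * G = 1) (a b c d a' b' c' d' : Fin 2 → ℂ) :
    lift E G a b c d * lift E G a' b' c' d' =
      lift E G (a * a' + b * c') (a * b' + b * d') (c * a' + d * c') (c * b' + d * d') := by
  simp only [lift, Matrix.fromBlocks_multiply, frame_mul hE, frame_mul hG, frame_add]

lemma lift_add (a b c d a' b' c' d' : Fin 2 → ℂ) :
    lift E G a b c d + lift E G a' b' c' d' = lift E G (a + a') (b + b') (c + c') (d + d') := by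
  simp only [lift, Matrix.fromBlocks_add, frame_add]

lemma lift_smul (r : ℂ) (a b c d : Fin 2 → ℂ) :
    r • lift E G a b c d = lift E G (r • a) (r • b) (r • c) (r • d) := by
  simp only [lift, Matrix.fromBlocks_smul, frame_smul]

lemma lift_sub (a b c d a' b' c' d' : Fin 2 → ℂ) :
    lift E G a b c d - lift E G a' b' c' d' = lift E G (a - a') (b - b') (c - c') (d - d') := by
  rw [sub_eq_add_neg, ← neg_one_smul ℂ (lift E G a' b' c' d'), lift_smul, lift_add]
  congr 1 <;> ext <;> simp [sub_eq_add_neg]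

lemma lift_one (hE : Eᴴ * E = 1) (hG : Gᴴ * G = 1) : lift E G 1 0 0 1 = 1 := by
  simp only [lift, frame_one hE, frame_one hG, frame_zero, Matrix.fromBlocks_one]

lemma lift_sigma3 (hE : Eᴴ * E = 1) (hG : Gᴴ * G = 1) : lift E G 1 0 0 (-1) = sigma3 := by
  have h : G * Matrix.diagonal (-1 : Fin 2 → ℂ) * Gᴴ = -1 := by
    have := frame_const hG (-1)
    rw [neg_one_smul] at this
    exact this
  simp only [lift, frame_one hE, frame_zero, sigma3, h]

lemma lift_conjTranspose (a b c d : Fin 2 → ℂ) :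
    (lift E G a b c d)ᴴ = lift E G (star a) (star c) (star b) (star d) := by
  simp only [lift, Matrix.fromBlocks_conjTranspose, frame_conjTranspose]

lemma tendsto_frame_apply {E G : Mat2} {α : Type*} {l : Filter α} {a : α → Fin 2 → ℂ}
    {a' : Fin 2 → ℂ} (ha : ∀ j, Tendsto (fun x => a x j) l (𝓝 (a' j))) (i j : Fin 2) :
    Tendsto (fun x => (E * Matrix.diagonal (a x) * Gᴴ) i j) l
      (𝓝 ((E * Matrix.diagonal a' * Gᴴ) i j)) := by
  simp only [frame_apply]
  exact tendsto_finsetSum _ fun l _ => ((ha l).const_mul _).mul_const _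

lemma tendsto_lift {α : Type*} {l : Filter α} {a b c d : α → Fin 2 → ℂ} {a' b' c' d' : Fin 2 → ℂ}
    (ha : ∀ j, Tendsto (fun x => a x j) l (𝓝 (a' j)))
    (hb : ∀ j, Tendsto (fun x => b x j) l (𝓝 (b' j)))
    (hc : ∀ j, Tendsto (fun x => c x j) l (𝓝 (c' j)))
    (hd : ∀ j, Tendsto (fun x => d x j) l (𝓝 (d' j))) :
    Tendsto (fun x => lift E G (a x) (b x) (c x) (d x)) l (𝓝 (lift E G a' b' c' d')) := by
  refine tendsto_pi_nhds.2 fun i => tendsto_pi_nhds.2 fun j => ?_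
  rcases i with i | i <;> rcases j with j | j <;> simp only [lift, Matrix.fromBlocks_apply₁₁,
    Matrix.fromBlocks_apply₁₂, Matrix.fromBlocks_apply₂₁, Matrix.fromBlocks_apply₂₂]
  exacts [tendsto_frame_apply ha i j, tendsto_frame_apply hb i j, tendsto_frame_apply hc i j,
    tendsto_frame_apply hd i j]

lemma hasDerivAt_frame (E G : Mat2) {a : ℝ → Fin 2 → ℂ} {a' : Fin 2 → ℂ} {s : ℝ}
    (ha : ∀ j, HasDerivAt (fun x => a x j) (a' j) s) (i j : Fin 2) :
    HasDerivAt (fun x => (E * Matrix.diagonal (a x) * Gᴴ) i j)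
      ((E * Matrix.diagonal a' * Gᴴ) i j) s := by
  simp only [frame_apply]
  exact HasDerivAt.fun_sum fun l _ => ((ha l).const_mul _).mul_const _

lemma hasDerivAt_lift {a b c d : ℝ → Fin 2 → ℂ} {a' b' c' d' : Fin 2 → ℂ} {s : ℝ}
    (ha : ∀ j, HasDerivAt (fun x => a x j) (a' j) s)
    (hb : ∀ j, HasDerivAt (fun x => b x j) (b' j) s)
    (hc : ∀ j, HasDerivAt (fun x => c x j) (c' j) s)
    (hd : ∀ j, HasDerivAt (fun x => d x j) (d' j) s) (i j : Fin 2 ⊕ Fin 2) :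
    HasDerivAt (fun x => lift E G (a x) (b x) (c x) (d x) i j) (lift E G a' b' c' d' i j) s := by
  rcases i with i | i <;> rcases j with j | j <;> simp only [lift, Matrix.fromBlocks_apply₁₁,
    Matrix.fromBlocks_apply₁₂, Matrix.fromBlocks_apply₂₁, Matrix.fromBlocks_apply₂₂]
  exacts [hasDerivAt_frame _ _ ha i j, hasDerivAt_frame _ _ hb i j, hasDerivAt_frame _ _ hc i j,
    hasDerivAt_frame _ _ hd i j]

lemma lift_expPhase (hE : Eᴴ * E = 1) (hG : Gᴴ * G = 1) (k : ℂ) (ξ t : ℝ) :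
    lift E G (fun _ => Complex.exp (Complex.I * phase k ξ t)) 0 0
      (fun _ => Complex.exp (-Complex.I * phase k ξ t)) = expPhase k ξ t := by
  simp only [lift, frame_const hE, frame_const hG, frame_zero, expPhase]

end lift

/-! ### The frame of a vector -/

/-- The special unitary matrix with columns `v / ‖v‖` and `v^⊥ / ‖v‖`. -/
noncomputable def unitFrame (v : Fin 2 → ℂ) : Mat2 :=
  (euclNorm v : ℂ)⁻¹ • !![v 0, -conj (v 1); v 1, conj (v 0)]

lemma euclNorm_sq (v : Fin 2 → ℂ) :
    (euclNorm v : ℂ) ^ 2 = v 0 * conj (v 0) + v 1 * conj (v 1) := by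
  have : (euclNorm v) ^ 2 = ‖v 0‖ ^ 2 + ‖v 1‖ ^ 2 := by
    rw [euclNorm, EuclideanSpace.norm_sq_eq]; simp
  rw [← Complex.ofReal_pow, this]
  simp [Complex.mul_conj, Complex.normSq_eq_norm_sq]

lemma euclNorm_pos {v : Fin 2 → ℂ} (hv : v ≠ 0) : 0 < euclNorm v := by
  unfold euclNorm
  rw [norm_pos_iff]
  intro h
  exact hv (by simpa using congrArg WithLp.ofLp h)

lemma unitFrame_apply₀ (v : Fin 2 → ℂ) (i : Fin 2) :
    unitFrame v i 0 = (euclNorm v : ℂ)⁻¹ * v i := by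
  fin_cases i <;> simp [unitFrame]

lemma unitFrame_apply₁ (v : Fin 2 → ℂ) (i : Fin 2) :
    unitFrame v i 1 = (euclNorm v : ℂ)⁻¹ * perp v i := by
  fin_cases i <;> simp [unitFrame, perp]

lemma unitFrame_unitary {v : Fin 2 → ℂ} (hv : v ≠ 0) : (unitFrame v)ᴴ * unitFrame v = 1 := by
  have h0 : (euclNorm v : ℂ) ≠ 0 := by exact_mod_cast (euclNorm_pos hv).ne'
  have h := euclNorm_sq v
  ext i j
  simp only [Matrix.mul_apply, Fin.sum_univ_two, Matrix.conjTranspose_apply, Matrix.one_apply]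
  fin_cases i <;> fin_cases j <;>
    simp [unitFrame_apply₀, unitFrame_apply₁, perp] <;> field_simp <;>
    first | ring1 | linear_combination -h

/-- The matrices of the form `potU` are `i` times the quaternions `(α, β; -β^*, α^*)`, a class
stable under multiplication by the frames on both sides; `diag(b, -b^*)` lies in it. The first row
determines the whole matrix. -/
lemma potU_frame (δ γ : Fin 2 → ℂ) (b : ℂ) :
    potU (fun j => Complex.I *
      (unitFrame δ * Matrix.diagonal ![b, -conj b] * (unitFrame γ)ᴴ) 0 j) =
      unitFrame δ * Matrix.diagonal ![b, -conj b] * (unitFrame γ)ᴴ := by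
  ext i j
  simp only [frame_apply, Fin.sum_univ_two, unitFrame_apply₀, unitFrame_apply₁]
  fin_cases i <;> fin_cases j <;>
    simp [potU, perp, ← mul_assoc] <;> ring

/-- `E diag(f) E^†` in terms of the dyads of the frame. -/
lemma unitFrame_diagonal {v : Fin 2 → ℂ} (hv : v ≠ 0) (f : Fin 2 → ℂ) :
    unitFrame v * Matrix.diagonal f * (unitFrame v)ᴴ =
      1 + ((f 0 - 1) / (euclNorm v : ℂ) ^ 2) • dyad v
        + ((f 1 - 1) / (euclNorm v : ℂ) ^ 2) • dyad (perp v) := by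
  have h0 : (euclNorm v : ℂ) ≠ 0 := by exact_mod_cast (euclNorm_pos hv).ne'
  have h := euclNorm_sq v
  ext i j
  simp only [frame_apply, Fin.sum_univ_two, unitFrame_apply₀, unitFrame_apply₁, Matrix.add_apply,
    Matrix.smul_apply, dyad, Matrix.vecMulVec_apply, Pi.star_apply, smul_eq_mul, Matrix.one_apply]
  fin_cases i <;> fin_cases j <;>
    simp [perp] <;> field_simp <;> first | ring1 | linear_combination -h

/-! ### Two-component dressing -/

/-- The flow along `s` of the entries `p` of the rank-one projector onto the direction `(1, τ)`;
`r` and `rb` are the logarithmic derivatives of `τ` and of its conjugate. -/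
structure ProjFlow (r rb : ℂ) (p₁₁ p₁₂ p₂₁ p₂₂ : ℝ → ℂ) : Prop where
  det : ∀ s, p₁₂ s * p₂₁ s = p₁₁ s * p₂₂ s
  trace : ∀ s, p₁₁ s + p₂₂ s = 1
  deriv₁₁ : ∀ s, HasDerivAt p₁₁ (-(r + rb) * (p₁₂ s * p₂₁ s)) s
  deriv₁₂ : ∀ s, HasDerivAt p₁₂ (p₁₂ s * (rb - (r + rb) * p₂₂ s)) s
  deriv₂₁ : ∀ s, HasDerivAt p₂₁ (p₂₁ s * (r - (r + rb) * p₂₂ s)) s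
  deriv₂₂ : ∀ s, HasDerivAt p₂₂ ((r + rb) * (p₁₂ s * p₂₁ s)) s

/-- The complementary projector flows with the opposite data. -/
lemma ProjFlow.compl {r rb : ℂ} {p₁₁ p₁₂ p₂₁ p₂₂ : ℝ → ℂ} (h : ProjFlow r rb p₁₁ p₁₂ p₂₁ p₂₂) :
    ProjFlow (-rb) (-r) p₂₂ (fun s => -p₁₂ s) (fun s => -p₂₁ s) p₁₁ where
  det s := by linear_combination h.det s
  trace s := by linear_combination h.trace s
  deriv₁₁ s := (h.deriv₂₂ s).congr_deriv (by ring)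
  deriv₁₂ s := (h.deriv₁₂ s).fun_neg.congr_deriv (by
    linear_combination p₁₂ s * (r + rb) * h.trace s)
  deriv₂₁ s := (h.deriv₂₁ s).fun_neg.congr_deriv (by
    linear_combination p₂₁ s * (r + rb) * h.trace s)
  deriv₂₂ s := (h.deriv₁₁ s).congr_deriv (by ring)

/-- When `τ` and its conjugate evolve by exponentials, the entries of the projector obey a closed
quadratic system. Here `τb` is a free second function, so that no conjugation has to be
differentiated. -/
lemma ProjFlow.of_tau {r rb : ℂ} {τ τb : ℝ → ℂ} (hτ : ∀ s, HasDerivAt τ (r * τ s) s)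
    (hτb : ∀ s, HasDerivAt τb (rb * τb s) s) (hD : ∀ s, 1 + τ s * τb s ≠ 0) :
    ProjFlow r rb (fun s => (1 + τ s * τb s)⁻¹) (fun s => τb s * (1 + τ s * τb s)⁻¹)
      (fun s => τ s * (1 + τ s * τb s)⁻¹) (fun s => τ s * τb s * (1 + τ s * τb s)⁻¹) := by
  have hd : ∀ s, HasDerivAt (fun s => (1 + τ s * τb s)⁻¹)
      (-((r + rb) * (τ s * τb s)) * (1 + τ s * τb s)⁻¹ ^ 2) s := fun s =>
    ((((hτ s).mul (hτb s)).const_add 1).fun_inv (hD s)).congr_deriv (by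
      simp only [Pi.mul_apply, div_eq_mul_inv, inv_pow]; ring)
  refine ⟨fun s => by ring, fun s => ?_, fun s => ?_, fun s => ?_, fun s => ?_, fun s => ?_⟩
  · have := hD s
    field_simp
  · exact (hd s).congr_deriv (by ring)
  · exact ((hτb s).mul (hd s)).congr_deriv (by ring)
  · refine ((hτ s).mul (hd s)).congr_deriv ?_
    have := hD s
    field_simp
    ring
  · refine (((hτ s).mul (hτb s)).mul (hd s)).congr_deriv ?_
    have := hD s
    simp only [Pi.mul_apply]
    field_simp
    ring

/-- `f - 1` for the Blaschke factor `f = κ^* (k - κ) / (κ (k - κ^*))`, with `κb = κ^*`. -/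
noncomputable def dressCoef (κ κb k : ℂ) : ℂ := k * (κb - κ) / (κ * (k - κb))

lemma dressCoef_mul {κ κb k : ℂ} (h0 : κ ≠ 0) (hb : κb ≠ 0) (h : k ≠ κ) (h' : k ≠ κb) :
    (1 + dressCoef κ κb k) * (1 + dressCoef κb κ k) = 1 := by
  have h1 := sub_ne_zero.2 h
  have h2 := sub_ne_zero.2 h'
  unfold dressCoef
  field_simp
  ring

/-- Together with `dressCoef_rel₂` this is all that the spatial equation uses about the dressing
factor and the amplitude `m`. -/
lemma dressCoef_rel₁ {κ κb k m : ℂ} (h0 : κ ≠ 0) (hb : κb ≠ 0) (h' : k ≠ κb)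
    (hm : m = (κ - κb) / (κ * κb)) :
    (κ - κb) * dressCoef κ κb k = k * m * (κ - κb + dressCoef κ κb k * κ) := by
  have hk := sub_ne_zero.2 h'
  rw [hm, dressCoef]
  field_simp
  ring

lemma dressCoef_rel₂ {κ κb k m : ℂ} (h0 : κ ≠ 0) (hb : κb ≠ 0) (h' : k ≠ κb)
    (hm : m = (κ - κb) / (κ * κb)) :
    dressCoef κ κb k * (κb - k) = k * m * κb := by
  have hk := sub_ne_zero.2 h'
  rw [hm, dressCoef]
  field_simp
  ring

section dressing

variable {κ κb k m : ℂ} {p₁₁ p₁₂ p₂₁ p₂₂ φ : ℝ → ℂ}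

/-- In matrix form: `Φ = (1 + gP) e^{-iφσ₃}` satisfies `Φ' = k(-iσ₃ + m P')Φ`. The trace of `P` is
constant, so the lower right entry of `P'` is `-d₁₁`. -/
lemma dress_space (h0 : κ ≠ 0) (hb : κb ≠ 0) (h' : k ≠ κb) (hm : m = (κ - κb) / (κ * κb))
    (hp : ProjFlow (2 * Complex.I * κ) (-2 * Complex.I * κb) p₁₁ p₁₂ p₂₁ p₂₂)
    (hφ : ∀ s, HasDerivAt φ k s) (s : ℝ) :
    let g := dressCoef κ κb k
    let d₁₁ := -(2 * Complex.I * κ + -2 * Complex.I * κb) * (p₁₂ s * p₂₁ s)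
    let d₁₂ := p₁₂ s * (-2 * Complex.I * κb - (2 * Complex.I * κ + -2 * Complex.I * κb) * p₂₂ s)
    let d₂₁ := p₂₁ s * (2 * Complex.I * κ - (2 * Complex.I * κ + -2 * Complex.I * κb) * p₂₂ s)
    let e := fun s => Complex.exp (-Complex.I * φ s)
    let e' := fun s => Complex.exp (Complex.I * φ s)
    HasDerivAt (fun s => (1 + g * p₁₁ s) * e s)
      (k * (-Complex.I + m * d₁₁) * ((1 + g * p₁₁ s) * e s) +
        k * m * d₁₂ * (g * p₂₁ s * e s)) s ∧
    HasDerivAt (fun s => g * p₂₁ s * e s)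
      (k * m * d₂₁ * ((1 + g * p₁₁ s) * e s) +
        k * (Complex.I - m * d₁₁) * (g * p₂₁ s * e s)) s ∧
    HasDerivAt (fun s => g * p₁₂ s * e' s)
      (k * (-Complex.I + m * d₁₁) * (g * p₁₂ s * e' s) +
        k * m * d₁₂ * ((1 + g * p₂₂ s) * e' s)) s ∧
    HasDerivAt (fun s => (1 + g * p₂₂ s) * e' s)
      (k * m * d₂₁ * (g * p₁₂ s * e' s) +
        k * (Complex.I - m * d₁₁) * ((1 + g * p₂₂ s) * e' s)) s := by
  intro g d₁₁ d₁₂ d₂₁ e e'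
  have he : HasDerivAt e (-Complex.I * k * e s) s :=
    ((hφ s).const_mul (-Complex.I)).cexp.congr_deriv (by simp only [e]; ring)
  have he' : HasDerivAt e' (Complex.I * k * e' s) s :=
    ((hφ s).const_mul Complex.I).cexp.congr_deriv (by simp only [e']; ring)
  have hR := dressCoef_rel₁ h0 hb h' hm
  have hR' := dressCoef_rel₂ h0 hb h' hm
  have hd := hp.det s
  have ht := hp.trace s
  change (κ - κb) * g = k * m * (κ - κb + g * κ) at hR
  change g * (κb - k) = k * m * κb at hR'
  -- Each entry is a combination of the two relations for `g`, taken modulo `tr P = 1` and `det P =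
  -- 0`.
  refine ⟨?_, ?_, ?_, ?_⟩
  · refine ((((hp.deriv₁₁ s).const_mul g).const_add 1).mul he).congr_deriv ?_
    simp only [d₁₁, d₁₂]
    linear_combination e s * (p₁₂ s * p₂₁ s) * (-2 * Complex.I) *
      (hR - k * m * g * (κ - κb) * ht)
  · refine (((hp.deriv₂₁ s).const_mul g).mul he).congr_deriv ?_
    simp only [d₁₁, d₂₁]
    linear_combination e s * p₂₁ s * (2 * Complex.I) *
      (hR' + p₁₁ s * hR - (g - k * m) * (κ - κb) * ht - k * m * g * (κ - κb) * hd)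
  · refine (((hp.deriv₁₂ s).const_mul g).mul he').congr_deriv ?_
    simp only [d₁₁, d₁₂]
    linear_combination e' s * p₁₂ s * (-2 * Complex.I) *
      (hR' + p₂₂ s * hR - k * m * g * (κ - κb) * p₂₂ s * ht - k * m * g * (κ - κb) * hd)
  · refine ((((hp.deriv₂₂ s).const_mul g).const_add 1).mul he').congr_deriv ?_
    simp only [d₁₁, d₂₁]
    linear_combination e' s * (p₁₂ s * p₂₁ s) * (2 * Complex.I) * hR

/-- In matrix form: `Φ' = (i/(4k) σ₃ - (i/4) m [σ₃, P])Φ`. The argument is that of the spatial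
equation with eigenvalues replaced by their inverses, in which `m = 1/κb - 1/κ`. -/
lemma dress_time (h0 : κ ≠ 0) (hb : κb ≠ 0) (hk : k ≠ 0) (h' : k ≠ κb)
    (hm : m = (κ - κb) / (κ * κb))
    (hp : ProjFlow (-Complex.I / (2 * κ)) (Complex.I / (2 * κb)) p₁₁ p₁₂ p₂₁ p₂₂)
    (hφ : ∀ s, HasDerivAt φ (-(4 * k)⁻¹) s) (s : ℝ) :
    let g := dressCoef κ κb k
    let e := fun s => Complex.exp (-Complex.I * φ s)
    let e' := fun s => Complex.exp (Complex.I * φ s)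
    HasDerivAt (fun s => (1 + g * p₁₁ s) * e s)
      (Complex.I / (4 * k) * ((1 + g * p₁₁ s) * e s) +
        -(Complex.I / 2) * (m * p₁₂ s) * (g * p₂₁ s * e s)) s ∧
    HasDerivAt (fun s => g * p₂₁ s * e s)
      (Complex.I / 2 * (m * p₂₁ s) * ((1 + g * p₁₁ s) * e s) +
        -(Complex.I / (4 * k)) * (g * p₂₁ s * e s)) s ∧
    HasDerivAt (fun s => g * p₁₂ s * e' s)
      (Complex.I / (4 * k) * (g * p₁₂ s * e' s) +
        -(Complex.I / 2) * (m * p₁₂ s) * ((1 + g * p₂₂ s) * e' s)) s ∧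
    HasDerivAt (fun s => (1 + g * p₂₂ s) * e' s)
      (Complex.I / 2 * (m * p₂₁ s) * (g * p₁₂ s * e' s) +
        -(Complex.I / (4 * k)) * ((1 + g * p₂₂ s) * e' s)) s := by
  intro g e e'
  have he : HasDerivAt e (Complex.I / (4 * k) * e s) s :=
    ((hφ s).const_mul (-Complex.I)).cexp.congr_deriv (by simp only [e]; ring)
  have he' : HasDerivAt e' (-(Complex.I / (4 * k)) * e' s) s :=
    ((hφ s).const_mul Complex.I).cexp.congr_deriv (by simp only [e']; ring)
  have hR : g * (k⁻¹ - κb⁻¹) = m := by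
    have := dressCoef_rel₂ h0 hb h' hm
    change g * (κb - k) = k * m * κb at this
    field_simp
    linear_combination this
  have hm' : m = κb⁻¹ - κ⁻¹ := by rw [hm]; field_simp
  have hr : -Complex.I / (2 * κ) = -(Complex.I / 2) * κ⁻¹ := by field_simp
  have hrb : Complex.I / (2 * κb) = Complex.I / 2 * κb⁻¹ := by field_simp
  have hk' : Complex.I / (4 * k) = Complex.I / 4 * k⁻¹ := by field_simp
  have ht := hp.trace s
  rw [hr, hrb] at hp
  rw [hk'] at he he' ⊢
  have hmI : -(Complex.I / 2) * κ⁻¹ + Complex.I / 2 * κb⁻¹ = Complex.I / 2 * m := by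
    rw [hm']; ring
  have hκ : κ⁻¹ = κb⁻¹ - m := by rw [hm']; ring
  refine ⟨?_, ?_, ?_, ?_⟩
  · refine ((((hp.deriv₁₁ s).const_mul g).const_add 1).mul he).congr_deriv ?_
    rw [hmI]
    ring
  · refine (((hp.deriv₂₁ s).const_mul g).mul he).congr_deriv ?_
    rw [hmI, hκ]
    linear_combination e s * p₂₁ s * (Complex.I / 2) * (hR - m * g * ht)
  · refine (((hp.deriv₁₂ s).const_mul g).mul he').congr_deriv ?_
    rw [hmI]
    linear_combination -e' s * p₁₂ s * (Complex.I / 2) * hR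
  · refine ((((hp.deriv₂₂ s).const_mul g).const_add 1).mul he').congr_deriv ?_
    rw [hmI]
    ring

end dressing

/-! ### The one-soliton solution in closed form -/

noncomputable section

/-- The eigenvalues `k₁, -k₁^*` of the upper half plane. -/
def pole (κ : ℂ) : Fin 2 → ℂ := ![κ, -conj κ]

/-- The residue factor `± c e^{2iθ}` at the pole `j`. -/
def resCoef (κ : ℂ) (c : ℝ) (ξ t : ℝ) (j : Fin 2) : ℂ :=
  ![1, -1] j * c * Complex.exp (2 * Complex.I * phase (pole κ j) ξ t)

/-- The slope of the projector direction `(1, τ)` attached to the pole `j`. -/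
def solTau (κ : ℂ) (c : ℝ) (ξ t : ℝ) (j : Fin 2) : ℂ :=
  -(conj (pole κ j) / pole κ j) * (resCoef κ c ξ t j / (pole κ j - conj (pole κ j)))

/-- `1 / (1 + |τ|²)`. -/
def prj₁₁ (κ : ℂ) (c : ℝ) (ξ t : ℝ) (j : Fin 2) : ℂ :=
  (1 + solTau κ c ξ t j * conj (solTau κ c ξ t j))⁻¹

/-- `τ^* / (1 + |τ|²)`. -/
def prj₁₂ (κ : ℂ) (c : ℝ) (ξ t : ℝ) (j : Fin 2) : ℂ :=
  conj (solTau κ c ξ t j) * (1 + solTau κ c ξ t j * conj (solTau κ c ξ t j))⁻¹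

/-- `τ / (1 + |τ|²)`. -/
def prj₂₁ (κ : ℂ) (c : ℝ) (ξ t : ℝ) (j : Fin 2) : ℂ :=
  solTau κ c ξ t j * (1 + solTau κ c ξ t j * conj (solTau κ c ξ t j))⁻¹

/-- `|τ|² / (1 + |τ|²)`. -/
def prj₂₂ (κ : ℂ) (c : ℝ) (ξ t : ℝ) (j : Fin 2) : ℂ :=
  solTau κ c ξ t j * conj (solTau κ c ξ t j) * (1 + solTau κ c ξ t j * conj (solTau κ c ξ t j))⁻¹

/-- The amplitude `(k₁ - k₁^*) / |k₁|²`. -/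
def amp (κ : ℂ) : ℂ := (κ - conj κ) / (κ * conj κ)

/-- The component `u` of the one-soliton solution with norming constant `γ δ^†`. -/
def solU (δ γ : Fin 2 → ℂ) (κ : ℂ) (c : ℝ) (ξ t : ℝ) : Fin 2 → ℂ := fun i =>
  Complex.I * (unitFrame δ * Matrix.diagonal (amp κ • prj₁₂ κ c ξ t) * (unitFrame γ)ᴴ) 0 i

/-- The component `x` of the one-soliton solution. -/
def solX (κ : ℂ) (c : ℝ) (ξ t : ℝ) : ℝ := ξ + (-Complex.I * (amp κ * prj₂₂ κ c ξ t 0)).re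

end

section solTau

variable {κ : ℂ} {c : ℝ}

lemma one_add_mul_conj_ne_zero (z : ℂ) : 1 + z * conj z ≠ 0 := by
  rw [Complex.mul_conj]
  norm_cast
  exact (add_pos_of_pos_of_nonneg one_pos (Complex.normSq_nonneg z)).ne'

lemma pole_ne_zero (hκ : κ.im ≠ 0) (j : Fin 2) : pole κ j ≠ 0 := by
  have : κ ≠ 0 := by rintro rfl; simp at hκ
  fin_cases j <;> simpa [pole]

lemma im_pole (κ : ℂ) (j : Fin 2) : (pole κ j).im = κ.im := by
  fin_cases j <;> simp [pole]

lemma pole_sub_conj (κ : ℂ) (j : Fin 2) : pole κ j - conj (pole κ j) = κ - conj κ := by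
  fin_cases j <;> simp [pole]; ring

lemma sub_conj_ne_zero {z : ℂ} (hz : z.im ≠ 0) : z - conj z ≠ 0 := by
  rw [Complex.sub_conj]
  simpa using hz

lemma conj_sub_conj (z : ℂ) : conj (z - conj z) = -(z - conj z) := by
  simp

lemma amp_pole (κ : ℂ) (j : Fin 2) :
    amp κ = (pole κ j - conj (pole κ j)) / (pole κ j * conj (pole κ j)) := by
  rw [pole_sub_conj, amp]
  congr 1
  fin_cases j <;> simp [pole]; ring

lemma conj_amp (κ : ℂ) : conj (amp κ) = -amp κ := by
  simp only [amp, map_div₀, map_mul, conj_sub_conj, Complex.conj_conj]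
  ring

lemma conj_phase (k : ℂ) (ξ t : ℝ) : conj (phase k ξ t) = phase (conj k) ξ t := by
  simp [phase, map_ofNat]

lemma phase_neg (k : ℂ) (ξ t : ℝ) : phase (-k) ξ t = -phase k ξ t := by
  simp only [phase, mul_neg, div_neg]
  ring

lemma resCoef_one (κ : ℂ) (c ξ t : ℝ) : resCoef κ c ξ t 1 = -conj (resCoef κ c ξ t 0) := by
  simp [resCoef, pole, ← Complex.exp_conj, conj_phase, phase_neg, map_ofNat]

/-- The minus sign of `C̃` and the relation `κ₁ = -κ₀^*` make the two directions complex conjugate.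
This symmetry puts `u` into the form required by `potU` and makes `x` independent of the frame. -/
lemma solTau_one (κ : ℂ) (c ξ t : ℝ) : solTau κ c ξ t 1 = conj (solTau κ c ξ t 0) := by
  simp only [solTau, pole_sub_conj, resCoef_one, map_mul, map_div₀, map_neg, conj_sub_conj]
  simp only [pole, Matrix.cons_val_zero, Matrix.cons_val_one, map_neg, Complex.conj_conj]
  generalize κ - conj κ = h
  ring

lemma solTau_ne_zero (hκ : κ.im ≠ 0) (hc : c ≠ 0) (ξ t : ℝ) (j : Fin 2) :
    solTau κ c ξ t j ≠ 0 := by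
  have h0 := pole_ne_zero hκ j
  have h1 := sub_conj_ne_zero hκ
  have h2 : conj (pole κ j) ≠ 0 := by simpa using h0
  have h3 : (![1, -1] : Fin 2 → ℂ) j ≠ 0 := by fin_cases j <;> simp
  simp only [solTau, resCoef, pole_sub_conj]
  have h4 : (c : ℂ) ≠ 0 := by exact_mod_cast hc
  simp only [ne_eq, neg_eq_zero, mul_eq_zero, div_eq_zero_iff, h0, h1, h2, h3, h4,
    Complex.exp_ne_zero, or_self, not_false_eq_true]

lemma hasDerivAt_phase_space (k : ℂ) (t s : ℝ) : HasDerivAt (fun ξ => phase k ξ t) k s := by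
  unfold phase
  exact ((Complex.ofRealCLM.hasDerivAt.const_mul k).sub_const _).congr_deriv (by simp)

lemma hasDerivAt_phase_time (k : ℂ) (ξ s : ℝ) :
    HasDerivAt (fun t => phase k ξ t) (-(4 * k)⁻¹) s := by
  unfold phase
  exact ((Complex.ofRealCLM.hasDerivAt.div_const (4 * k)).const_sub _).congr_deriv (by simp)

lemma hasDerivAt_solTau_space (κ : ℂ) (c t : ℝ) (j : Fin 2) (s : ℝ) :
    HasDerivAt (fun ξ => solTau κ c ξ t j) (2 * Complex.I * pole κ j * solTau κ c s t j) s := by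
  unfold solTau resCoef
  exact ((((((hasDerivAt_phase_space (pole κ j) t s).const_mul
    (2 * Complex.I)).cexp.const_mul _).div_const _).const_mul _)).congr_deriv (by ring)

lemma hasDerivAt_solTau_time (κ : ℂ) (c ξ : ℝ) (j : Fin 2) (s : ℝ) :
    HasDerivAt (fun t => solTau κ c ξ t j)
      (-Complex.I / (2 * pole κ j) * solTau κ c ξ s j) s := by
  unfold solTau resCoef
  exact ((((((hasDerivAt_phase_time (pole κ j) ξ s).const_mul
    (2 * Complex.I)).cexp.const_mul _).div_const _).const_mul _)).congr_deriv (by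
      rw [mul_inv, div_eq_mul_inv _ (2 * pole κ j), mul_inv]; ring)

lemma HasDerivAt.conj_comp {f : ℝ → ℂ} {f' : ℂ} {s : ℝ} (h : HasDerivAt f f' s) :
    HasDerivAt (fun x => conj (f x)) (conj f') s := h.star

lemma projFlow_space (κ : ℂ) (c t : ℝ) (j : Fin 2) :
    ProjFlow (2 * Complex.I * pole κ j) (-2 * Complex.I * conj (pole κ j))
      (fun ξ => prj₁₁ κ c ξ t j) (fun ξ => prj₁₂ κ c ξ t j) (fun ξ => prj₂₁ κ c ξ t j)
      (fun ξ => prj₂₂ κ c ξ t j) :=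
  ProjFlow.of_tau (hasDerivAt_solTau_space κ c t j)
    (fun s => (hasDerivAt_solTau_space κ c t j s).conj_comp.congr_deriv (by
      simp [map_ofNat])) fun _ => one_add_mul_conj_ne_zero _

lemma projFlow_time (κ : ℂ) (c ξ : ℝ) (j : Fin 2) :
    ProjFlow (-Complex.I / (2 * pole κ j)) (Complex.I / (2 * conj (pole κ j)))
      (fun t => prj₁₁ κ c ξ t j) (fun t => prj₁₂ κ c ξ t j) (fun t => prj₂₁ κ c ξ t j)
      (fun t => prj₂₂ κ c ξ t j) :=
  ProjFlow.of_tau (hasDerivAt_solTau_time κ c ξ j)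
    (fun s => (hasDerivAt_solTau_time κ c ξ j s).conj_comp.congr_deriv (by
      simp [map_ofNat])) fun _ => one_add_mul_conj_ne_zero _

lemma conj_prj₁₂ (κ : ℂ) (c ξ t : ℝ) (j : Fin 2) :
    conj (prj₁₂ κ c ξ t j) = prj₂₁ κ c ξ t j := by
  simp [prj₁₂, prj₂₁, mul_comm]

lemma conj_prj₂₁ (κ : ℂ) (c ξ t : ℝ) (j : Fin 2) :
    conj (prj₂₁ κ c ξ t j) = prj₁₂ κ c ξ t j := by
  simp [prj₁₂, prj₂₁, mul_comm]

lemma conj_prj₂₂ (κ : ℂ) (c ξ t : ℝ) (j : Fin 2) :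
    conj (prj₂₂ κ c ξ t j) = prj₂₂ κ c ξ t j := by
  simp [prj₂₂, mul_comm]

lemma prj₂₂_eq (κ : ℂ) (c ξ t : ℝ) (j : Fin 2) : prj₂₂ κ c ξ t j = prj₂₂ κ c ξ t 0 := by
  fin_cases j
  · rfl
  · simp [prj₂₂, solTau_one, mul_comm]

lemma prj₁₂_one (κ : ℂ) (c ξ t : ℝ) : prj₁₂ κ c ξ t 1 = conj (prj₁₂ κ c ξ t 0) := by
  simp [prj₁₂, solTau_one, mul_comm]

lemma prj₂₁_one (κ : ℂ) (c ξ t : ℝ) : prj₂₁ κ c ξ t 1 = prj₁₂ κ c ξ t 0 := by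
  simp [prj₁₂, prj₂₁, solTau_one, mul_comm]

lemma prj_det (κ : ℂ) (c ξ t : ℝ) (j : Fin 2) :
    prj₁₂ κ c ξ t j * prj₂₁ κ c ξ t j = prj₁₁ κ c ξ t j * prj₂₂ κ c ξ t j :=
  (projFlow_space κ c t j).det ξ

lemma prj_trace (κ : ℂ) (c ξ t : ℝ) (j : Fin 2) :
    prj₁₁ κ c ξ t j + prj₂₂ κ c ξ t j = 1 :=
  (projFlow_space κ c t j).trace ξ

/-- The real part taken in `solX` loses nothing: the amplitude is purely imaginary and the diagonal
projector entry is real. -/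
lemma coe_solX (κ : ℂ) (c ξ t : ℝ) :
    (solX κ c ξ t : ℂ) = ξ - Complex.I * (amp κ * prj₂₂ κ c ξ t 0) := by
  have : conj (-Complex.I * (amp κ * prj₂₂ κ c ξ t 0)) =
      -Complex.I * (amp κ * prj₂₂ κ c ξ t 0) := by
    simp only [map_mul, map_neg, Complex.conj_I, conj_amp, conj_prj₂₂]; ring
  rw [solX, Complex.ofReal_add, Complex.conj_eq_iff_re.1 this]
  ring

end solTau

/-! ### The Lax pair of the one-soliton solution -/

noncomputable section

/-- `∂p₁₁ / ∂ξ`. -/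
def dprj₁₁ (κ : ℂ) (c ξ t : ℝ) (j : Fin 2) : ℂ :=
  -(2 * Complex.I * pole κ j + -2 * Complex.I * conj (pole κ j)) *
    (prj₁₂ κ c ξ t j * prj₂₁ κ c ξ t j)

/-- `∂p₁₂ / ∂ξ`. -/
def dprj₁₂ (κ : ℂ) (c ξ t : ℝ) (j : Fin 2) : ℂ :=
  prj₁₂ κ c ξ t j * (-2 * Complex.I * conj (pole κ j) -
    (2 * Complex.I * pole κ j + -2 * Complex.I * conj (pole κ j)) * prj₂₂ κ c ξ t j)

/-- `∂p₂₁ / ∂ξ`. -/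
def dprj₂₁ (κ : ℂ) (c ξ t : ℝ) (j : Fin 2) : ℂ :=
  prj₂₁ κ c ξ t j * (2 * Complex.I * pole κ j -
    (2 * Complex.I * pole κ j + -2 * Complex.I * conj (pole κ j)) * prj₂₂ κ c ξ t j)

end

lemma conj_dprj₁₁ (κ : ℂ) (c ξ t : ℝ) (j : Fin 2) :
    conj (dprj₁₁ κ c ξ t j) = dprj₁₁ κ c ξ t j := by
  simp only [dprj₁₁, map_mul, map_neg, map_add, conj_prj₁₂, conj_prj₂₁, Complex.conj_I,
    Complex.conj_conj, map_ofNat]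
  ring

lemma conj_dprj₁₂ (κ : ℂ) (c ξ t : ℝ) (j : Fin 2) :
    conj (dprj₁₂ κ c ξ t j) = dprj₂₁ κ c ξ t j := by
  simp only [dprj₁₂, dprj₂₁, map_mul, map_neg, map_add, map_sub, conj_prj₁₂, conj_prj₂₂,
    Complex.conj_I, Complex.conj_conj, map_ofNat]
  ring

lemma conj_dprj₂₁ (κ : ℂ) (c ξ t : ℝ) (j : Fin 2) :
    conj (dprj₂₁ κ c ξ t j) = dprj₁₂ κ c ξ t j := by
  rw [← conj_dprj₁₂, Complex.conj_conj]

lemma dprj₁₁_eq (κ : ℂ) (c ξ t : ℝ) (j : Fin 2) : dprj₁₁ κ c ξ t j = dprj₁₁ κ c ξ t 0 := by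
  fin_cases j
  · rfl
  · simp only [Fin.mk_one, dprj₁₁, prj₁₂_one, prj₂₁_one, conj_prj₁₂]
    simp only [pole, Matrix.cons_val_zero, Matrix.cons_val_one, map_neg, Complex.conj_conj]
    ring

lemma dprj₁₂_one (κ : ℂ) (c ξ t : ℝ) : dprj₁₂ κ c ξ t 1 = conj (dprj₁₂ κ c ξ t 0) := by
  rw [conj_dprj₁₂]
  simp only [dprj₂₁, dprj₁₂, prj₁₂_one, prj₂₂_eq κ c ξ t 1, conj_prj₁₂]
  simp only [pole, Matrix.cons_val_zero, Matrix.cons_val_one, map_neg, Complex.conj_conj]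
  ring

lemma amp_smul_prj₁₂ (κ : ℂ) (c ξ t : ℝ) :
    amp κ • prj₁₂ κ c ξ t = ![amp κ * prj₁₂ κ c ξ t 0, -conj (amp κ * prj₁₂ κ c ξ t 0)] := by
  ext j; fin_cases j <;> simp [prj₁₂_one, conj_amp]

lemma amp_smul_dprj₁₂ (κ : ℂ) (c ξ t : ℝ) :
    amp κ • dprj₁₂ κ c ξ t = ![amp κ * dprj₁₂ κ c ξ t 0, -conj (amp κ * dprj₁₂ κ c ξ t 0)] := by
  ext j; fin_cases j <;> simp [dprj₁₂_one, conj_amp]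

lemma deriv_solU (δ γ : Fin 2 → ℂ) (κ : ℂ) (c ξ t : ℝ) (i : Fin 2) :
    deriv (fun s => solU δ γ κ c s t i) ξ =
      Complex.I * (unitFrame δ * Matrix.diagonal (amp κ • dprj₁₂ κ c ξ t) * (unitFrame γ)ᴴ) 0 i :=
  ((hasDerivAt_frame _ _ (fun j => ((projFlow_space κ c t j).deriv₁₂ ξ).const_mul (amp κ)) 0
    i).const_mul Complex.I).deriv

lemma deriv_ofReal_eq {f : ℝ → ℝ} {f' : ℂ} {s : ℝ} (h : HasDerivAt (fun x => (f x : ℂ)) f' s) :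
    ((deriv f s : ℝ) : ℂ) = f' := by
  have h1 : HasDerivAt f f'.re s := by
    exact Complex.reCLM.hasFDerivAt.comp_hasDerivAt s h
  rw [h1.deriv]
  exact h1.ofReal_comp.unique h

lemma deriv_solX (κ : ℂ) (c ξ t : ℝ) :
    ((deriv (fun s => solX κ c s t) ξ : ℝ) : ℂ) = 1 + Complex.I * (amp κ * dprj₁₁ κ c ξ t 0) := by
  apply deriv_ofReal_eq
  simp only [coe_solX]
  refine (Complex.ofRealCLM.hasDerivAt.sub ((((projFlow_space κ c t 0).deriv₂₂ ξ).const_mul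
    (amp κ)).const_mul Complex.I)).congr_deriv ?_
  simp only [dprj₁₁, Complex.ofRealCLM_apply, Complex.ofReal_one]
  ring

section lax

variable {δ γ : Fin 2 → ℂ} {κ : ℂ} {c : ℝ}

/-- The hypothesis on `b` is the conjugation symmetry between the two directions; it is what makes a
block diagonal in the frames a potential matrix. -/
lemma potV0_frame (b : Fin 2 → ℂ) (hb : b 1 = -conj (b 0)) :
    potV0 (fun i => Complex.I * (unitFrame δ * Matrix.diagonal b * (unitFrame γ)ᴴ) 0 i) =
      lift (unitFrame δ) (unitFrame γ) 0 b (star b) 0 := by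
  have hb' : b = ![b 0, -conj (b 0)] := by
    ext j; fin_cases j <;> simp [hb]
  have := potU_frame δ γ (b 0)
  rw [← hb'] at this
  rw [potV0, this, lift, frame_zero, frame_zero, frame_conjTranspose]

/-- The frames do not depend on `ξ`, so differentiation passes to the diagonals. In each direction
the operator is `k(-iσ₃ + m P_ξ)`, the coefficient met in `dress_space`; the lower left block gets
its sign from `m^* = -m`. -/
lemma laxSpace_sol (hδ : δ ≠ 0) (hγ : γ ≠ 0) (k : ℂ) (ξ t : ℝ) :
    laxSpace (solU δ γ κ c) (solX κ c) k ξ t =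
      lift (unitFrame δ) (unitFrame γ)
        (fun j => k * (-Complex.I + amp κ * dprj₁₁ κ c ξ t j))
        (fun j => k * amp κ * dprj₁₂ κ c ξ t j)
        (fun j => k * amp κ * dprj₂₁ κ c ξ t j)
        (fun j => k * (Complex.I - amp κ * dprj₁₁ κ c ξ t j)) := by
  have hE := unitFrame_unitary hδ
  have hG := unitFrame_unitary hγ
  simp only [laxSpace, deriv_solX, deriv_solU]
  rw [potV0_frame _ (by rw [amp_smul_dprj₁₂]; rfl), ← lift_sigma3 hE hG, lift_mul hE hG, lift_smul,
    lift_smul, lift_add]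
  have hI := Complex.I_mul_I
  congr 1 <;> ext j <;>
    simp only [Pi.add_apply, Pi.smul_apply, Pi.mul_apply, Pi.one_apply, Pi.zero_apply,
      Pi.neg_apply, Pi.star_apply, smul_eq_mul, Complex.star_def, map_mul, conj_amp, conj_dprj₁₂,
      dprj₁₁_eq κ c ξ t j]
  · linear_combination -k * (amp κ * dprj₁₁ κ c ξ t 0) * hI
  · ring
  · ring
  · linear_combination k * (amp κ * dprj₁₁ κ c ξ t 0) * hI

lemma laxTime_sol (hδ : δ ≠ 0) (hγ : γ ≠ 0) (k : ℂ) (ξ t : ℝ) :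
    laxTime (solU δ γ κ c) k ξ t =
      lift (unitFrame δ) (unitFrame γ)
        (fun _ => Complex.I / (4 * k))
        (fun j => -(Complex.I / 2) * (amp κ * prj₁₂ κ c ξ t j))
        (fun j => Complex.I / 2 * (amp κ * prj₂₁ κ c ξ t j))
        (fun _ => -(Complex.I / (4 * k))) := by
  have hE := unitFrame_unitary hδ
  have hG := unitFrame_unitary hγ
  have : solU δ γ κ c ξ t = fun i => Complex.I *
    (unitFrame δ * Matrix.diagonal (amp κ • prj₁₂ κ c ξ t) * (unitFrame γ)ᴴ) 0 i := rfl
  rw [laxTime, this, potV0_frame _ (by rw [amp_smul_prj₁₂]; rfl), ← lift_sigma3 hE hG, lift_smul,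
    lift_smul, lift_sub]
  congr 1 <;> ext j <;>
    simp only [Pi.sub_apply, Pi.smul_apply, Pi.one_apply, Pi.zero_apply, Pi.neg_apply,
      Pi.star_apply, smul_eq_mul, Complex.star_def, map_mul, conj_amp, conj_prj₁₂] <;> ring

/-- The spatial Lax operator is `-i k H` with a Hermitian involution `H`. -/
lemma exists_laxSpace_eq (hκ : κ.im ≠ 0) (hδ : δ ≠ 0) (hγ : γ ≠ 0) (k : ℂ) (ξ t : ℝ) :
    ∃ H : Mat4, Hᴴ = H ∧ H * H = 1 ∧
      laxSpace (solU δ γ κ c) (solX κ c) k ξ t = (-Complex.I * k) • H := by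
  have hE := unitFrame_unitary hδ
  have hG := unitFrame_unitary hγ
  have hI := Complex.I_mul_I
  refine ⟨lift (unitFrame δ) (unitFrame γ)
    (fun j => 1 + Complex.I * (amp κ * dprj₁₁ κ c ξ t j))
    (fun j => Complex.I * (amp κ * dprj₁₂ κ c ξ t j))
    (fun j => Complex.I * (amp κ * dprj₂₁ κ c ξ t j))
    (fun j => -(1 + Complex.I * (amp κ * dprj₁₁ κ c ξ t j))), ?_, ?_, ?_⟩
  · rw [lift_conjTranspose]
    congr 1 <;> ext j <;>
      simp only [Pi.star_apply, Complex.star_def, map_neg, map_add, map_mul, map_one,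
        Complex.conj_I, conj_amp, conj_dprj₁₁, conj_dprj₁₂, conj_dprj₂₁] <;> ring
  -- Here `H = σ₃ + i m P_ξ` in each direction. This identity is `ρ² + ‖u_ξ‖² = 1`; it needs `det P
  -- = 0` and the exact value of the amplitude `m`.
  · have key : ∀ j, (1 + Complex.I * (amp κ * dprj₁₁ κ c ξ t j)) *
        (1 + Complex.I * (amp κ * dprj₁₁ κ c ξ t j)) +
        Complex.I * (amp κ * dprj₁₂ κ c ξ t j) * (Complex.I * (amp κ * dprj₂₁ κ c ξ t j)) = 1 := by
      intro j
      have h0 := pole_ne_zero hκ j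
      have h1 : conj (pole κ j) ≠ 0 := by simpa using h0
      have hm : amp κ * (pole κ j * conj (pole κ j)) = pole κ j - conj (pole κ j) := by
        rw [amp_pole κ j]; field_simp
      have hd := prj_det κ c ξ t j
      have ht := prj_trace κ c ξ t j
      simp only [dprj₁₁, dprj₁₂, dprj₂₁]
      have ht' : prj₁₁ κ c ξ t j = 1 - prj₂₂ κ c ξ t j := by linear_combination ht
      rw [ht'] at hd
      generalize prj₁₂ κ c ξ t j = p at *
      generalize prj₂₁ κ c ξ t j = q at *
      generalize prj₂₂ κ c ξ t j = w at *
      generalize amp κ = m at *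
      generalize conj (pole κ j) = b at *
      generalize pole κ j = a at *
      have hA : Complex.I * (m * (-(2 * Complex.I * a + -2 * Complex.I * b) * (p * q))) =
          2 * m * (a - b) * (p * q) := by
        linear_combination -2 * m * (a - b) * (p * q) * hI
      have hB : Complex.I * (m * (p * (-2 * Complex.I * b -
          (2 * Complex.I * a + -2 * Complex.I * b) * w))) = 2 * m * p * (b + (a - b) * w) := by
        linear_combination -2 * m * p * (b + (a - b) * w) * hI
      have hC : Complex.I * (m * (q * (2 * Complex.I * a -
          (2 * Complex.I * a + -2 * Complex.I * b) * w))) = -2 * m * q * (a - (a - b) * w) := by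
        linear_combination 2 * m * q * (a - (a - b) * w) * hI
      rw [hA, hB, hC]
      linear_combination 4 * m * (p * q) * (m * (a - b) ^ 2 * hd - hm)
    rw [lift_mul hE hG, ← lift_one hE hG]
    congr 1 <;> ext j <;>
      simp only [Pi.add_apply, Pi.mul_apply, Pi.one_apply, Pi.zero_apply]
    · exact key j
    · ring
    · ring
    · linear_combination key j
  · rw [laxSpace_sol hδ hγ, lift_smul]
    congr 1 <;> ext j <;> simp only [Pi.smul_apply, smul_eq_mul]
    · linear_combination k * (amp κ * dprj₁₁ κ c ξ t j) * hI
    · linear_combination k * (amp κ * dprj₁₂ κ c ξ t j) * hI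
    · linear_combination k * (amp κ * dprj₂₁ κ c ξ t j) * hI
    · linear_combination -k * (amp κ * dprj₁₁ κ c ξ t j) * hI

end lax

/-! ### Uniqueness of Jost solutions -/

lemma star_dotProduct_self_re {n : Type*} [Fintype n] (y : n → ℂ) :
    (star y ⬝ᵥ y).re = ∑ i, ‖y i‖ ^ 2 := by
  simp only [dotProduct, Pi.star_apply, Complex.star_def, ← Complex.normSq_eq_conj_mul_self,
    Complex.re_sum, Complex.ofReal_re, Complex.normSq_eq_norm_sq]

lemma star_mulVec_dotProduct {n : Type*} [Fintype n] {H : Matrix n n ℂ} (hH : Hᴴ = H)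
    (y w : n → ℂ) : star (H *ᵥ y) ⬝ᵥ w = star y ⬝ᵥ H *ᵥ w := by
  rw [Matrix.star_mulVec, hH, Matrix.dotProduct_mulVec]

/-- A Hermitian involution has a quadratic form bounded by the Euclidean norm. -/
lemma abs_re_quadForm_le {n : Type*} [Fintype n] [DecidableEq n] {H : Matrix n n ℂ}
    (hH : Hᴴ = H) (hH2 : H * H = 1) (y : n → ℂ) :
    |(star y ⬝ᵥ H *ᵥ y).re| ≤ ∑ i, ‖y i‖ ^ 2 := by
  have hsq : star (H *ᵥ y) ⬝ᵥ H *ᵥ y = star y ⬝ᵥ y := by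
    rw [star_mulVec_dotProduct hH, Matrix.mulVec_mulVec, hH2, Matrix.one_mulVec]
  -- `H` is an isometry, so the squared norms of `y + Hy` and `y - Hy` are `2‖y‖² ± 2 Re⟨y, Hy⟩`;
  -- both are nonnegative.
  have hp := star_dotProduct_self_re (y + H *ᵥ y)
  have hm := star_dotProduct_self_re (y - H *ᵥ y)
  have h0 := star_dotProduct_self_re y
  simp only [star_add, star_sub, add_dotProduct, dotProduct_add, sub_dotProduct, dotProduct_sub,
    hsq, star_mulVec_dotProduct hH] at hp hm
  have h1 : 0 ≤ ∑ i, ‖(y + H *ᵥ y) i‖ ^ 2 := Finset.sum_nonneg fun _ _ => by positivity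
  have h2 : 0 ≤ ∑ i, ‖(y - H *ᵥ y) i‖ ^ 2 := Finset.sum_nonneg fun _ _ => by positivity
  rw [← hp] at h1
  rw [← hm] at h2
  simp only [Complex.add_re, Complex.sub_re] at h1 h2
  rw [abs_le]
  constructor <;> linarith

/-- The growth of solutions of `y' = -i k H y` with Hermitian involutions `H`. -/
lemma exists_hasDerivAt_energy {n : Type*} [Fintype n] [DecidableEq n] {k : ℂ}
    {H : Matrix n n ℂ} (hH : Hᴴ = H) (hH2 : H * H = 1) {y : ℝ → n → ℂ} {s : ℝ}
    (hy : ∀ i, HasDerivAt (fun x => y x i) (((-Complex.I * k) • H *ᵥ y s) i) s) :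
    ∃ e : ℝ, HasDerivAt (fun x => ∑ i, ‖y x i‖ ^ 2) e s ∧
      |e| ≤ 2 * |k.im| * ∑ i, ‖y s i‖ ^ 2 := by
  set q := star (y s) ⬝ᵥ H *ᵥ y s with hq
  -- The quadratic form of a Hermitian matrix is real, so the real part of `k` drops out of the
  -- energy balance.
  have hqi : q.im = 0 := by
    rw [← Complex.conj_eq_iff_im, ← Complex.star_def, hq, ← Matrix.star_dotProduct,
      star_mulVec_dotProduct hH]
  refine ⟨2 * (k.im * q.re), ?_, ?_⟩
  · have h1 : HasDerivAt (fun x => star (y x) ⬝ᵥ y x)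
        (star ((-Complex.I * k) • H *ᵥ y s) ⬝ᵥ y s +
          star (y s) ⬝ᵥ ((-Complex.I * k) • H *ᵥ y s)) s := by
      simp only [dotProduct, ← Finset.sum_add_distrib]
      exact HasDerivAt.fun_sum fun i _ => (hy i).star.mul (hy i)
    have h2 := Complex.reCLM.hasFDerivAt.comp_hasDerivAt s h1
    have h3 : (⇑Complex.reCLM ∘ fun x => star (y x) ⬝ᵥ y x) = fun x => ∑ i, ‖y x i‖ ^ 2 := by
      ext x; exact star_dotProduct_self_re (y x)
    rw [h3] at h2
    refine h2.congr_deriv ?_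
    rw [star_smul, smul_dotProduct, dotProduct_smul, star_mulVec_dotProduct hH, ← hq]
    simp [hqi]
    ring
  · rw [abs_mul, abs_mul, abs_two, mul_assoc]
    gcongr
    exact abs_re_quadForm_le hH hH2 (y s)

/-! ### Vanishing of solutions that are small at one end -/

section unique

variable {n : ℝ → ℝ} {a : ℝ}

/-- A Grönwall argument from infinity: the weighted energy is nonincreasing and nonnegative, so a
zero limit at `-∞` forces it to vanish everywhere. -/
lemma eq_zero_of_energy_atBot (h0 : ∀ s, 0 ≤ n s)
    (hn : ∀ s, ∃ e, HasDerivAt n e s ∧ |e| ≤ 2 * a * n s)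
    (hl : Tendsto (fun s => Real.exp (-2 * a * s) * n s) atBot (𝓝 0)) (s : ℝ) : n s = 0 := by
  have hd : ∀ s, HasDerivAt (fun s => Real.exp (-2 * a * s)) (-2 * a * Real.exp (-2 * a * s)) s :=
    fun s => (((hasDerivAt_id s).const_mul (-2 * a)).exp).congr_deriv (by simp; ring)
  have hanti : Antitone fun s => Real.exp (-2 * a * s) * n s := by
    refine antitone_of_deriv_nonpos (fun s => ?_) fun s => ?_
    · obtain ⟨e, he, -⟩ := hn s
      exact ((hd s).mul he).differentiableAt
    · obtain ⟨e, he, hle⟩ := hn s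
      rw [show deriv (fun s => Real.exp (-2 * a * s) * n s) s = _ from ((hd s).mul he).deriv]
      have := le_of_abs_le hle
      nlinarith [Real.exp_pos (-2 * a * s)]
  have := hanti.ge_of_tendsto hl s
  have hp := Real.exp_pos (-2 * a * s)
  exact le_antisymm (nonpos_of_mul_nonpos_right this hp) (h0 s)

/-- The reflection `s ↦ -s` reverses the sign of the derivative, and the bound on its absolute value
survives. -/
lemma eq_zero_of_energy_atTop (h0 : ∀ s, 0 ≤ n s)
    (hn : ∀ s, ∃ e, HasDerivAt n e s ∧ |e| ≤ 2 * a * n s)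
    (hl : Tendsto (fun s => Real.exp (2 * a * s) * n s) atTop (𝓝 0)) (s : ℝ) : n s = 0 := by
  have := eq_zero_of_energy_atBot (n := fun s => n (-s)) (a := a) (fun s => h0 _) (fun s => by
    obtain ⟨e, he, hle⟩ := hn (-s)
    exact ⟨-e, (he.comp s (hasDerivAt_neg s)).congr_deriv (by ring), by rwa [abs_neg]⟩)
    (by
      have := hl.comp tendsto_neg_atBot_atTop
      refine this.congr fun s => ?_
      simp) (-s)
  simpa using this

end unique

section jost

variable {δ γ : Fin 2 → ℂ} {κ : ℂ} {c : ℝ} {k : ℂ}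

lemma lax_energy (hκ : κ.im ≠ 0) (hδ : δ ≠ 0) (hγ : γ ≠ 0) {n : Type}
    {Ψ : ℝ → ℝ → Matrix (Fin 2 ⊕ Fin 2) n ℂ} (h : IsLaxSolution (solU δ γ κ c) (solX κ c) k Ψ)
    (t : ℝ) (j : n) (s : ℝ) :
    ∃ e : ℝ, HasDerivAt (fun x => ∑ i, ‖Ψ x t i j‖ ^ 2) e s ∧
      |e| ≤ 2 * |k.im| * ∑ i, ‖Ψ s t i j‖ ^ 2 := by
  obtain ⟨H, hH, hH2, hR⟩ := exists_laxSpace_eq (c := c) hκ hδ hγ k s t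
  refine exists_hasDerivAt_energy hH hH2 (y := fun x i => Ψ x t i j) fun i => ?_
  have := h.space s t i j
  rw [hR] at this
  refine this.congr_deriv ?_
  rw [Matrix.smul_mul]
  simp [Matrix.mul_apply, Matrix.mulVec, dotProduct]

lemma IsLaxSolution.sub {u : ℝ → ℝ → Fin 2 → ℂ} {x : ℝ → ℝ → ℝ} {n : Type}
    {Ψ Ψ' : ℝ → ℝ → Matrix (Fin 2 ⊕ Fin 2) n ℂ} (h : IsLaxSolution u x k Ψ)
    (h' : IsLaxSolution u x k Ψ') : IsLaxSolution u x k fun ξ t => Ψ ξ t - Ψ' ξ t where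
  space ξ t i j := by
    simp only [Matrix.sub_apply, Matrix.mul_sub]
    exact (h.space ξ t i j).sub (h'.space ξ t i j)
  time ξ t i j := by
    simp only [Matrix.sub_apply, Matrix.mul_sub]
    exact (h.time ξ t i j).sub (h'.time ξ t i j)

lemma IsLaxSolution.mul_const {u : ℝ → ℝ → Fin 2 → ℂ} {x : ℝ → ℝ → ℝ} {n m : Type} [Fintype n]
    {Ψ : ℝ → ℝ → Matrix (Fin 2 ⊕ Fin 2) n ℂ} (h : IsLaxSolution u x k Ψ) (A : Matrix n m ℂ) :
    IsLaxSolution u x k fun ξ t => Ψ ξ t * A where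
  space ξ t i j := by
    rw [← Matrix.mul_assoc, Matrix.mul_apply]
    simp only [Matrix.mul_apply (M := Ψ _ _)]
    exact HasDerivAt.fun_sum fun l _ => (h.space ξ t i l).mul_const _
  time ξ t i j := by
    rw [← Matrix.mul_assoc, Matrix.mul_apply]
    simp only [Matrix.mul_apply (M := Ψ _ _)]
    exact HasDerivAt.fun_sum fun l _ => (h.time ξ t i l).mul_const _

lemma norm_exp_phase (k : ℂ) (ξ t : ℝ) :
    ‖Complex.exp (Complex.I * phase k ξ t)‖ =
      ‖Complex.exp (Complex.I * phase k 0 t)‖ * Real.exp (-k.im * ξ) := by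
  have : Complex.I * phase k ξ t = Complex.I * phase k 0 t + Complex.I * (k * ξ) := by
    simp only [phase]; push_cast; ring
  rw [this, Complex.exp_add, norm_mul]
  congr 1
  rw [Complex.norm_exp]
  simp

lemma norm_exp_neg_phase (k : ℂ) (ξ t : ℝ) :
    ‖Complex.exp (-Complex.I * phase k ξ t)‖ =
      ‖Complex.exp (-Complex.I * phase k 0 t)‖ * Real.exp (k.im * ξ) := by
  have := norm_exp_phase (-k) ξ t
  simpa [phase_neg] using this

/-- The end of the axis and the exponential rate for which decay determines Lax solutions. -/
def DecayEnd (k : ℂ) (l : Filter ℝ) (φ : ℝ → ℂ) : Prop :=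
  φ 0 ≠ 0 ∧ ((l = atBot ∧ ∀ s, ‖φ s‖ = ‖φ 0‖ * Real.exp (-|k.im| * s)) ∨
    (l = atTop ∧ ∀ s, ‖φ s‖ = ‖φ 0‖ * Real.exp (|k.im| * s)))

/-- The square of `|φ|` is, up to a constant, the weight in the energy argument, so smallness of
`φΨ` at the chosen end is the required zero limit. No decay of the potential enters. -/
lemma lax_eq_zero (hκ : κ.im ≠ 0) (hδ : δ ≠ 0) (hγ : γ ≠ 0) {n : Type}
    {Ψ : ℝ → ℝ → Matrix (Fin 2 ⊕ Fin 2) n ℂ} (h : IsLaxSolution (solU δ γ κ c) (solX κ c) k Ψ)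
    {l : Filter ℝ} {φ : ℝ → ℂ} (hφ : DecayEnd k l φ) (t : ℝ) (j : n)
    (hl : ∀ i, Tendsto (fun s => φ s * Ψ s t i j) l (𝓝 0)) (s : ℝ) (i : Fin 2 ⊕ Fin 2) :
    Ψ s t i j = 0 := by
  have h0 : ∀ s, 0 ≤ ∑ i, ‖Ψ s t i j‖ ^ 2 := fun s => Finset.sum_nonneg fun _ _ => by positivity
  have hz : ∑ i, ‖Ψ s t i j‖ ^ 2 = 0 := by
    obtain ⟨hφ0, hφ⟩ := hφ
    have hφ0' : ‖φ 0‖ ≠ 0 := norm_ne_zero_iff.2 hφ0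
    have hsum : Tendsto (fun s => (‖φ 0‖ ^ 2)⁻¹ * ∑ i, ‖φ s * Ψ s t i j‖ ^ 2) l (𝓝 0) := by
      have := (tendsto_finsetSum Finset.univ fun i _ => ((hl i).norm.pow 2)).const_mul
        (‖φ 0‖ ^ 2)⁻¹
      simpa using this
    rcases hφ with ⟨rfl, hφ⟩ | ⟨rfl, hφ⟩
    · refine eq_zero_of_energy_atBot h0 (lax_energy hκ hδ hγ h t j) (hsum.congr fun s => ?_) s
      simp only [norm_mul, hφ s, mul_pow, ← Finset.mul_sum, ← Real.exp_nat_mul]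
      rw [show ((2 : ℕ) : ℝ) * (-|k.im| * s) = -2 * |k.im| * s by push_cast; ring]
      field_simp
    · refine eq_zero_of_energy_atTop h0 (lax_energy hκ hδ hγ h t j) (hsum.congr fun s => ?_) s
      simp only [norm_mul, hφ s, mul_pow, ← Finset.mul_sum, ← Real.exp_nat_mul]
      rw [show ((2 : ℕ) : ℝ) * (|k.im| * s) = 2 * |k.im| * s by push_cast; ring]
      field_simp
  have := (Finset.sum_eq_zero_iff_of_nonneg fun _ _ => by positivity).1 hz i (Finset.mem_univ i)
  simpa using this

lemma lax_unique (hκ : κ.im ≠ 0) (hδ : δ ≠ 0) (hγ : γ ≠ 0) {n : Type}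
    {Ψ Ψ' : ℝ → ℝ → Matrix (Fin 2 ⊕ Fin 2) n ℂ}
    (h : IsLaxSolution (solU δ γ κ c) (solX κ c) k Ψ)
    (h' : IsLaxSolution (solU δ γ κ c) (solX κ c) k Ψ')
    {l : Filter ℝ} {φ : ℝ → ℂ} (hφ : DecayEnd k l φ) (t : ℝ) (j : n) (b : Fin 2 ⊕ Fin 2 → ℂ)
    (hl : ∀ i, Tendsto (fun s => φ s * Ψ s t i j) l (𝓝 (b i)))
    (hl' : ∀ i, Tendsto (fun s => φ s * Ψ' s t i j) l (𝓝 (b i))) (s : ℝ) (i : Fin 2 ⊕ Fin 2) :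
    Ψ s t i j = Ψ' s t i j := by
  refine sub_eq_zero.1 (lax_eq_zero hκ hδ hγ (h.sub h') hφ t j (fun i => ?_) s i)
  simpa [mul_sub] using (hl i).sub (hl' i)

/-- The four lemmas from here on pair each exponential with the end where its modulus has the
extremal rate. For real `k` the rate is zero and both ends qualify for both exponentials. -/
lemma decayEnd_exp_atBot (hk : 0 ≤ k.im) (t : ℝ) :
    DecayEnd k atBot fun ξ => Complex.exp (Complex.I * phase k ξ t) :=
  ⟨Complex.exp_ne_zero _, Or.inl ⟨rfl, fun s => by rw [abs_of_nonneg hk]; exact norm_exp_phase k s t⟩⟩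

lemma decayEnd_exp_neg_atTop (hk : 0 ≤ k.im) (t : ℝ) :
    DecayEnd k atTop fun ξ => Complex.exp (-Complex.I * phase k ξ t) :=
  ⟨Complex.exp_ne_zero _,
    Or.inr ⟨rfl, fun s => by rw [abs_of_nonneg hk]; exact norm_exp_neg_phase k s t⟩⟩

lemma decayEnd_exp_atTop (hk : k.im ≤ 0) (t : ℝ) :
    DecayEnd k atTop fun ξ => Complex.exp (Complex.I * phase k ξ t) :=
  ⟨Complex.exp_ne_zero _, Or.inr ⟨rfl, fun s => by rw [abs_of_nonpos hk]; exact norm_exp_phase k s t⟩⟩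

lemma decayEnd_exp_neg_atBot (hk : k.im ≤ 0) (t : ℝ) :
    DecayEnd k atBot fun ξ => Complex.exp (-Complex.I * phase k ξ t) :=
  ⟨Complex.exp_ne_zero _, Or.inl ⟨rfl, fun s => by
    rw [abs_of_nonpos hk, neg_neg]; exact norm_exp_neg_phase k s t⟩⟩

lemma jostCol₁_unique (hκ : κ.im ≠ 0) (hδ : δ ≠ 0) (hγ : γ ≠ 0) {l : Filter ℝ}
    (hφ : ∀ t, DecayEnd k l fun ξ => Complex.exp (Complex.I * phase k ξ t)) {Ψ Ψ' : ℝ → ℝ → Mat42}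
    (h : IsJostCol₁ (solU δ γ κ c) (solX κ c) k l Ψ)
    (h' : IsJostCol₁ (solU δ γ κ c) (solX κ c) k l Ψ') : Ψ = Ψ' := by
  ext s t i j
  exact lax_unique hκ hδ hγ h.1 h'.1 (hφ t) t j (fun i => Matrix.fromRows (1 : Mat2) (0 : Mat2) i j)
    (fun i => (tendsto_pi_nhds.1 (tendsto_pi_nhds.1 (h.2 t) i) j))
    (fun i => (tendsto_pi_nhds.1 (tendsto_pi_nhds.1 (h'.2 t) i) j)) s i

lemma jostCol₂_unique (hκ : κ.im ≠ 0) (hδ : δ ≠ 0) (hγ : γ ≠ 0) {l : Filter ℝ}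
    (hφ : ∀ t, DecayEnd k l fun ξ => Complex.exp (-Complex.I * phase k ξ t))
    {Ψ Ψ' : ℝ → ℝ → Mat42} (h : IsJostCol₂ (solU δ γ κ c) (solX κ c) k l Ψ)
    (h' : IsJostCol₂ (solU δ γ κ c) (solX κ c) k l Ψ') : Ψ = Ψ' := by
  ext s t i j
  exact lax_unique hκ hδ hγ h.1 h'.1 (hφ t) t j (fun i => Matrix.fromRows (0 : Mat2) (1 : Mat2) i j)
    (fun i => (tendsto_pi_nhds.1 (tendsto_pi_nhds.1 (h.2 t) i) j))
    (fun i => (tendsto_pi_nhds.1 (tendsto_pi_nhds.1 (h'.2 t) i) j)) s i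

lemma mul_expPhase_inl (A : Mat4) (k : ℂ) (ξ t : ℝ) (i : Fin 2 ⊕ Fin 2) (j : Fin 2) :
    (A * expPhase k ξ t) i (Sum.inl j) = Complex.exp (Complex.I * phase k ξ t) * A i (Sum.inl j) := by
  simp [Matrix.mul_apply, expPhase, Matrix.one_apply, mul_comm]

lemma mul_expPhase_inr (A : Mat4) (k : ℂ) (ξ t : ℝ) (i : Fin 2 ⊕ Fin 2) (j : Fin 2) :
    (A * expPhase k ξ t) i (Sum.inr j) = Complex.exp (-Complex.I * phase k ξ t) * A i (Sum.inr j) := by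
  simp [Matrix.mul_apply, expPhase, Matrix.one_apply, mul_comm]

/-- The first two columns are normalized with `e^{iθ}` and the last two with `e^{-iθ}`; a single end
serves both only when `k` is real. -/
lemma jost_unique (hκ : κ.im ≠ 0) (hδ : δ ≠ 0) (hγ : γ ≠ 0) {l : Filter ℝ}
    (hφ : ∀ t, DecayEnd k l fun ξ => Complex.exp (Complex.I * phase k ξ t))
    (hφ' : ∀ t, DecayEnd k l fun ξ => Complex.exp (-Complex.I * phase k ξ t))
    {Ψ Ψ' : ℝ → ℝ → Mat4} (h : IsJost (solU δ γ κ c) (solX κ c) k l Ψ)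
    (h' : IsJost (solU δ γ κ c) (solX κ c) k l Ψ') : Ψ = Ψ' := by
  ext s t i j
  have hh := fun i j => tendsto_pi_nhds.1 (tendsto_pi_nhds.1 (h.2 t) i) j
  have hh' := fun i j => tendsto_pi_nhds.1 (tendsto_pi_nhds.1 (h'.2 t) i) j
  rcases j with j | j
  · refine lax_unique hκ hδ hγ h.1 h'.1 (hφ t) t (Sum.inl j) (fun i => (1 : Mat4) i (Sum.inl j))
      (fun i => ?_) (fun i => ?_) s i
    · simpa only [mul_expPhase_inl] using hh i (Sum.inl j)
    · simpa only [mul_expPhase_inl] using hh' i (Sum.inl j)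
  · refine lax_unique hκ hδ hγ h.1 h'.1 (hφ' t) t (Sum.inr j) (fun i => (1 : Mat4) i (Sum.inr j))
      (fun i => ?_) (fun i => ?_) s i
    · simpa only [mul_expPhase_inr] using hh i (Sum.inr j)
    · simpa only [mul_expPhase_inr] using hh' i (Sum.inr j)

end jost

/-! ### Dressed solutions of the Lax pair -/

noncomputable section

/-- `f_j - 1`, with poles in the lower half plane. -/
def coefUp (κ k : ℂ) (j : Fin 2) : ℂ := dressCoef (pole κ j) (conj (pole κ j)) k

/-- `1 / f_j - 1`, with poles in the upper half plane. -/
def coefLo (κ k : ℂ) (j : Fin 2) : ℂ := dressCoef (conj (pole κ j)) (pole κ j) k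

/-- The fundamental matrix of the Lax pair that is regular in the closed upper half plane. -/
def dressUp (δ γ : Fin 2 → ℂ) (κ : ℂ) (c : ℝ) (k : ℂ) (ξ t : ℝ) : Mat4 :=
  lift (unitFrame δ) (unitFrame γ)
    (fun j => (1 + coefUp κ k j * prj₁₁ κ c ξ t j) * Complex.exp (-Complex.I * phase k ξ t))
    (fun j => coefUp κ k j * prj₁₂ κ c ξ t j * Complex.exp (Complex.I * phase k ξ t))
    (fun j => coefUp κ k j * prj₂₁ κ c ξ t j * Complex.exp (-Complex.I * phase k ξ t))
    (fun j => (1 + coefUp κ k j * prj₂₂ κ c ξ t j) * Complex.exp (Complex.I * phase k ξ t))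

/-- The fundamental matrix of the Lax pair that is regular in the closed lower half plane. -/
def dressLo (δ γ : Fin 2 → ℂ) (κ : ℂ) (c : ℝ) (k : ℂ) (ξ t : ℝ) : Mat4 :=
  lift (unitFrame δ) (unitFrame γ)
    (fun j => (1 + coefLo κ k j * prj₂₂ κ c ξ t j) * Complex.exp (-Complex.I * phase k ξ t))
    (fun j => coefLo κ k j * -prj₁₂ κ c ξ t j * Complex.exp (Complex.I * phase k ξ t))
    (fun j => coefLo κ k j * -prj₂₁ κ c ξ t j * Complex.exp (-Complex.I * phase k ξ t))
    (fun j => (1 + coefLo κ k j * prj₁₁ κ c ξ t j) * Complex.exp (Complex.I * phase k ξ t))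

/-- The transmission matrix in the upper half plane, in the frame of `v`. -/
def transUp (v : Fin 2 → ℂ) (κ k : ℂ) : Mat2 :=
  unitFrame v * Matrix.diagonal (1 + coefUp κ k) * (unitFrame v)ᴴ

/-- The transmission matrix in the lower half plane, in the frame of `v`. -/
def transLo (v : Fin 2 → ℂ) (κ k : ℂ) : Mat2 :=
  unitFrame v * Matrix.diagonal (1 + coefLo κ k) * (unitFrame v)ᴴ

end

section dressed

variable {δ γ : Fin 2 → ℂ} {κ : ℂ} {c : ℝ} {k : ℂ}

lemma isLaxSolution_dressUp (hκ : κ.im ≠ 0) (hδ : δ ≠ 0) (hγ : γ ≠ 0) (hk : k ≠ 0)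
    (hk' : ∀ j, k ≠ conj (pole κ j)) :
    IsLaxSolution (solU δ γ κ c) (solX κ c) k (dressUp δ γ κ c k) where
  space ξ t := by
    have h0 := pole_ne_zero hκ
    have hd := fun j => dress_space (h0 j) (by simpa using h0 j) (hk' j) (amp_pole κ j)
      (projFlow_space κ c t j) (fun s => hasDerivAt_phase_space k t s) ξ
    rw [laxSpace_sol hδ hγ, dressUp, lift_mul (unitFrame_unitary hδ) (unitFrame_unitary hγ)]
    exact hasDerivAt_lift (fun j => (hd j).1) (fun j => (hd j).2.2.1) (fun j => (hd j).2.1)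
      (fun j => (hd j).2.2.2)
  time ξ t := by
    have h0 := pole_ne_zero hκ
    have hd := fun j => dress_time (h0 j) (by simpa using h0 j) hk (hk' j) (amp_pole κ j)
      (projFlow_time κ c ξ j) (fun s => hasDerivAt_phase_time k ξ s) t
    rw [laxTime_sol hδ hγ, dressUp, lift_mul (unitFrame_unitary hδ) (unitFrame_unitary hγ)]
    exact hasDerivAt_lift (fun j => (hd j).1) (fun j => (hd j).2.2.1) (fun j => (hd j).2.1)
      (fun j => (hd j).2.2.2)

/-- This is the same dressing with `κ_j` and `κ_j^*` exchanged and `P` replaced by `1 - P`. The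
amplitude and `P_ξ` both change sign, so their product, and likewise `m [σ₃, P]` in the time
equation, is unchanged. -/
lemma isLaxSolution_dressLo (hκ : κ.im ≠ 0) (hδ : δ ≠ 0) (hγ : γ ≠ 0) (hk : k ≠ 0)
    (hk' : ∀ j, k ≠ pole κ j) :
    IsLaxSolution (solU δ γ κ c) (solX κ c) k (dressLo δ γ κ c k) where
  space ξ t := by
    have h0 := pole_ne_zero hκ
    have hm : ∀ j, -amp κ = (conj (pole κ j) - pole κ j) / (conj (pole κ j) * pole κ j) := by
      intro j; rw [amp_pole κ j]; ring
    have hp : ∀ j, ProjFlow (2 * Complex.I * conj (pole κ j)) (-2 * Complex.I * pole κ j)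
        (fun s => prj₂₂ κ c s t j) (fun s => -prj₁₂ κ c s t j) (fun s => -prj₂₁ κ c s t j)
        (fun s => prj₁₁ κ c s t j) := fun j => by
      have := (projFlow_space κ c t j).compl
      convert this using 1 <;> ring
    have hd := fun j => dress_space (by simpa using h0 j) (h0 j) (hk' j) (hm j) (hp j)
      (fun s => hasDerivAt_phase_space k t s) ξ
    rw [laxSpace_sol hδ hγ, dressLo, lift_mul (unitFrame_unitary hδ) (unitFrame_unitary hγ)]
    have ht : ∀ j, prj₁₁ κ c ξ t j = 1 - prj₂₂ κ c ξ t j := fun j => by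
      linear_combination prj_trace κ c ξ t j
    refine hasDerivAt_lift (fun j => (hd j).1.congr_deriv ?_) (fun j => (hd j).2.2.1.congr_deriv ?_)
      (fun j => (hd j).2.1.congr_deriv ?_) (fun j => (hd j).2.2.2.congr_deriv ?_) <;>
    · simp only [Pi.add_apply, Pi.mul_apply, coefLo, dprj₁₁, dprj₁₂, dprj₂₁, ht]
      ring
  time ξ t := by
    have h0 := pole_ne_zero hκ
    have hm : ∀ j, -amp κ = (conj (pole κ j) - pole κ j) / (conj (pole κ j) * pole κ j) := by
      intro j; rw [amp_pole κ j]; ring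
    have hp : ∀ j, ProjFlow (-Complex.I / (2 * conj (pole κ j))) (Complex.I / (2 * pole κ j))
        (fun s => prj₂₂ κ c ξ s j) (fun s => -prj₁₂ κ c ξ s j) (fun s => -prj₂₁ κ c ξ s j)
        (fun s => prj₁₁ κ c ξ s j) := fun j => by
      have := (projFlow_time κ c ξ j).compl
      convert this using 1 <;> ring
    have hd := fun j => dress_time (by simpa using h0 j) (h0 j) hk (hk' j) (hm j) (hp j)
      (fun s => hasDerivAt_phase_time k ξ s) t
    rw [laxTime_sol hδ hγ, dressLo, lift_mul (unitFrame_unitary hδ) (unitFrame_unitary hγ)]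
    refine hasDerivAt_lift (fun j => (hd j).1.congr_deriv ?_) (fun j => (hd j).2.2.1.congr_deriv ?_)
      (fun j => (hd j).2.1.congr_deriv ?_) (fun j => (hd j).2.2.2.congr_deriv ?_) <;>
    · simp only [Pi.add_apply, Pi.mul_apply, coefLo]
      ring

lemma dressUp_mul_expPhase (hδ : δ ≠ 0) (hγ : γ ≠ 0) (k : ℂ) (ξ t : ℝ) :
    dressUp δ γ κ c k ξ t * expPhase k ξ t = lift (unitFrame δ) (unitFrame γ)
      (fun j => 1 + coefUp κ k j * prj₁₁ κ c ξ t j) (fun j => coefUp κ k j * prj₁₂ κ c ξ t j)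
      (fun j => coefUp κ k j * prj₂₁ κ c ξ t j) (fun j => 1 + coefUp κ k j * prj₂₂ κ c ξ t j) := by
  have hE := unitFrame_unitary hδ
  have hG := unitFrame_unitary hγ
  have he : Complex.exp (-Complex.I * phase k ξ t) * Complex.exp (Complex.I * phase k ξ t) = 1 := by
    rw [← Complex.exp_add]; simp
  rw [← lift_expPhase hE hG, dressUp, lift_mul hE hG]
  congr 1 <;> ext j <;> simp only [Pi.add_apply, Pi.mul_apply, Pi.zero_apply]
  · linear_combination (1 + coefUp κ k j * prj₁₁ κ c ξ t j) * he
  · linear_combination (coefUp κ k j * prj₁₂ κ c ξ t j) * he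
  · linear_combination (coefUp κ k j * prj₂₁ κ c ξ t j) * he
  · linear_combination (1 + coefUp κ k j * prj₂₂ κ c ξ t j) * he

lemma dressLo_mul_expPhase (hδ : δ ≠ 0) (hγ : γ ≠ 0) (k : ℂ) (ξ t : ℝ) :
    dressLo δ γ κ c k ξ t * expPhase k ξ t = lift (unitFrame δ) (unitFrame γ)
      (fun j => 1 + coefLo κ k j * prj₂₂ κ c ξ t j) (fun j => coefLo κ k j * -prj₁₂ κ c ξ t j)
      (fun j => coefLo κ k j * -prj₂₁ κ c ξ t j)
      (fun j => 1 + coefLo κ k j * prj₁₁ κ c ξ t j) := by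
  have hE := unitFrame_unitary hδ
  have hG := unitFrame_unitary hγ
  have he : Complex.exp (-Complex.I * phase k ξ t) * Complex.exp (Complex.I * phase k ξ t) = 1 := by
    rw [← Complex.exp_add]; simp
  rw [← lift_expPhase hE hG, dressLo, lift_mul hE hG]
  congr 1 <;> ext j <;> simp only [Pi.add_apply, Pi.mul_apply, Pi.zero_apply]
  · linear_combination (1 + coefLo κ k j * prj₂₂ κ c ξ t j) * he
  · linear_combination (coefLo κ k j * -prj₁₂ κ c ξ t j) * he
  · linear_combination (coefLo κ k j * -prj₂₁ κ c ξ t j) * he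
  · linear_combination (1 + coefLo κ k j * prj₁₁ κ c ξ t j) * he

/-! ### Asymptotics -/

/-- Both poles have the imaginary part of `κ`, so both directions decay at the same rate. -/
lemma norm_solTau (κ : ℂ) (c ξ t : ℝ) (j : Fin 2) :
    ‖solTau κ c ξ t j‖ = ‖solTau κ c 0 t j‖ * Real.exp (-(2 * κ.im) * ξ) := by
  have : solTau κ c ξ t j = solTau κ c 0 t j * Complex.exp (2 * Complex.I * (pole κ j * ξ)) := by
    have : 2 * Complex.I * phase (pole κ j) ξ t =
        2 * Complex.I * phase (pole κ j) 0 t + 2 * Complex.I * (pole κ j * ξ) := by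
      simp only [phase]; push_cast; ring
    simp only [solTau, resCoef, this, Complex.exp_add]
    ring
  rw [this, norm_mul, Complex.norm_exp]
  simp [im_pole, mul_assoc]

lemma tendsto_solTau_atTop (hκ : 0 < κ.im) (t : ℝ) (j : Fin 2) :
    Tendsto (fun ξ => solTau κ c ξ t j) atTop (𝓝 0) := by
  rw [tendsto_zero_iff_norm_tendsto_zero]
  rw [show (fun ξ => ‖solTau κ c ξ t j‖) = _ from funext fun ξ => norm_solTau κ c ξ t j]
  have h : Tendsto (fun ξ : ℝ => Real.exp (-(2 * κ.im) * ξ)) atTop (𝓝 0) :=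
    Real.tendsto_exp_atBot.comp (tendsto_id.const_mul_atTop_of_neg (by linarith))
  simpa using h.const_mul ‖solTau κ c 0 t j‖

lemma tendsto_inv_solTau_atBot (hκ : 0 < κ.im) (t : ℝ) (j : Fin 2) :
    Tendsto (fun ξ => (solTau κ c ξ t j)⁻¹) atBot (𝓝 0) := by
  rw [tendsto_zero_iff_norm_tendsto_zero]
  rw [show (fun ξ => ‖(solTau κ c ξ t j)⁻¹‖) =
      fun ξ => ‖solTau κ c 0 t j‖⁻¹ * Real.exp (-(-(2 * κ.im) * ξ)) from funext fun ξ => by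
    rw [norm_inv, norm_solTau κ c ξ t j, mul_inv, ← Real.exp_neg]]
  have h : Tendsto (fun ξ : ℝ => Real.exp (-(-(2 * κ.im) * ξ))) atBot (𝓝 0) := by
    have := tendsto_id.const_mul_atBot (r := 2 * κ.im) (by linarith)
    refine Real.tendsto_exp_atBot.comp (this.congr fun ξ => ?_)
    simp
  simpa using h.const_mul ‖solTau κ c 0 t j‖⁻¹

lemma tendsto_inv_one_add {α : Type*} {l : Filter α} {z : α → ℂ} (hz : Tendsto z l (𝓝 0)) :
    Tendsto (fun x => (1 + z x * conj (z x))⁻¹) l (𝓝 1) := by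
  have h := ((hz.mul ((Complex.continuous_conj.tendsto 0).comp hz)).const_add 1).inv₀ (by simp)
  simpa using h

lemma tendsto_conj_zero {α : Type*} {l : Filter α} {z : α → ℂ} (hz : Tendsto z l (𝓝 0)) :
    Tendsto (fun x => conj (z x)) l (𝓝 0) := by
  simpa [Function.comp_def] using (Complex.continuous_conj.tendsto 0).comp hz

lemma tendsto_prj_atTop (hκ : 0 < κ.im) (t : ℝ) (j : Fin 2) :
    Tendsto (fun ξ => prj₁₁ κ c ξ t j) atTop (𝓝 1) ∧
    Tendsto (fun ξ => prj₁₂ κ c ξ t j) atTop (𝓝 0) ∧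
    Tendsto (fun ξ => prj₂₁ κ c ξ t j) atTop (𝓝 0) ∧
    Tendsto (fun ξ => prj₂₂ κ c ξ t j) atTop (𝓝 0) := by
  have h := tendsto_solTau_atTop (c := c) hκ t j
  have h' := tendsto_conj_zero h
  have hD := tendsto_inv_one_add h
  refine ⟨hD, ?_, ?_, ?_⟩
  · simpa [prj₁₂] using h'.mul hD
  · simpa [prj₂₁] using h.mul hD
  · simpa [prj₂₂] using (h.mul h').mul hD

lemma tendsto_prj_atBot (hκ : 0 < κ.im) (hc : c ≠ 0) (t : ℝ) (j : Fin 2) :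
    Tendsto (fun ξ => prj₁₁ κ c ξ t j) atBot (𝓝 0) ∧
    Tendsto (fun ξ => prj₁₂ κ c ξ t j) atBot (𝓝 0) ∧
    Tendsto (fun ξ => prj₂₁ κ c ξ t j) atBot (𝓝 0) ∧
    Tendsto (fun ξ => prj₂₂ κ c ξ t j) atBot (𝓝 1) := by
  have h := tendsto_inv_solTau_atBot (c := c) hκ t j
  have h' := tendsto_conj_zero h
  have hD := tendsto_inv_one_add h
  have h0 := fun ξ => solTau_ne_zero (κ := κ) (c := c) hκ.ne' hc ξ t j
  have h1 : ∀ ξ, conj (solTau κ c ξ t j) ≠ 0 := fun ξ => by simpa using h0 ξ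
  have h2 : ∀ ξ, 1 + solTau κ c ξ t j * conj (solTau κ c ξ t j) ≠ 0 := fun ξ =>
    one_add_mul_conj_ne_zero _
  -- The line through `(1, τ)` is also the line through `(1/τ, 1)`. Written in `1/τ`, which tends to
  -- zero at this end, the entries have obvious limits.
  have hinv : ∀ ξ, (1 + (solTau κ c ξ t j)⁻¹ * conj (solTau κ c ξ t j)⁻¹)⁻¹ =
      solTau κ c ξ t j * conj (solTau κ c ξ t j) *
        (1 + solTau κ c ξ t j * conj (solTau κ c ξ t j))⁻¹ := by
    intro ξ
    have := h0 ξ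
    have := h1 ξ
    rw [map_inv₀, ← mul_inv, add_comm, ← inv_inv (_ * _ * _), mul_inv, inv_inv]
    field_simp
  refine ⟨?_, ?_, ?_, ?_⟩
  · have := (h.mul h').mul hD
    simp only [zero_mul] at this
    refine this.congr fun ξ => ?_
    have := h0 ξ
    have := h1 ξ
    rw [hinv, prj₁₁, map_inv₀]
    field_simp
  · have := h.mul hD
    simp only [zero_mul] at this
    refine this.congr fun ξ => ?_
    have := h0 ξ
    rw [hinv, prj₁₂]
    field_simp
  · have := h'.mul hD
    simp only [zero_mul] at this
    refine this.congr fun ξ => ?_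
    have := h1 ξ
    rw [hinv, prj₂₁, map_inv₀]
    field_simp
  · exact hD.congr fun ξ => hinv ξ

lemma tendsto_one_add_mul {α : Type*} {l : Filter α} {f : α → ℂ} {p : ℂ} (g : ℂ)
    (hf : Tendsto f l (𝓝 p)) : Tendsto (fun x => 1 + g * f x) l (𝓝 (1 + g * p)) :=
  (hf.const_mul g).const_add 1

lemma tendsto_dressUp_atTop (hκ : 0 < κ.im) (hδ : δ ≠ 0) (hγ : γ ≠ 0) (t : ℝ) :
    Tendsto (fun ξ => dressUp δ γ κ c k ξ t * expPhase k ξ t) atTop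
      (𝓝 (lift (unitFrame δ) (unitFrame γ) (1 + coefUp κ k) 0 0 1)) := by
  simp only [dressUp_mul_expPhase hδ hγ]
  refine tendsto_lift (fun j => ?_) (fun j => ?_) (fun j => ?_) (fun j => ?_)
  · simpa using tendsto_one_add_mul (coefUp κ k j) (tendsto_prj_atTop (c := c) hκ t j).1
  · simpa using ((tendsto_prj_atTop (c := c) hκ t j).2.1).const_mul (coefUp κ k j)
  · simpa using ((tendsto_prj_atTop (c := c) hκ t j).2.2.1).const_mul (coefUp κ k j)
  · simpa using tendsto_one_add_mul (coefUp κ k j) (tendsto_prj_atTop (c := c) hκ t j).2.2.2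

lemma tendsto_dressUp_atBot (hκ : 0 < κ.im) (hc : c ≠ 0) (hδ : δ ≠ 0) (hγ : γ ≠ 0) (t : ℝ) :
    Tendsto (fun ξ => dressUp δ γ κ c k ξ t * expPhase k ξ t) atBot
      (𝓝 (lift (unitFrame δ) (unitFrame γ) 1 0 0 (1 + coefUp κ k))) := by
  simp only [dressUp_mul_expPhase hδ hγ]
  refine tendsto_lift (fun j => ?_) (fun j => ?_) (fun j => ?_) (fun j => ?_)
  · simpa using tendsto_one_add_mul (coefUp κ k j) (tendsto_prj_atBot hκ hc t j).1
  · simpa using ((tendsto_prj_atBot hκ hc t j).2.1).const_mul (coefUp κ k j)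
  · simpa using ((tendsto_prj_atBot hκ hc t j).2.2.1).const_mul (coefUp κ k j)
  · simpa using tendsto_one_add_mul (coefUp κ k j) (tendsto_prj_atBot hκ hc t j).2.2.2

lemma tendsto_dressLo_atTop (hκ : 0 < κ.im) (hδ : δ ≠ 0) (hγ : γ ≠ 0) (t : ℝ) :
    Tendsto (fun ξ => dressLo δ γ κ c k ξ t * expPhase k ξ t) atTop
      (𝓝 (lift (unitFrame δ) (unitFrame γ) 1 0 0 (1 + coefLo κ k))) := by
  simp only [dressLo_mul_expPhase hδ hγ]
  refine tendsto_lift (fun j => ?_) (fun j => ?_) (fun j => ?_) (fun j => ?_)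
  · simpa using tendsto_one_add_mul (coefLo κ k j) (tendsto_prj_atTop (c := c) hκ t j).2.2.2
  · simpa using ((tendsto_prj_atTop (c := c) hκ t j).2.1).neg.const_mul (coefLo κ k j)
  · simpa using ((tendsto_prj_atTop (c := c) hκ t j).2.2.1).neg.const_mul (coefLo κ k j)
  · simpa using tendsto_one_add_mul (coefLo κ k j) (tendsto_prj_atTop (c := c) hκ t j).1

lemma tendsto_dressLo_atBot (hκ : 0 < κ.im) (hc : c ≠ 0) (hδ : δ ≠ 0) (hγ : γ ≠ 0) (t : ℝ) :
    Tendsto (fun ξ => dressLo δ γ κ c k ξ t * expPhase k ξ t) atBot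
      (𝓝 (lift (unitFrame δ) (unitFrame γ) (1 + coefLo κ k) 0 0 1)) := by
  simp only [dressLo_mul_expPhase hδ hγ]
  refine tendsto_lift (fun j => ?_) (fun j => ?_) (fun j => ?_) (fun j => ?_)
  · simpa using tendsto_one_add_mul (coefLo κ k j) (tendsto_prj_atBot hκ hc t j).2.2.2
  · simpa using ((tendsto_prj_atBot hκ hc t j).2.1).neg.const_mul (coefLo κ k j)
  · simpa using ((tendsto_prj_atBot hκ hc t j).2.2.1).neg.const_mul (coefLo κ k j)
  · simpa using tendsto_one_add_mul (coefLo κ k j) (tendsto_prj_atBot hκ hc t j).1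

end dressed

/-! ### Transmission coefficients of the one-soliton solution -/

section transmission

variable {δ γ : Fin 2 → ℂ} {κ : ℂ} {c : ℝ} {k : ℂ}

lemma expPhase_mul_fromRows_one (k : ℂ) (ξ t : ℝ) :
    expPhase k ξ t * (Matrix.fromRows 1 0 : Mat42) =
      Complex.exp (Complex.I * phase k ξ t) • (Matrix.fromRows 1 0 : Mat42) := by
  rw [expPhase, Matrix.fromBlocks_mul_fromRows]
  ext (i | i) j <;> simp

lemma expPhase_mul_fromRows_two (k : ℂ) (ξ t : ℝ) :
    expPhase k ξ t * (Matrix.fromRows 0 1 : Mat42) =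
      Complex.exp (-Complex.I * phase k ξ t) • (Matrix.fromRows 0 1 : Mat42) := by
  rw [expPhase, Matrix.fromBlocks_mul_fromRows]
  ext (i | i) j <;> simp

lemma mod₁_mul (Φ : ℝ → ℝ → Mat4) (k : ℂ) (ξ t : ℝ) :
    mod₁ k (fun ξ t => Φ ξ t * (Matrix.fromRows 1 0 : Mat42)) ξ t =
      Φ ξ t * expPhase k ξ t * (Matrix.fromRows 1 0 : Mat42) := by
  rw [mod₁, Matrix.mul_assoc, expPhase_mul_fromRows_one, Matrix.mul_smul]

lemma mod₂_mul (Φ : ℝ → ℝ → Mat4) (k : ℂ) (ξ t : ℝ) :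
    mod₂ k (fun ξ t => Φ ξ t * (Matrix.fromRows 0 1 : Mat42)) ξ t =
      Φ ξ t * expPhase k ξ t * (Matrix.fromRows 0 1 : Mat42) := by
  rw [mod₂, Matrix.mul_assoc, expPhase_mul_fromRows_two, Matrix.mul_smul]

lemma tendsto_mul_const_matrix {α : Type*} {l : Filter α} {n m p : Type*} [Fintype n]
    {A : α → Matrix m n ℂ} {B : Matrix m n ℂ} (h : Tendsto A l (𝓝 B)) (C : Matrix n p ℂ) :
    Tendsto (fun x => A x * C) l (𝓝 (B * C)) :=
  ((continuous_id.matrix_mul continuous_const).tendsto B).comp h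

lemma tendsto_toRows₁ {α : Type*} {l : Filter α} {A : α → Mat42} {B : Mat42}
    (h : Tendsto A l (𝓝 B)) : Tendsto (fun x => (A x).toRows₁) l (𝓝 B.toRows₁) :=
  tendsto_pi_nhds.2 fun i => tendsto_pi_nhds.2 fun j =>
    tendsto_pi_nhds.1 (tendsto_pi_nhds.1 h (Sum.inl i)) j

lemma tendsto_toRows₂ {α : Type*} {l : Filter α} {A : α → Mat42} {B : Mat42}
    (h : Tendsto A l (𝓝 B)) : Tendsto (fun x => (A x).toRows₂) l (𝓝 B.toRows₂) :=
  tendsto_pi_nhds.2 fun i => tendsto_pi_nhds.2 fun j =>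
    tendsto_pi_nhds.1 (tendsto_pi_nhds.1 h (Sum.inr i)) j

lemma lift_mul_fromRows_one (E G : Mat2) (a b c d : Fin 2 → ℂ) :
    lift E G a b c d * (Matrix.fromRows 1 0 : Mat42) =
      Matrix.fromRows (E * Matrix.diagonal a * Eᴴ) (G * Matrix.diagonal c * Eᴴ) := by
  rw [lift, Matrix.fromBlocks_mul_fromRows]; simp

lemma lift_mul_fromRows_two (E G : Mat2) (a b c d : Fin 2 → ℂ) :
    lift E G a b c d * (Matrix.fromRows 0 1 : Mat42) =
      Matrix.fromRows (E * Matrix.diagonal b * Gᴴ) (G * Matrix.diagonal d * Gᴴ) := by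
  rw [lift, Matrix.fromBlocks_mul_fromRows]; simp

lemma ne_conj_pole (hκ : 0 < κ.im) (hk : 0 ≤ k.im) (j : Fin 2) : k ≠ conj (pole κ j) := by
  rintro rfl
  rw [Complex.conj_im, im_pole] at hk
  linarith

lemma ne_pole (hκ : 0 < κ.im) (hk : k.im ≤ 0) (j : Fin 2) : k ≠ pole κ j := by
  rintro rfl
  rw [im_pole] at hk
  linarith

/-- At `-∞` the dressed matrix tends to `diag(1, f)`, so its first block column is already
normalized there. The three lemmas that follow use the other entries equal to `1` in the same way.
-/
lemma isJostCol₁_upper (hκ : 0 < κ.im) (hc : c ≠ 0) (hδ : δ ≠ 0) (hγ : γ ≠ 0) (hk : 0 < k.im) :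
    IsJostCol₁ (solU δ γ κ c) (solX κ c) k atBot
      (fun ξ t => dressUp δ γ κ c k ξ t * (Matrix.fromRows 1 0 : Mat42)) := by
  refine ⟨(isLaxSolution_dressUp hκ.ne' hδ hγ (by rintro rfl; simp at hk)
    (ne_conj_pole hκ hk.le)).mul_const _, fun t => ?_⟩
  simp only [mod₁_mul]
  have := tendsto_mul_const_matrix (tendsto_dressUp_atBot (k := k) hκ hc hδ hγ t)
    (Matrix.fromRows 1 0 : Mat42)
  rwa [lift_mul_fromRows_one, frame_one (unitFrame_unitary hδ), frame_zero] at this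

lemma isJostCol₂_upper (hκ : 0 < κ.im) (hδ : δ ≠ 0) (hγ : γ ≠ 0) (hk : 0 < k.im) :
    IsJostCol₂ (solU δ γ κ c) (solX κ c) k atTop
      (fun ξ t => dressUp δ γ κ c k ξ t * (Matrix.fromRows 0 1 : Mat42)) := by
  refine ⟨(isLaxSolution_dressUp hκ.ne' hδ hγ (by rintro rfl; simp at hk)
    (ne_conj_pole hκ hk.le)).mul_const _, fun t => ?_⟩
  simp only [mod₂_mul]
  have := tendsto_mul_const_matrix (tendsto_dressUp_atTop (k := k) (c := c) hκ hδ hγ t)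
    (Matrix.fromRows 0 1 : Mat42)
  rwa [lift_mul_fromRows_two, frame_one (unitFrame_unitary hγ), frame_zero] at this

lemma isJostCol₁_lower (hκ : 0 < κ.im) (hδ : δ ≠ 0) (hγ : γ ≠ 0) (hk : k.im < 0) :
    IsJostCol₁ (solU δ γ κ c) (solX κ c) k atTop
      (fun ξ t => dressLo δ γ κ c k ξ t * (Matrix.fromRows 1 0 : Mat42)) := by
  refine ⟨(isLaxSolution_dressLo hκ.ne' hδ hγ (by rintro rfl; simp at hk)
    (ne_pole hκ hk.le)).mul_const _, fun t => ?_⟩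
  simp only [mod₁_mul]
  have := tendsto_mul_const_matrix (tendsto_dressLo_atTop (k := k) (c := c) hκ hδ hγ t)
    (Matrix.fromRows 1 0 : Mat42)
  rwa [lift_mul_fromRows_one, frame_one (unitFrame_unitary hδ), frame_zero] at this

lemma isJostCol₂_lower (hκ : 0 < κ.im) (hc : c ≠ 0) (hδ : δ ≠ 0) (hγ : γ ≠ 0) (hk : k.im < 0) :
    IsJostCol₂ (solU δ γ κ c) (solX κ c) k atBot
      (fun ξ t => dressLo δ γ κ c k ξ t * (Matrix.fromRows 0 1 : Mat42)) := by
  refine ⟨(isLaxSolution_dressLo hκ.ne' hδ hγ (by rintro rfl; simp at hk)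
    (ne_pole hκ hk.le)).mul_const _, fun t => ?_⟩
  simp only [mod₂_mul]
  have := tendsto_mul_const_matrix (tendsto_dressLo_atBot (k := k) hκ hc hδ hγ t)
    (Matrix.fromRows 0 1 : Mat42)
  rwa [lift_mul_fromRows_two, frame_one (unitFrame_unitary hγ), frame_zero] at this

lemma coefUp_mul_coefLo (hκ : κ.im ≠ 0) (h : ∀ j, k ≠ pole κ j) (h' : ∀ j, k ≠ conj (pole κ j)) :
    (1 + coefUp κ k) * (1 + coefLo κ k) = 1 := by
  ext j
  have h0 := pole_ne_zero hκ j
  exact dressCoef_mul h0 (by simpa using h0) (h j) (h' j)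

lemma lift_mul_expPhase_comm (hδ : δ ≠ 0) (hγ : γ ≠ 0) (k : ℂ) (ξ t : ℝ) (a d : Fin 2 → ℂ) :
    lift (unitFrame δ) (unitFrame γ) a 0 0 d * expPhase k ξ t =
      expPhase k ξ t * lift (unitFrame δ) (unitFrame γ) a 0 0 d := by
  have hE := unitFrame_unitary hδ
  have hG := unitFrame_unitary hγ
  rw [← lift_expPhase hE hG, lift_mul hE hG, lift_mul hE hG]
  congr 1 <;> ext j <;> simp [mul_comm]

/-- For real `k` both block columns must be normalized at the same end. The constant right factor
divides out `diag(1, f)`; it commutes with `e^{iθΣ₃}`, which is scalar on each block. -/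
lemma isJost_atBot (hκ : 0 < κ.im) (hc : c ≠ 0) (hδ : δ ≠ 0) (hγ : γ ≠ 0) {k : ℝ} (hk : k ≠ 0) :
    IsJost (solU δ γ κ c) (solX κ c) k atBot (fun ξ t => dressUp δ γ κ c k ξ t *
      lift (unitFrame δ) (unitFrame γ) 1 0 0 (1 + coefLo κ k)) := by
  have hE := unitFrame_unitary hδ
  have hG := unitFrame_unitary hγ
  refine ⟨(isLaxSolution_dressUp hκ.ne' hδ hγ (by exact_mod_cast hk)
    (ne_conj_pole hκ (by simp))).mul_const _, fun t => ?_⟩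
  have := tendsto_mul_const_matrix (tendsto_dressUp_atBot (k := (k : ℂ)) hκ hc hδ hγ t)
    (lift (unitFrame δ) (unitFrame γ) 1 0 0 (1 + coefLo κ k))
  rw [lift_mul hE hG] at this
  simp only [mul_zero, zero_mul, add_zero, zero_add, one_mul, coefUp_mul_coefLo hκ.ne'
    (ne_pole (k := (k : ℂ)) hκ (by simp)) (ne_conj_pole (k := (k : ℂ)) hκ (by simp)),
    lift_one hE hG] at this
  refine this.congr fun ξ => ?_
  rw [Matrix.mul_assoc, Matrix.mul_assoc, lift_mul_expPhase_comm hδ hγ]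

lemma isJost_atTop (hκ : 0 < κ.im) (hδ : δ ≠ 0) (hγ : γ ≠ 0) {k : ℝ} (hk : k ≠ 0) :
    IsJost (solU δ γ κ c) (solX κ c) k atTop (fun ξ t => dressUp δ γ κ c k ξ t *
      lift (unitFrame δ) (unitFrame γ) (1 + coefLo κ k) 0 0 1) := by
  have hE := unitFrame_unitary hδ
  have hG := unitFrame_unitary hγ
  refine ⟨(isLaxSolution_dressUp hκ.ne' hδ hγ (by exact_mod_cast hk)
    (ne_conj_pole hκ (by simp))).mul_const _, fun t => ?_⟩
  have := tendsto_mul_const_matrix (tendsto_dressUp_atTop (k := (k : ℂ)) (c := c) hκ hδ hγ t)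
    (lift (unitFrame δ) (unitFrame γ) (1 + coefLo κ k) 0 0 1)
  rw [lift_mul hE hG] at this
  simp only [mul_zero, zero_mul, add_zero, zero_add, one_mul, coefUp_mul_coefLo hκ.ne'
    (ne_pole (k := (k : ℂ)) hκ (by simp)) (ne_conj_pole (k := (k : ℂ)) hκ (by simp)),
    lift_one hE hG] at this
  refine this.congr fun ξ => ?_
  rw [Matrix.mul_assoc, Matrix.mul_assoc, lift_mul_expPhase_comm hδ hγ]

/-- Both Jost matrices are the same dressed solution times constants, so `S` is the quotient of the
constants, `diag(f, 1/f)` in the frames. Its off-diagonal blocks vanish: the potential is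
reflectionless. -/
lemma scattering_sol (hκ : 0 < κ.im) (hc : c ≠ 0) (hδ : δ ≠ 0) (hγ : γ ≠ 0) {k : ℝ} (hk : k ≠ 0)
    {Ψm Ψp : ℝ → ℝ → Mat4} (hm : IsJost (solU δ γ κ c) (solX κ c) k atBot Ψm)
    (hp : IsJost (solU δ γ κ c) (solX κ c) k atTop Ψp) :
    ∃ S : Mat4, (∀ ξ t, Ψm ξ t = Ψp ξ t * S) ∧ IsUnit S ∧
      S.toBlocks₁₁ = transUp δ κ k ∧ S.toBlocks₂₂ = transLo γ κ k ∧
      (S⁻¹).toBlocks₁₁ = transLo δ κ k ∧ (S⁻¹).toBlocks₂₂ = transUp γ κ k := by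
  have hE := unitFrame_unitary hδ
  have hG := unitFrame_unitary hγ
  have hmul := coefUp_mul_coefLo hκ.ne' (ne_pole (k := (k : ℂ)) hκ (by simp))
    (ne_conj_pole (k := (k : ℂ)) hκ (by simp))
  have hmul' := hmul
  rw [mul_comm] at hmul'
  have hm' := jost_unique hκ.ne' hδ hγ (decayEnd_exp_atBot (by simp))
    (decayEnd_exp_neg_atBot (by simp)) hm (isJost_atBot hκ hc hδ hγ hk)
  have hp' := jost_unique hκ.ne' hδ hγ (decayEnd_exp_atTop (by simp))
    (decayEnd_exp_neg_atTop (by simp)) hp (isJost_atTop hκ hδ hγ hk)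
  have hS : lift (unitFrame δ) (unitFrame γ) (1 + coefUp κ k) 0 0 (1 + coefLo κ k) *
      lift (unitFrame δ) (unitFrame γ) (1 + coefLo κ k) 0 0 (1 + coefUp κ k) = 1 := by
    rw [lift_mul hE hG, ← lift_one hE hG, hmul, hmul']
    simp
  refine ⟨lift (unitFrame δ) (unitFrame γ) (1 + coefUp κ k) 0 0 (1 + coefLo κ k), fun ξ t => ?_,
    IsUnit.of_mul_eq_one _ hS, ?_⟩
  · rw [hm', hp', Matrix.mul_assoc, lift_mul hE hG, hmul']
    simp
  · rw [Matrix.inv_eq_right_inv hS]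
    simp only [lift, Matrix.toBlocks_fromBlocks₁₁, Matrix.toBlocks_fromBlocks₂₂, transUp, transLo,
      and_self]

lemma differentiableAt_dressCoef {a b k : ℂ} (ha : a ≠ 0) (hk : k ≠ b) :
    DifferentiableAt ℂ (fun k => dressCoef a b k) k := by
  unfold dressCoef
  have := sub_ne_zero.2 hk
  fun_prop (disch := simp_all)

lemma diffContOnCl_transUp (hκ : 0 < κ.im) (v : Fin 2 → ℂ) (i j : Fin 2) :
    DiffContOnCl ℂ (fun k => transUp v κ k i j) {k | 0 < k.im} := by
  refine DifferentiableOn.diffContOnCl fun k hk => DifferentiableAt.differentiableWithinAt ?_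
  rw [Complex.closure_setOfPred_lt_im] at hk
  simp only [transUp, frame_apply, Pi.add_apply, Pi.one_apply]
  refine DifferentiableAt.fun_sum fun l _ => ?_
  exact ((((differentiableAt_dressCoef (pole_ne_zero hκ.ne' l)
    (ne_conj_pole hκ hk l)).const_add 1).const_mul _).mul_const _)

lemma diffContOnCl_transLo (hκ : 0 < κ.im) (v : Fin 2 → ℂ) (i j : Fin 2) :
    DiffContOnCl ℂ (fun k => transLo v κ k i j) {k | k.im < 0} := by
  refine DifferentiableOn.diffContOnCl fun k hk => DifferentiableAt.differentiableWithinAt ?_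
  rw [Complex.closure_setOfPred_im_lt] at hk
  simp only [transLo, frame_apply, Pi.add_apply, Pi.one_apply]
  refine DifferentiableAt.fun_sum fun l _ => ?_
  exact ((((differentiableAt_dressCoef (by simpa using pole_ne_zero hκ.ne' l)
    (ne_pole hκ hk l)).const_add 1).const_mul _).mul_const _)

lemma DiffContOnCl.congr_closure {f g : ℂ → ℂ} {s : Set ℂ} (hf : DiffContOnCl ℂ f s)
    (h : ∀ k ∈ closure s, g k = f k) : DiffContOnCl ℂ g s :=
  ⟨hf.differentiableOn.congr fun k hk => h k (subset_closure hk), hf.continuousOn.congr h⟩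

/-- This carries the values from the open half plane, where they are limits of Jost columns, to the
real line, including `k = 0` where no Jost solution is prescribed. -/
lemma eq_on_closure {f g : ℂ → Mat2} {s : Set ℂ}
    (hf : ∀ i j, DiffContOnCl ℂ (fun k => f k i j) s)
    (hg : ∀ i j, DiffContOnCl ℂ (fun k => g k i j) s) (h : ∀ k ∈ s, f k = g k) :
    ∀ k ∈ closure s, f k = g k := by
  intro k hk
  ext i j
  refine Set.EqOn.of_subset_closure (s := s) (t := closure s) (fun k hk => ?_)
    (hf i j).continuousOn (hg i j).continuousOn subset_closure subset_rfl hk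
  simp only [h k hk]

lemma tendsto_upper_a (hκ : 0 < κ.im) (hc : c ≠ 0) (hδ : δ ≠ 0) (hγ : γ ≠ 0) (hk : 0 < k.im)
    {Ψ : ℝ → ℝ → Mat42} (h : IsJostCol₁ (solU δ γ κ c) (solX κ c) k atBot Ψ) (t : ℝ) :
    Tendsto (fun ξ => (mod₁ k Ψ ξ t).toRows₁) atTop (𝓝 (transUp δ κ k)) := by
  rw [jostCol₁_unique hκ.ne' hδ hγ (decayEnd_exp_atBot hk.le) h
    (isJostCol₁_upper hκ hc hδ hγ hk)]
  simp only [mod₁_mul]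
  have := tendsto_toRows₁ (tendsto_mul_const_matrix
    (tendsto_dressUp_atTop (k := k) (c := c) hκ hδ hγ t) (Matrix.fromRows 1 0 : Mat42))
  rwa [lift_mul_fromRows_one, Matrix.toRows₁_fromRows] at this

lemma tendsto_upper_c (hκ : 0 < κ.im) (hc : c ≠ 0) (hδ : δ ≠ 0) (hγ : γ ≠ 0) (hk : 0 < k.im)
    {Ψ : ℝ → ℝ → Mat42} (h : IsJostCol₂ (solU δ γ κ c) (solX κ c) k atTop Ψ) (t : ℝ) :
    Tendsto (fun ξ => (mod₂ k Ψ ξ t).toRows₂) atBot (𝓝 (transUp γ κ k)) := by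
  rw [jostCol₂_unique hκ.ne' hδ hγ (decayEnd_exp_neg_atTop hk.le) h
    (isJostCol₂_upper hκ hδ hγ hk)]
  simp only [mod₂_mul]
  have := tendsto_toRows₂ (tendsto_mul_const_matrix
    (tendsto_dressUp_atBot (k := k) hκ hc hδ hγ t) (Matrix.fromRows 0 1 : Mat42))
  rwa [lift_mul_fromRows_two, Matrix.toRows₂_fromRows] at this

lemma tendsto_lower_abar (hκ : 0 < κ.im) (hc : c ≠ 0) (hδ : δ ≠ 0) (hγ : γ ≠ 0) (hk : k.im < 0)
    {Ψ : ℝ → ℝ → Mat42} (h : IsJostCol₂ (solU δ γ κ c) (solX κ c) k atBot Ψ) (t : ℝ) :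
    Tendsto (fun ξ => (mod₂ k Ψ ξ t).toRows₂) atTop (𝓝 (transLo γ κ k)) := by
  rw [jostCol₂_unique hκ.ne' hδ hγ (decayEnd_exp_neg_atBot hk.le) h
    (isJostCol₂_lower hκ hc hδ hγ hk)]
  simp only [mod₂_mul]
  have := tendsto_toRows₂ (tendsto_mul_const_matrix
    (tendsto_dressLo_atTop (k := k) (c := c) hκ hδ hγ t) (Matrix.fromRows 0 1 : Mat42))
  rwa [lift_mul_fromRows_two, Matrix.toRows₂_fromRows] at this

lemma tendsto_lower_cbar (hκ : 0 < κ.im) (hc : c ≠ 0) (hδ : δ ≠ 0) (hγ : γ ≠ 0) (hk : k.im < 0)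
    {Ψ : ℝ → ℝ → Mat42} (h : IsJostCol₁ (solU δ γ κ c) (solX κ c) k atTop Ψ) (t : ℝ) :
    Tendsto (fun ξ => (mod₁ k Ψ ξ t).toRows₁) atBot (𝓝 (transLo δ κ k)) := by
  rw [jostCol₁_unique hκ.ne' hδ hγ (decayEnd_exp_atTop hk.le) h
    (isJostCol₁_lower hκ hδ hγ hk)]
  simp only [mod₁_mul]
  have := tendsto_toRows₁ (tendsto_mul_const_matrix
    (tendsto_dressLo_atBot (k := k) hκ hc hδ hγ t) (Matrix.fromRows 1 0 : Mat42))
  rwa [lift_mul_fromRows_one, Matrix.toRows₁_fromRows] at this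

/-- Uniqueness follows from the limits in the open half planes and continuity. Conversely, each
defining property holds because every Jost solution coincides with the dressed one. -/
theorem isTransmissionData_sol_iff (hκ : 0 < κ.im) (hc : c ≠ 0) (hδ : δ ≠ 0) (hγ : γ ≠ 0)
    (a abar c' cbar : ℂ → Mat2) :
    IsTransmissionData (solU δ γ κ c) (solX κ c) a abar c' cbar ↔
      (∀ k : ℂ, 0 ≤ k.im → a k = transUp δ κ k ∧ c' k = transUp γ κ k) ∧
      (∀ k : ℂ, k.im ≤ 0 → abar k = transLo γ κ k ∧ cbar k = transLo δ κ k) := by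
  have hcl : closure {k : ℂ | 0 < k.im} = {k | 0 ≤ k.im} := Complex.closure_setOfPred_lt_im 0
  have hcl' : closure {k : ℂ | k.im < 0} = {k | k.im ≤ 0} := Complex.closure_setOfPred_im_lt 0
  constructor
  · intro h
    have ha := eq_on_closure (fun i j => (h.analytic_upper i j).1) (diffContOnCl_transUp hκ δ)
      fun k hk => by
        obtain ⟨Ψ, hΨ⟩ := (h.exists_upper k hk).1
        exact tendsto_nhds_unique (h.lim_a k hk Ψ hΨ 0) (tendsto_upper_a hκ hc hδ hγ hk hΨ 0)
    have hc' := eq_on_closure (fun i j => (h.analytic_upper i j).2) (diffContOnCl_transUp hκ γ)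
      fun k hk => by
        obtain ⟨Ψ, hΨ⟩ := (h.exists_upper k hk).2
        exact tendsto_nhds_unique (h.lim_c k hk Ψ hΨ 0) (tendsto_upper_c hκ hc hδ hγ hk hΨ 0)
    have hb := eq_on_closure (fun i j => (h.analytic_lower i j).1) (diffContOnCl_transLo hκ γ)
      fun k hk => by
        obtain ⟨Ψ, hΨ⟩ := (h.exists_lower k hk).2
        exact tendsto_nhds_unique (h.lim_abar k hk Ψ hΨ 0)
          (tendsto_lower_abar hκ hc hδ hγ hk hΨ 0)
    have hd := eq_on_closure (fun i j => (h.analytic_lower i j).2) (diffContOnCl_transLo hκ δ)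
      fun k hk => by
        obtain ⟨Ψ, hΨ⟩ := (h.exists_lower k hk).1
        exact tendsto_nhds_unique (h.lim_cbar k hk Ψ hΨ 0)
          (tendsto_lower_cbar hκ hc hδ hγ hk hΨ 0)
    rw [hcl] at ha hc'
    rw [hcl'] at hb hd
    exact ⟨fun k hk => ⟨ha k hk, hc' k hk⟩, fun k hk => ⟨hb k hk, hd k hk⟩⟩
  · rintro ⟨hu, hl⟩
    have hre : ∀ k : ℝ, (0 : ℝ) ≤ (k : ℂ).im := fun k => by simp
    have hre' : ∀ k : ℝ, (k : ℂ).im ≤ 0 := fun k => by simp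
    constructor
    · exact fun i j => ⟨(diffContOnCl_transUp hκ δ i j).congr_closure fun k hk => by
        rw [hcl] at hk; rw [(hu k hk).1], (diffContOnCl_transUp hκ γ i j).congr_closure
        fun k hk => by rw [hcl] at hk; rw [(hu k hk).2]⟩
    · exact fun i j => ⟨(diffContOnCl_transLo hκ γ i j).congr_closure fun k hk => by
        rw [hcl'] at hk; rw [(hl k hk).1], (diffContOnCl_transLo hκ δ i j).congr_closure
        fun k hk => by rw [hcl'] at hk; rw [(hl k hk).2]⟩
    · exact fun k hk => ⟨⟨_, isJost_atBot hκ hc hδ hγ hk⟩, ⟨_, isJost_atTop hκ hδ hγ hk⟩⟩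
    · intro k hk Ψm Ψp hm hp
      rw [(hu k (hre k)).1, (hu k (hre k)).2, (hl k (hre' k)).1, (hl k (hre' k)).2]
      exact scattering_sol hκ hc hδ hγ hk hm hp
    · exact fun k hk => ⟨⟨_, isJostCol₁_upper hκ hc hδ hγ hk⟩, ⟨_, isJostCol₂_upper hκ hδ hγ hk⟩⟩
    · exact fun k hk => ⟨⟨_, isJostCol₁_lower hκ hδ hγ hk⟩, ⟨_, isJostCol₂_lower hκ hc hδ hγ hk⟩⟩
    · intro k hk Ψ hΨ t
      rw [(hu k hk.le).1]
      exact tendsto_upper_a hκ hc hδ hγ hk hΨ t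
    · intro k hk Ψ hΨ t
      rw [(hu k hk.le).2]
      exact tendsto_upper_c hκ hc hδ hγ hk hΨ t
    · intro k hk Ψ hΨ t
      rw [(hl k hk.le).1]
      exact tendsto_lower_abar hκ hc hδ hγ hk hΨ t
    · intro k hk Ψ hΨ t
      rw [(hl k hk.le).2]
      exact tendsto_lower_cbar hκ hc hδ hγ hk hΨ t

end transmission

/-! ### The reflectionless Riemann-Hilbert problem of a quartet -/

/-- The norming constant `γ δ^†` of rank one. -/
def rankOne (γ δ : Fin 2 → ℂ) : Mat2 := Matrix.vecMulVec γ (star δ)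

/-- The reflectionless Riemann-Hilbert problem of the quartet of `κ` with norming constant `C`. -/
abbrev IsQuartetRHP (κ : ℂ) (C : Mat2) (ξ t : ℝ) (M₁ M₂ : ℂ → Mat42) : Prop :=
  IsReflectionlessRHP ![κ, -conj κ] ![C, normTilde C] ![conj κ, -κ]
    ![normBar C, normTilde (normBar C)] ξ t M₁ M₂

/-- The amplitude of the norming constant `γ δ^†`. -/
noncomputable def rankOneNorm (γ δ : Fin 2 → ℂ) : ℝ := euclNorm γ * euclNorm δ

section rankOne

variable {δ γ : Fin 2 → ℂ}

lemma rankOneNorm_pos (hγ : γ ≠ 0) (hδ : δ ≠ 0) : 0 < rankOneNorm γ δ :=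
  mul_pos (euclNorm_pos hγ) (euclNorm_pos hδ)

lemma normTilde_rankOne (γ δ : Fin 2 → ℂ) :
    normTilde (rankOne γ δ) = -rankOne (perp γ) (perp δ) := by
  ext i j
  simp only [normTilde, rankOne, Matrix.neg_apply, Matrix.mul_apply, Matrix.map_apply,
    Fin.sum_univ_two, Matrix.vecMulVec_apply, Pi.star_apply]
  fin_cases i <;> fin_cases j <;> simp [pauli2, perp] <;> ring_nf <;> simp

lemma normBar_rankOne (γ δ : Fin 2 → ℂ) : normBar (rankOne γ δ) = -rankOne δ γ := by
  ext i j
  simp [normBar, rankOne, Matrix.vecMulVec_apply]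

lemma normTilde_neg (C : Mat2) : normTilde (-C) = -normTilde C := by
  have : (-C).map (starRingEnd ℂ) = -(C.map (starRingEnd ℂ)) := by ext; simp
  simp [normTilde, this]

lemma rankOne_frame₀ (hγ : γ ≠ 0) (hδ : δ ≠ 0) :
    rankOne γ δ = (rankOneNorm γ δ : ℂ) •
      (unitFrame γ * Matrix.diagonal (Pi.single 0 1) * (unitFrame δ)ᴴ) := by
  have h1 : (euclNorm γ : ℂ) ≠ 0 := by exact_mod_cast (euclNorm_pos hγ).ne'
  have h2 : (euclNorm δ : ℂ) ≠ 0 := by exact_mod_cast (euclNorm_pos hδ).ne'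
  ext i j
  simp only [rankOne, Matrix.vecMulVec_apply, Matrix.smul_apply, frame_apply, Fin.sum_univ_two,
    unitFrame_apply₀, rankOneNorm, Complex.ofReal_mul]
  simp
  field_simp

lemma rankOne_frame₁ (hγ : γ ≠ 0) (hδ : δ ≠ 0) :
    rankOne (perp γ) (perp δ) = (rankOneNorm γ δ : ℂ) •
      (unitFrame γ * Matrix.diagonal (Pi.single 1 1) * (unitFrame δ)ᴴ) := by
  have h1 : (euclNorm γ : ℂ) ≠ 0 := by exact_mod_cast (euclNorm_pos hγ).ne'
  have h2 : (euclNorm δ : ℂ) ≠ 0 := by exact_mod_cast (euclNorm_pos hδ).ne'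
  ext i j
  simp only [rankOne, Matrix.vecMulVec_apply, Matrix.smul_apply, frame_apply, Fin.sum_univ_two,
    unitFrame_apply₁, rankOneNorm, Complex.ofReal_mul]
  simp
  field_simp

/-- The source of the decoupling: in the frames, the norming constant of the `n`-th pole acts on the
`n`-th direction only. -/
lemma quartet_residue (hγ : γ ≠ 0) (hδ : δ ≠ 0) (n : Fin 2) :
    (![rankOne γ δ, normTilde (rankOne γ δ)] : Fin 2 → Mat2) n * unitFrame δ =
      ((![1, -1] : Fin 2 → ℂ) n * rankOneNorm γ δ) •
        (unitFrame γ * Matrix.diagonal (Pi.single n 1)) := by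
  have hE := unitFrame_unitary hδ
  fin_cases n
  · simp [rankOne_frame₀ hγ hδ, Matrix.mul_assoc, hE]
  · simp [normTilde_rankOne, rankOne_frame₁ hγ hδ, Matrix.mul_assoc, hE]

lemma quartet_residue_bar (hγ : γ ≠ 0) (hδ : δ ≠ 0) (n : Fin 2) :
    (![normBar (rankOne γ δ), normTilde (normBar (rankOne γ δ))] : Fin 2 → Mat2) n * unitFrame γ =
      (-((![1, -1] : Fin 2 → ℂ) n * rankOneNorm γ δ)) •
        (unitFrame δ * Matrix.diagonal (Pi.single n 1)) := by
  have hG := unitFrame_unitary hγ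
  have hc : rankOneNorm δ γ = rankOneNorm γ δ := mul_comm _ _
  fin_cases n
  · simp [normBar_rankOne, rankOne_frame₀ hδ hγ, Matrix.mul_assoc, hG, hc]
  · simp [normBar_rankOne, normTilde_neg, normTilde_rankOne, rankOne_frame₁ hδ hγ,
      Matrix.mul_assoc, hG, hc]

lemma conj_resCoef (κ : ℂ) (c ξ t : ℝ) (j : Fin 2) :
    conj (resCoef κ c ξ t j) = (![1, -1] : Fin 2 → ℂ) j * c *
      Complex.exp (-2 * Complex.I * phase (conj (pole κ j)) ξ t) := by
  have : conj ((![1, -1] : Fin 2 → ℂ) j) = (![1, -1] : Fin 2 → ℂ) j := by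
    fin_cases j <;> simp
  simp [resCoef, ← Complex.exp_conj, conj_phase, this, map_ofNat]

lemma conj_pole_eq (κ : ℂ) (n : Fin 2) : (![conj κ, -κ] : Fin 2 → ℂ) n = conj (pole κ n) := by
  fin_cases n <;> simp [pole]

/-- In the adapted frames, the Riemann-Hilbert problem decouples into scalar equations. -/
lemma isQuartetRHP_iff (hγ : γ ≠ 0) (hδ : δ ≠ 0) (κ : ℂ) (ξ t : ℝ) (M₁ M₂ : ℂ → Mat42) :
    IsQuartetRHP κ (rankOne γ δ) ξ t M₁ M₂ ↔
      (∀ k, (∀ n, k ≠ pole κ n) → ∀ i j, (M₁ k * unitFrame δ) i j =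
        (Matrix.fromRows (unitFrame δ) 0 : Mat42) i j +
          resCoef κ (rankOneNorm γ δ) ξ t j / (k - pole κ j) * (M₂ (pole κ j) * unitFrame γ) i j) ∧
      (∀ k, (∀ n, k ≠ conj (pole κ n)) → ∀ i j, (M₂ k * unitFrame γ) i j =
        (Matrix.fromRows 0 (unitFrame γ) : Mat42) i j -
          conj (resCoef κ (rankOneNorm γ δ) ξ t j) / (k - conj (pole κ j)) *
            (M₁ (conj (pole κ j)) * unitFrame δ) i j) := by
  have hE := mul_eq_one_comm.mp (unitFrame_unitary hδ)
  have hG := mul_eq_one_comm.mp (unitFrame_unitary hγ)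
  have cancel : ∀ {F : Mat2} (_ : F * Fᴴ = 1) (A B : Mat42), A = B ↔ A * F = B * F := by
    intro F hF A B
    refine ⟨fun h => by rw [h], fun h => ?_⟩
    have := congrArg (· * Fᴴ) h
    simpa [Matrix.mul_assoc, hF] using this
  have h1 : ∀ k, (M₁ k = (Matrix.fromRows 1 0 : Mat42) +
      ∑ n, (Complex.exp (2 * Complex.I * phase ((![κ, -conj κ] : Fin 2 → ℂ) n) ξ t) /
        (k - (![κ, -conj κ] : Fin 2 → ℂ) n)) • (M₂ ((![κ, -conj κ] : Fin 2 → ℂ) n) *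
          (![rankOne γ δ, normTilde (rankOne γ δ)] : Fin 2 → Mat2) n)) ↔
      ∀ i j, (M₁ k * unitFrame δ) i j = (Matrix.fromRows (unitFrame δ) 0 : Mat42) i j +
          resCoef κ (rankOneNorm γ δ) ξ t j / (k - pole κ j) *
            (M₂ (pole κ j) * unitFrame γ) i j := by
    intro k
    rw [cancel hE, ← Matrix.ext_iff]
    refine forall_congr' fun i => forall_congr' fun j => ?_
    rw [Matrix.add_mul, Matrix.sum_mul]
    simp only [Matrix.smul_mul, Matrix.mul_assoc, quartet_residue hγ hδ, Matrix.mul_smul,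
      Matrix.fromRows_mul, Matrix.one_mul, Matrix.zero_mul]
    simp only [← Matrix.mul_assoc, Fin.sum_univ_two, Matrix.add_apply, Matrix.smul_apply,
      Matrix.mul_diagonal, smul_eq_mul]
    -- In column `j` only the pole `n = j` contributes. With everything moved to one side the two
    -- equations become literally the same expression.
    rw [← sub_eq_zero, ← sub_eq_zero (b := _ + _ / _ * _)]
    convert Iff.rfl using 2
    fin_cases j <;> simp [resCoef, pole] <;> ring
  have h2 : ∀ k, (M₂ k = (Matrix.fromRows 0 1 : Mat42) +
      ∑ n, (Complex.exp (-2 * Complex.I * phase ((![conj κ, -κ] : Fin 2 → ℂ) n) ξ t) /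
        (k - (![conj κ, -κ] : Fin 2 → ℂ) n)) • (M₁ ((![conj κ, -κ] : Fin 2 → ℂ) n) *
          (![normBar (rankOne γ δ), normTilde (normBar (rankOne γ δ))] : Fin 2 → Mat2) n)) ↔
      ∀ i j, (M₂ k * unitFrame γ) i j = (Matrix.fromRows 0 (unitFrame γ) : Mat42) i j -
          conj (resCoef κ (rankOneNorm γ δ) ξ t j) / (k - conj (pole κ j)) *
            (M₁ (conj (pole κ j)) * unitFrame δ) i j := by
    intro k
    rw [cancel hG, ← Matrix.ext_iff]
    refine forall_congr' fun i => forall_congr' fun j => ?_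
    rw [Matrix.add_mul, Matrix.sum_mul]
    simp only [Matrix.smul_mul, Matrix.mul_assoc, quartet_residue_bar hγ hδ, Matrix.mul_smul,
      Matrix.fromRows_mul, Matrix.one_mul, Matrix.zero_mul]
    simp only [← Matrix.mul_assoc, Fin.sum_univ_two, Matrix.add_apply, Matrix.smul_apply,
      Matrix.mul_diagonal, smul_eq_mul, conj_resCoef]
    rw [← sub_eq_zero, ← sub_eq_zero (b := _ - _ / _ * _)]
    convert Iff.rfl using 2
    fin_cases j <;> simp [pole] <;> ring
  constructor
  · rintro ⟨hc1, hc2⟩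
    exact ⟨fun k hk => (h1 k).1 (hc1 k hk),
      fun k hk => (h2 k).1 (hc2 k fun n => by rw [conj_pole_eq]; exact hk n)⟩
  · rintro ⟨hc1, hc2⟩
    exact ⟨fun k hk => (h1 k).2 (hc1 k hk),
      fun k hk => (h2 k).2 (hc2 k fun n => by rw [← conj_pole_eq]; exact hk n)⟩

end rankOne

/-! ### Solution of the Riemann-Hilbert problem -/

noncomputable section

/-- The upper block of the first block column, in the adapted frames. -/
def rhp₁₁ (κ : ℂ) (c ξ t : ℝ) (k : ℂ) (j : Fin 2) : ℂ :=
  1 + (κ - conj κ) * prj₂₂ κ c ξ t j / (k - pole κ j)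

/-- The lower block of the first block column, in the adapted frames. -/
def rhp₂₁ (κ : ℂ) (c ξ t : ℝ) (k : ℂ) (j : Fin 2) : ℂ :=
  -(pole κ j / conj (pole κ j)) * (κ - conj κ) * prj₂₁ κ c ξ t j / (k - pole κ j)

/-- The upper block of the second block column, in the adapted frames. -/
def rhp₁₂ (κ : ℂ) (c ξ t : ℝ) (k : ℂ) (j : Fin 2) : ℂ :=
  -(conj (pole κ j) / pole κ j) * (κ - conj κ) * prj₁₂ κ c ξ t j / (k - conj (pole κ j))

/-- The lower block of the second block column, in the adapted frames. -/
def rhp₂₂ (κ : ℂ) (c ξ t : ℝ) (k : ℂ) (j : Fin 2) : ℂ :=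
  1 - (κ - conj κ) * prj₂₂ κ c ξ t j / (k - conj (pole κ j))

/-- The first block column of the solution. -/
def rhpCol₁ (δ γ : Fin 2 → ℂ) (κ : ℂ) (c ξ t : ℝ) (k : ℂ) : Mat42 :=
  Matrix.fromRows (unitFrame δ * Matrix.diagonal (rhp₁₁ κ c ξ t k) * (unitFrame δ)ᴴ)
    (unitFrame γ * Matrix.diagonal (rhp₂₁ κ c ξ t k) * (unitFrame δ)ᴴ)

/-- The second block column of the solution. -/
def rhpCol₂ (δ γ : Fin 2 → ℂ) (κ : ℂ) (c ξ t : ℝ) (k : ℂ) : Mat42 :=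
  Matrix.fromRows (unitFrame δ * Matrix.diagonal (rhp₁₂ κ c ξ t k) * (unitFrame γ)ᴴ)
    (unitFrame γ * Matrix.diagonal (rhp₂₂ κ c ξ t k) * (unitFrame γ)ᴴ)

end

section rhp

variable {δ γ : Fin 2 → ℂ} {κ : ℂ} {ξ t : ℝ}

lemma conj_pole_ne_zero (hκ : κ.im ≠ 0) (j : Fin 2) : conj (pole κ j) ≠ 0 := by
  simpa using pole_ne_zero hκ j

lemma resCoef_eq (hκ : κ.im ≠ 0) (c ξ t : ℝ) (j : Fin 2) :
    resCoef κ c ξ t j = -(pole κ j / conj (pole κ j)) * (κ - conj κ) * solTau κ c ξ t j := by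
  have h0 := pole_ne_zero hκ j
  have h1 : conj (pole κ j) ≠ 0 := by simpa using h0
  have h2 := sub_conj_ne_zero hκ
  rw [solTau, pole_sub_conj]
  field_simp

lemma conj_resCoef_eq (hκ : κ.im ≠ 0) (c ξ t : ℝ) (j : Fin 2) :
    conj (resCoef κ c ξ t j) =
      conj (pole κ j) / pole κ j * (κ - conj κ) * conj (solTau κ c ξ t j) := by
  rw [resCoef_eq hκ]
  simp only [map_mul, map_neg, map_div₀, Complex.conj_conj, conj_sub_conj]
  ring

lemma solTau_mul_prj (κ : ℂ) (c ξ t : ℝ) (j : Fin 2) :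
    solTau κ c ξ t j * prj₁₂ κ c ξ t j = prj₂₂ κ c ξ t j ∧
    conj (solTau κ c ξ t j) * prj₂₁ κ c ξ t j = prj₂₂ κ c ξ t j ∧
    solTau κ c ξ t j * prj₁₁ κ c ξ t j = prj₂₁ κ c ξ t j ∧
    conj (solTau κ c ξ t j) * prj₁₁ κ c ξ t j = prj₁₂ κ c ξ t j := by
  refine ⟨(mul_assoc _ _ _).symm, ?_, rfl, rfl⟩
  rw [prj₂₁, prj₂₂]
  ring

/-- At the conjugate poles the ansatz reduces the equations to the relations `τ p₁₂ = p₂₂`, `τ p₁₁ =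
p₂₁` and their conjugates. -/
lemma isQuartetRHP_rhpCol (hκ : 0 < κ.im) (hγ : γ ≠ 0) (hδ : δ ≠ 0) (ξ t : ℝ) :
    IsQuartetRHP κ (rankOne γ δ) ξ t (rhpCol₁ δ γ κ (rankOneNorm γ δ) ξ t)
      (rhpCol₂ δ γ κ (rankOneNorm γ δ) ξ t) := by
  have hE := unitFrame_unitary hδ
  have hG := unitFrame_unitary hγ
  rw [isQuartetRHP_iff hγ hδ]
  set c := rankOneNorm γ δ
  have e1 : ∀ k i j, (rhpCol₁ δ γ κ c ξ t k * unitFrame δ) (Sum.inl i) j =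
      unitFrame δ i j * rhp₁₁ κ c ξ t k j := by
    intro k i j
    simp [rhpCol₁, Matrix.fromRows_mul, Matrix.mul_assoc, hE]
  have e2 : ∀ k i j, (rhpCol₁ δ γ κ c ξ t k * unitFrame δ) (Sum.inr i) j =
      unitFrame γ i j * rhp₂₁ κ c ξ t k j := by
    intro k i j
    simp [rhpCol₁, Matrix.fromRows_mul, Matrix.mul_assoc, hE]
  have e3 : ∀ k i j, (rhpCol₂ δ γ κ c ξ t k * unitFrame γ) (Sum.inl i) j =
      unitFrame δ i j * rhp₁₂ κ c ξ t k j := by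
    intro k i j
    simp [rhpCol₂, Matrix.fromRows_mul, Matrix.mul_assoc, hG]
  have e4 : ∀ k i j, (rhpCol₂ δ γ κ c ξ t k * unitFrame γ) (Sum.inr i) j =
      unitFrame γ i j * rhp₂₂ κ c ξ t k j := by
    intro k i j
    simp [rhpCol₂, Matrix.fromRows_mul, Matrix.mul_assoc, hG]
  have h2 := sub_conj_ne_zero hκ.ne'
  have hneg : ∀ j, conj (pole κ j) - pole κ j = -(κ - conj κ) := fun j => by
    rw [← pole_sub_conj κ j]; ring
  constructor
  · intro k hk i j
    have h0 := pole_ne_zero hκ.ne' j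
    have h1 : conj (pole κ j) ≠ 0 := by simpa using h0
    have h3 := sub_ne_zero.2 (hk j)
    obtain ⟨q1, q2, q3, q4⟩ := solTau_mul_prj κ c ξ t j
    have ht := prj_trace κ c ξ t j
    rcases i with i | i
    · rw [e1, e3, resCoef_eq hκ.ne', rhp₁₁, rhp₁₂, pole_sub_conj, Matrix.fromRows_apply_inl]
      field_simp
      linear_combination -unitFrame δ i j * (κ - conj κ) * q1
    · rw [e2, e4, resCoef_eq hκ.ne', rhp₂₁, rhp₂₂, pole_sub_conj, Matrix.fromRows_apply_inr]
      field_simp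
      simp only [Matrix.zero_apply]
      linear_combination unitFrame γ i j * (κ - conj κ) * pole κ j *
        (q3 - solTau κ c ξ t j * ht)
  · intro k hk i j
    have h0 := pole_ne_zero hκ.ne' j
    have h1 : conj (pole κ j) ≠ 0 := by simpa using h0
    have h3 := sub_ne_zero.2 (hk j)
    obtain ⟨q1, q2, q3, q4⟩ := solTau_mul_prj κ c ξ t j
    have ht := prj_trace κ c ξ t j
    rcases i with i | i
    · rw [e1, e3, conj_resCoef_eq hκ.ne', rhp₁₁, rhp₁₂, hneg, Matrix.fromRows_apply_inl]
      field_simp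
      simp only [Matrix.zero_apply]
      linear_combination unitFrame δ i j * (κ - conj κ) * conj (pole κ j) *
        (q4 - conj (solTau κ c ξ t j) * ht)
    · rw [e2, e4, conj_resCoef_eq hκ.ne', rhp₂₁, rhp₂₂, hneg, Matrix.fromRows_apply_inr]
      field_simp
      linear_combination unitFrame γ i j * (κ - conj κ) * q2

/-- The values of each column at the poles of the other determine everything. Per direction they
solve a `2 × 2` system with determinant `1 + |ω|²`. At its own poles a column is unconstrained, so
agreement is claimed only elsewhere. -/
lemma isQuartetRHP_unique (hκ : 0 < κ.im) (hγ : γ ≠ 0) (hδ : δ ≠ 0) {M₁ M₂ M₁' M₂' : ℂ → Mat42}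
    (h : IsQuartetRHP κ (rankOne γ δ) ξ t M₁ M₂) (h' : IsQuartetRHP κ (rankOne γ δ) ξ t M₁' M₂') :
    (∀ k, (∀ n, k ≠ pole κ n) → M₁ k = M₁' k) ∧
      (∀ k, (∀ n, k ≠ conj (pole κ n)) → M₂ k = M₂' k) := by
  have hE := mul_eq_one_comm.mp (unitFrame_unitary hδ)
  have hG := mul_eq_one_comm.mp (unitFrame_unitary hγ)
  rw [isQuartetRHP_iff hγ hδ] at h h'
  have hlow : ∀ m n : Fin 2, conj (pole κ m) ≠ pole κ n := fun m n =>
    ne_pole hκ (by rw [Complex.conj_im, im_pole]; linarith) n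
  have hval : ∀ i j, (M₂ (pole κ j) * unitFrame γ) i j = (M₂' (pole κ j) * unitFrame γ) i j := by
    intro i j
    have a1 := h.1 _ (hlow j) i j
    have a1' := h'.1 _ (hlow j) i j
    have a2 := h.2 _ (fun n => (hlow n j).symm) i j
    have a2' := h'.2 _ (fun n => (hlow n j).symm) i j
    have hs : conj (pole κ j) - pole κ j = -(pole κ j - conj (pole κ j)) := by ring
    have hne : pole κ j - conj (pole κ j) ≠ 0 := by
      rw [pole_sub_conj]; exact sub_conj_ne_zero hκ.ne'
    rw [hs] at a1 a1'
    set ω := resCoef κ (rankOneNorm γ δ) ξ t j / (pole κ j - conj (pole κ j)) with hω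
    have hωc : conj ω = -(conj (resCoef κ (rankOneNorm γ δ) ξ t j) /
        (pole κ j - conj (pole κ j))) := by
      rw [hω, map_div₀, conj_sub_conj, div_neg]
    rw [div_neg, ← hω] at a1 a1'
    rw [show conj (resCoef κ (rankOneNorm γ δ) ξ t j) / (pole κ j - conj (pole κ j)) = -conj ω by
      rw [hωc, neg_neg]] at a2 a2'
    -- Eliminating the value of the first column from the two pairs of equations leaves `(1 + ωω^*)`
    -- times the difference of the second columns.
    refine sub_eq_zero.1 ((mul_eq_zero.1 ?_).resolve_left (one_add_mul_conj_ne_zero ω))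
    linear_combination a2 - a2' + conj ω * (a1 - a1')
  have hval' : ∀ i j, (M₁ (conj (pole κ j)) * unitFrame δ) i j =
      (M₁' (conj (pole κ j)) * unitFrame δ) i j := by
    intro i j
    rw [h.1 _ (hlow j), h'.1 _ (hlow j), hval]
  constructor
  · intro k hk
    have : M₁ k * unitFrame δ = M₁' k * unitFrame δ := by
      ext i j
      rw [h.1 k hk, h'.1 k hk, hval]
    simpa [Matrix.mul_assoc, hE] using congrArg (· * (unitFrame δ)ᴴ) this
  · intro k hk
    have : M₂ k * unitFrame γ = M₂' k * unitFrame γ := by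
      ext i j
      rw [h.2 k hk, h'.2 k hk, hval']
    simpa [Matrix.mul_assoc, hG] using congrArg (· * (unitFrame γ)ᴴ) this

/-! ### The normalized eigenfunction and its expansion at `k = 0` -/

lemma fromCols_rhpCol (δ γ : Fin 2 → ℂ) (κ : ℂ) (c ξ t : ℝ) (k : ℂ) :
    (Matrix.fromCols (rhpCol₁ δ γ κ c ξ t k) (rhpCol₂ δ γ κ c ξ t k) : Mat4) =
      lift (unitFrame δ) (unitFrame γ) (rhp₁₁ κ c ξ t k) (rhp₁₂ κ c ξ t k) (rhp₂₁ κ c ξ t k)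
        (rhp₂₂ κ c ξ t k) := by
  rw [rhpCol₁, rhpCol₂, lift, Matrix.fromCols_fromRows_eq_fromBlocks]

lemma rhp_det_zero (hκ : κ.im ≠ 0) (c ξ t : ℝ) (j : Fin 2) :
    rhp₁₁ κ c ξ t 0 j * rhp₂₂ κ c ξ t 0 j - rhp₁₂ κ c ξ t 0 j * rhp₂₁ κ c ξ t 0 j = 1 := by
  have h0 := pole_ne_zero hκ j
  have h1 : conj (pole κ j) ≠ 0 := by simpa using h0
  have ht : prj₁₁ κ c ξ t j = 1 - prj₂₂ κ c ξ t j := by linear_combination prj_trace κ c ξ t j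
  have hd := prj_det κ c ξ t j
  rw [ht] at hd
  simp only [rhp₁₁, rhp₁₂, rhp₂₁, rhp₂₂, ← pole_sub_conj κ j, zero_sub]
  generalize conj (pole κ j) = b at *
  generalize pole κ j = a at *
  linear_combination (norm := (field_simp; ring)) -(a - b) ^ 2 / (a * b) * hd

/-- This is `M(k) = M(0) N(k)`, where `N` joins the first column of `1 + (1/f - 1)(1 - P)` to the
second column of `1 + (f - 1)P`. These are the modified Jost columns at `+∞`; the factor `κ_j^*/κ_j`
in `solTau` comes from this normalization at `k = 0`. -/
lemma rhp_factor (hκ : κ.im ≠ 0) (c ξ t : ℝ) {k : ℂ} (j : Fin 2) (hk : k ≠ pole κ j)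
    (hk' : k ≠ conj (pole κ j)) :
    rhp₁₁ κ c ξ t k j = rhp₁₁ κ c ξ t 0 j * (1 + coefLo κ k j * prj₂₂ κ c ξ t j) +
      rhp₁₂ κ c ξ t 0 j * -(coefLo κ k j * prj₂₁ κ c ξ t j) ∧
    rhp₁₂ κ c ξ t k j = rhp₁₁ κ c ξ t 0 j * (coefUp κ k j * prj₁₂ κ c ξ t j) +
      rhp₁₂ κ c ξ t 0 j * (1 + coefUp κ k j * prj₂₂ κ c ξ t j) ∧
    rhp₂₁ κ c ξ t k j = rhp₂₁ κ c ξ t 0 j * (1 + coefLo κ k j * prj₂₂ κ c ξ t j) +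
      rhp₂₂ κ c ξ t 0 j * -(coefLo κ k j * prj₂₁ κ c ξ t j) ∧
    rhp₂₂ κ c ξ t k j = rhp₂₁ κ c ξ t 0 j * (coefUp κ k j * prj₁₂ κ c ξ t j) +
      rhp₂₂ κ c ξ t 0 j * (1 + coefUp κ k j * prj₂₂ κ c ξ t j) := by
  have h0 := pole_ne_zero hκ j
  have h1 : conj (pole κ j) ≠ 0 := by simpa using h0
  have h2 := sub_ne_zero.2 hk
  have h3 := sub_ne_zero.2 hk'
  have ht : prj₁₁ κ c ξ t j = 1 - prj₂₂ κ c ξ t j := by linear_combination prj_trace κ c ξ t j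
  have hd := prj_det κ c ξ t j
  rw [ht] at hd
  simp only [rhp₁₁, rhp₁₂, rhp₂₁, rhp₂₂, coefUp, coefLo, dressCoef, ← pole_sub_conj κ j, zero_sub]
  generalize conj (pole κ j) = b at *
  generalize pole κ j = a at *
  refine ⟨?_, ?_, ?_, ?_⟩
  · linear_combination (norm := (field_simp; ring))
      (a - b) / a * (k * (a - b) / (b * (k - a))) * hd
  · field_simp
    ring
  · field_simp
    ring
  · linear_combination (norm := (field_simp; ring))
      -((a - b) / b * (k * (b - a) / (a * (k - b)))) * hd

/-- `N(k) = M(0)⁻¹ M(k)` in the adapted frames. -/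
lemma rhp_normalized (hκ : 0 < κ.im) (hγ : γ ≠ 0) (hδ : δ ≠ 0) {M₁ M₂ : ℂ → Mat42}
    (h : IsQuartetRHP κ (rankOne γ δ) ξ t M₁ M₂) {k : ℂ} (hk : ∀ n, k ≠ pole κ n)
    (hk' : ∀ n, k ≠ conj (pole κ n)) :
    (Matrix.fromCols (M₁ 0) (M₂ 0) : Mat4)⁻¹ * (Matrix.fromCols (M₁ k) (M₂ k) : Mat4) =
      lift (unitFrame δ) (unitFrame γ)
        (1 + coefLo κ k * prj₂₂ κ (rankOneNorm γ δ) ξ t)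
        (coefUp κ k * prj₁₂ κ (rankOneNorm γ δ) ξ t)
        (-(coefLo κ k * prj₂₁ κ (rankOneNorm γ δ) ξ t))
        (1 + coefUp κ k * prj₂₂ κ (rankOneNorm γ δ) ξ t) := by
  have hE := unitFrame_unitary hδ
  have hG := unitFrame_unitary hγ
  obtain ⟨hu1, hu2⟩ := isQuartetRHP_unique hκ hγ hδ h (isQuartetRHP_rhpCol hκ hγ hδ ξ t)
  set c := rankOneNorm γ δ
  have h0 : ∀ n, (0 : ℂ) ≠ pole κ n := fun n => (pole_ne_zero hκ.ne' n).symm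
  have h0' : ∀ n, (0 : ℂ) ≠ conj (pole κ n) := fun n =>
    (conj_pole_ne_zero hκ.ne' n).symm
  rw [hu1 0 h0, hu2 0 h0', hu1 k hk, hu2 k hk', fromCols_rhpCol, fromCols_rhpCol]
  -- The inverse is the adjugate in each direction, as the determinant there is `1`.
  have hinv : lift (unitFrame δ) (unitFrame γ) (rhp₂₂ κ c ξ t 0) (-rhp₁₂ κ c ξ t 0)
      (-rhp₂₁ κ c ξ t 0) (rhp₁₁ κ c ξ t 0) * lift (unitFrame δ) (unitFrame γ) (rhp₁₁ κ c ξ t 0)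
      (rhp₁₂ κ c ξ t 0) (rhp₂₁ κ c ξ t 0) (rhp₂₂ κ c ξ t 0) = 1 := by
    rw [lift_mul hE hG, ← lift_one hE hG]
    congr 1 <;> ext j <;> simp only [Pi.add_apply, Pi.mul_apply, Pi.neg_apply, Pi.one_apply,
      Pi.zero_apply]
    · linear_combination rhp_det_zero hκ.ne' c ξ t j
    · ring
    · ring
    · linear_combination rhp_det_zero hκ.ne' c ξ t j
  have hfac : lift (unitFrame δ) (unitFrame γ) (rhp₁₁ κ c ξ t k) (rhp₁₂ κ c ξ t k)
      (rhp₂₁ κ c ξ t k) (rhp₂₂ κ c ξ t k) =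
      lift (unitFrame δ) (unitFrame γ) (rhp₁₁ κ c ξ t 0)
        (rhp₁₂ κ c ξ t 0) (rhp₂₁ κ c ξ t 0) (rhp₂₂ κ c ξ t 0) *
      lift (unitFrame δ) (unitFrame γ) (1 + coefLo κ k * prj₂₂ κ c ξ t)
        (coefUp κ k * prj₁₂ κ c ξ t) (-(coefLo κ k * prj₂₁ κ c ξ t))
        (1 + coefUp κ k * prj₂₂ κ c ξ t) := by
    rw [lift_mul hE hG]
    have hf := fun j => rhp_factor hκ.ne' c ξ t j (hk j) (hk' j)
    congr 1 <;> ext j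
    · exact (hf j).1
    · exact (hf j).2.1
    · exact (hf j).2.2.1
    · exact (hf j).2.2.2
  rw [Matrix.inv_eq_left_inv hinv, hfac, ← Matrix.mul_assoc, hinv, Matrix.one_mul]

lemma tendsto_dressCoef_div {a b : ℂ} (hb : b ≠ 0) :
    Tendsto (fun k => dressCoef a b k / k) (𝓝[≠] 0) (𝓝 ((a - b) / (a * b))) := by
  have h : Tendsto (fun k => (b - a) / (a * (k - b))) (𝓝 0) (𝓝 ((b - a) / (a * (0 - b)))) := by
    -- If `a = 0`, both sides are zero by the convention for division.
    by_cases ha : a = 0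
    · simp [ha]
    · exact tendsto_const_nhds.div ((tendsto_id.sub_const b).const_mul a)
        (mul_ne_zero ha (by simpa using hb))
  have e : (b - a) / (a * (0 - b)) = (a - b) / (a * b) := by
    rw [zero_sub, mul_neg, div_neg, ← neg_div, neg_sub]
  rw [e] at h
  refine (h.mono_left nhdsWithin_le_nhds).congr' ?_
  filter_upwards [self_mem_nhdsWithin] with k hk
  have hk : k ≠ 0 := hk
  rw [dressCoef, mul_div_assoc, mul_div_cancel_left₀ _ hk]

lemma eventually_regular (hκ : κ.im ≠ 0) :
    ∀ᶠ k in 𝓝[≠] (0 : ℂ), k ≠ 0 ∧ (∀ n, k ≠ pole κ n) ∧ (∀ n, k ≠ conj (pole κ n)) := by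
  have h1 : ∀ n, ∀ᶠ k in 𝓝[≠] (0 : ℂ), k ≠ pole κ n := fun n =>
    (eventually_ne_nhds (pole_ne_zero hκ n).symm).filter_mono nhdsWithin_le_nhds
  have h2 : ∀ n, ∀ᶠ k in 𝓝[≠] (0 : ℂ), k ≠ conj (pole κ n) := fun n =>
    (eventually_ne_nhds (conj_pole_ne_zero hκ n).symm).filter_mono nhdsWithin_le_nhds
  filter_upwards [self_mem_nhdsWithin, eventually_all.2 h1, eventually_all.2 h2] with k a b c
  exact ⟨a, b, c⟩

lemma tendsto_soliton_u (hκ : 0 < κ.im) (hγ : γ ≠ 0) (hδ : δ ≠ 0) {M₁ M₂ : ℂ → Mat42}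
    (h : IsQuartetRHP κ (rankOne γ δ) ξ t M₁ M₂) (i : Fin 2) :
    Tendsto (fun k : ℂ => Complex.I / k *
        ((Matrix.fromCols (M₁ 0) (M₂ 0) : Mat4)⁻¹ *
          (Matrix.fromCols (M₁ k) (M₂ k) : Mat4)) (Sum.inl 0) (Sum.inr i))
      (𝓝[≠] 0) (𝓝 (solU δ γ κ (rankOneNorm γ δ) ξ t i)) := by
  have hb : ∀ j, Tendsto
      (fun k => (fun j => coefUp κ k j / k * prj₁₂ κ (rankOneNorm γ δ) ξ t j : Fin 2 → ℂ) j)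
      (𝓝[≠] 0) (𝓝 ((amp κ • prj₁₂ κ (rankOneNorm γ δ) ξ t) j)) := by
    intro j
    rw [Pi.smul_apply, smul_eq_mul, amp_pole κ j]
    exact (tendsto_dressCoef_div (by simpa using pole_ne_zero hκ.ne' j)).mul_const _
  refine ((tendsto_frame_apply (E := unitFrame δ) (G := unitFrame γ) hb 0 i).const_mul
    Complex.I).congr' ?_
  filter_upwards [eventually_regular hκ.ne'] with k hk
  rw [rhp_normalized hκ hγ hδ h hk.2.1 hk.2.2, lift, Matrix.fromBlocks_apply₁₂, frame_apply,
    frame_apply, Finset.mul_sum, Finset.mul_sum]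
  refine Finset.sum_congr rfl fun l _ => ?_
  rw [Pi.mul_apply]
  ring

lemma tendsto_soliton_x (hκ : 0 < κ.im) (hγ : γ ≠ 0) (hδ : δ ≠ 0) {M₁ M₂ : ℂ → Mat42}
    (h : IsQuartetRHP κ (rankOne γ δ) ξ t M₁ M₂) :
    Tendsto (fun k : ℂ => Complex.I / k *
        (((Matrix.fromCols (M₁ 0) (M₂ 0) : Mat4)⁻¹ *
          (Matrix.fromCols (M₁ k) (M₂ k) : Mat4)) (Sum.inl 0) (Sum.inl 0) - 1))
      (𝓝[≠] 0) (𝓝 ((solX κ (rankOneNorm γ δ) ξ t - ξ : ℝ) : ℂ)) := by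
  have hE := unitFrame_unitary hδ
  -- The limit is the same in both directions, so the limiting block is a scalar matrix and its
  -- first entry does not depend on the frame of `δ`.
  have hb : ∀ j, Tendsto
      (fun k => (fun j => coefLo κ k j / k * prj₂₂ κ (rankOneNorm γ δ) ξ t j : Fin 2 → ℂ) j)
      (𝓝[≠] 0) (𝓝 ((fun _ => -(amp κ * prj₂₂ κ (rankOneNorm γ δ) ξ t 0) : Fin 2 → ℂ) j)) := by
    intro j
    have e : -(amp κ * prj₂₂ κ (rankOneNorm γ δ) ξ t 0) = (conj (pole κ j) - pole κ j) /
        (conj (pole κ j) * pole κ j) * prj₂₂ κ (rankOneNorm γ δ) ξ t j := by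
      rw [amp_pole κ j, prj₂₂_eq κ _ ξ t j]
      ring
    rw [e]
    exact (tendsto_dressCoef_div (pole_ne_zero hκ.ne' j)).mul_const _
  have hlim := (tendsto_frame_apply (E := unitFrame δ) (G := unitFrame δ) hb 0 0).const_mul
    Complex.I
  rw [frame_const hE] at hlim
  have hval : Complex.I * ((-(amp κ * prj₂₂ κ (rankOneNorm γ δ) ξ t 0)) • (1 : Mat2)) 0 0 =
      ((solX κ (rankOneNorm γ δ) ξ t - ξ : ℝ) : ℂ) := by
    rw [Complex.ofReal_sub, coe_solX]
    simp
  rw [hval] at hlim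
  refine hlim.congr' ?_
  filter_upwards [eventually_regular hκ.ne'] with k hk
  rw [rhp_normalized hκ hγ hδ h hk.2.1 hk.2.2, lift, Matrix.fromBlocks_apply₁₁, ← frame_add,
    frame_one hE, Matrix.add_apply, Matrix.one_apply_eq, add_sub_cancel_left, frame_apply,
    frame_apply, Finset.mul_sum, Finset.mul_sum]
  refine Finset.sum_congr rfl fun l _ => ?_
  rw [Pi.mul_apply]
  ring

/-- The one-soliton solution exists, is unique, and is the closed form above. -/
theorem isQuartetSoliton_iff (hκ : 0 < κ.im) (hγ : γ ≠ 0) (hδ : δ ≠ 0)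
    (u : ℝ → ℝ → Fin 2 → ℂ) (x : ℝ → ℝ → ℝ) :
    IsQuartetSoliton κ (rankOne γ δ) u x ↔
      u = solU δ γ κ (rankOneNorm γ δ) ∧ x = solX κ (rankOneNorm γ δ) := by
  constructor
  · rintro ⟨M₁, M₂, hM⟩
    constructor
    · ext ξ t j
      exact tendsto_nhds_unique ((hM ξ t).2.1 j) (tendsto_soliton_u hκ hγ hδ (hM ξ t).1 j)
    · ext ξ t
      have := tendsto_nhds_unique (hM ξ t).2.2 (tendsto_soliton_x hκ hγ hδ (hM ξ t).1)
      have := Complex.ofReal_injective this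
      linarith
  · rintro ⟨rfl, rfl⟩
    exact ⟨rhpCol₁ δ γ κ (rankOneNorm γ δ), rhpCol₂ δ γ κ (rankOneNorm γ δ), fun ξ t =>
      ⟨isQuartetRHP_rhpCol hκ hγ hδ ξ t,
        tendsto_soliton_u hκ hγ hδ (isQuartetRHP_rhpCol hκ hγ hδ ξ t),
        tendsto_soliton_x hκ hγ hδ (isQuartetRHP_rhpCol hκ hγ hδ ξ t)⟩⟩

theorem hasTransmissionCoefficients_rankOne (hκ : 0 < κ.im) (hγ : γ ≠ 0) (hδ : δ ≠ 0)
    {A Abar Cc Cbar : ℂ → Mat2}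
    (hu : ∀ k : ℂ, 0 ≤ k.im → A k = transUp δ κ k ∧ Cc k = transUp γ κ k)
    (hl : ∀ k : ℂ, k.im ≤ 0 → Abar k = transLo γ κ k ∧ Cbar k = transLo δ κ k) :
    HasTransmissionCoefficients (IsQuartetSoliton κ (rankOne γ δ)) A Abar Cc Cbar := by
  constructor
  · refine ⟨(solU δ γ κ (rankOneNorm γ δ), solX κ (rankOneNorm γ δ)),
      (isQuartetSoliton_iff hκ hγ hδ _ _).2 ⟨rfl, rfl⟩, fun s hs => ?_⟩
    obtain ⟨h1, h2⟩ := (isQuartetSoliton_iff hκ hγ hδ _ _).1 hs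
    exact Prod.ext h1 h2
  · intro u x hP a abar c cbar
    obtain ⟨rfl, rfl⟩ := (isQuartetSoliton_iff hκ hγ hδ _ _).1 hP
    rw [isTransmissionData_sol_iff hκ (rankOneNorm_pos hγ hδ).ne' hδ hγ]
    refine and_congr (forall₂_congr fun k hk => ?_) (forall₂_congr fun k hk => ?_)
    · rw [(hu k hk).1, (hu k hk).2]
    · rw [(hl k hk).1, (hl k hk).2]

end rhp

/-! ### Explicit transmission matrices -/

section formulas

variable {κ k : ℂ}

/-- Exchanging `κ` with `κ^*` inverts the Blaschke factor, so every formula in the lower half plane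
follows from its upper counterpart. -/
lemma transLo_eq_transUp_conj (v : Fin 2 → ℂ) (κ k : ℂ) : transLo v κ k = transUp v (conj κ) k := by
  have : coefLo κ k = coefUp (conj κ) k := by
    ext j; fin_cases j <;> simp [coefLo, coefUp, pole]
  rw [transLo, transUp, this]

/-- There is no restriction on `k`: at a pole the corresponding coefficient is zero on both sides by
the convention for division. -/
lemma transUp_eq_dyad {v : Fin 2 → ℂ} (hv : v ≠ 0) (κ k : ℂ) :
    transUp v κ k = 1
      - (k / κ * ((κ - conj κ) / (k - conj κ)) / (euclNorm v : ℂ) ^ 2) • dyad v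
      + (k / conj κ * ((κ - conj κ) / (k + κ)) / (euclNorm v : ℂ) ^ 2) • dyad (perp v) := by
  have h0 : coefUp κ k 0 = -(k / κ * ((κ - conj κ) / (k - conj κ))) := by
    simp only [coefUp, dressCoef, pole, Matrix.cons_val_zero, div_eq_mul_inv, mul_inv]
    ring
  have h1 : coefUp κ k 1 = k / conj κ * ((κ - conj κ) / (k + κ)) := by
    simp only [coefUp, dressCoef, pole, Matrix.cons_val_one, Matrix.cons_val_zero, map_neg,
      Complex.conj_conj, sub_neg_eq_add, div_eq_mul_inv, mul_inv, inv_neg]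
    ring
  rw [transUp, unitFrame_diagonal hv]
  rw [Pi.add_apply, Pi.add_apply, Pi.one_apply, Pi.one_apply, add_sub_cancel_left,
    add_sub_cancel_left, h0, h1, neg_div, neg_smul, ← sub_eq_add_neg]

lemma transLo_eq_dyad {v : Fin 2 → ℂ} (hv : v ≠ 0) (κ k : ℂ) :
    transLo v κ k = 1
      - (k / conj κ * ((conj κ - κ) / (k - κ)) / (euclNorm v : ℂ) ^ 2) • dyad v
      + (k / κ * ((conj κ - κ) / (k + conj κ)) / (euclNorm v : ℂ) ^ 2) • dyad (perp v) := by
  rw [transLo_eq_transUp_conj, transUp_eq_dyad hv, Complex.conj_conj]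

lemma unitFrame_diagonal_pol {v : Fin 2 → ℂ} (hv : v ≠ 0) (f : Fin 2 → ℂ) :
    unitFrame v * Matrix.diagonal f * (unitFrame v)ᴴ =
      f 1 • 1 + (f 0 - f 1) • polDyad (polarization v) := by
  have h0 : (euclNorm v : ℂ) ≠ 0 := by exact_mod_cast (euclNorm_pos hv).ne'
  have h := euclNorm_sq v
  ext i j
  simp only [frame_apply, Fin.sum_univ_two, unitFrame_apply₀, unitFrame_apply₁, Matrix.add_apply,
    Matrix.smul_apply, polDyad, polarization, Matrix.vecMulVec_apply, Pi.star_apply, smul_eq_mul,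
    Matrix.one_apply]
  fin_cases i <;> fin_cases j <;>
    simp [perp] <;> field_simp <;> first | ring1 | linear_combination -f 1 * h

/-- The second eigenvalue `f₁` is pulled out as a common factor and the bracket carries `(f₀ -
f₁)/f₁`. This excludes the zero `-κ^*` of `f₁` in addition to the poles. -/
lemma transUp_eq_polDyad {v : Fin 2 → ℂ} (hv : v ≠ 0) (hκ : κ ≠ 0) (h1 : k ≠ -κ)
    (h2 : k ≠ conj κ) (h3 : k ≠ -conj κ) :
    transUp v κ k = (κ / conj κ * ((k + conj κ) / (k + κ))) •
      (1 + (k ^ 2 * (conj κ ^ 2 - κ ^ 2) / (κ ^ 2 * (k ^ 2 - conj κ ^ 2))) •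
        polDyad (polarization v)) := by
  have hc : conj κ ≠ 0 := by simpa using hκ
  rw [transUp, unitFrame_diagonal_pol hv, smul_add, smul_smul]
  simp only [Pi.add_apply, Pi.one_apply, coefUp, dressCoef, pole, Matrix.cons_val_one,
    Matrix.cons_val_zero, map_neg, Complex.conj_conj]
  generalize conj κ = b at *
  have e1 : k + κ ≠ 0 := fun h => h1 (eq_neg_of_add_eq_zero_left h)
  have e2 : k - b ≠ 0 := sub_ne_zero.2 h2
  have e3 : k + b ≠ 0 := fun h => h3 (eq_neg_of_add_eq_zero_left h)
  rw [show k ^ 2 - b ^ 2 = (k - b) * (k + b) by ring, show k - -κ = k + κ by ring]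
  congr 2
  · field_simp
    ring
  · field_simp
    ring

lemma transLo_eq_polDyad {v : Fin 2 → ℂ} (hv : v ≠ 0) (hκ : κ ≠ 0) (h0 : k ≠ κ) (h1 : k ≠ -κ)
    (h3 : k ≠ -conj κ) :
    transLo v κ k = (conj κ / κ * ((k + κ) / (k + conj κ))) •
      (1 + (k ^ 2 * (κ ^ 2 - conj κ ^ 2) / (conj κ ^ 2 * (k ^ 2 - κ ^ 2))) •
        polDyad (polarization v)) := by
  rw [transLo_eq_transUp_conj, transUp_eq_polDyad hv (by simpa using hκ) h3
    (by simpa using h0) (by simpa using h1), Complex.conj_conj]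

/-- The frame of `(1, 0)` is the identity; this is why two of the coefficients of a fundamental
soliton are diagonal and free of the norming constant. -/
lemma unitFrame_single : unitFrame ![1, 0] = 1 := by
  have h : (euclNorm ![1, 0] : ℂ) = 1 := by
    have h2 : (euclNorm ![1, 0] : ℂ) ^ 2 = 1 := by rw [euclNorm_sq]; simp
    have h3 : euclNorm ![1, 0] ^ 2 = 1 := by exact_mod_cast h2
    have := (pow_eq_one_iff_of_nonneg (norm_nonneg _) two_ne_zero).1 h3
    exact_mod_cast this
  ext i j
  fin_cases i <;> fin_cases j <;> simp [unitFrame, h]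

lemma transUp_single (hκ : κ ≠ 0) (h1 : k ≠ -κ) (h2 : k ≠ conj κ) :
    transUp ![1, 0] κ k = Matrix.diagonal ![conj κ / κ * ((k - κ) / (k - conj κ)),
      κ / conj κ * ((k + conj κ) / (k + κ))] := by
  have hc : conj κ ≠ 0 := by simpa using hκ
  rw [transUp, unitFrame_single, Matrix.one_mul, Matrix.conjTranspose_one, Matrix.mul_one]
  congr 1
  ext j
  simp only [Pi.add_apply, Pi.one_apply, coefUp, dressCoef, pole]
  generalize hb : conj κ = b at *
  have e1 : k + κ ≠ 0 := fun h => h1 (eq_neg_of_add_eq_zero_left h)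
  have e2 : k - b ≠ 0 := sub_ne_zero.2 h2
  fin_cases j
  · simp [hb]
    field_simp
    ring
  · simp [← hb]
    rw [hb]
    field_simp
    ring

lemma transLo_single (hκ : κ ≠ 0) (h1 : k ≠ κ) (h2 : k ≠ -conj κ) :
    transLo ![1, 0] κ k = Matrix.diagonal ![κ / conj κ * ((k - conj κ) / (k - κ)),
      conj κ / κ * ((k + κ) / (k + conj κ))] := by
  rw [transLo_eq_transUp_conj, transUp_single (by simpa using hκ) h2 (by simpa using h1),
    Complex.conj_conj]

/-- For imaginary `κ` the two poles coincide, so both eigenvalues are equal and the frame cancels.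
-/
lemma transUp_imag {v : Fin 2 → ℂ} (hv : v ≠ 0) (hκ : κ ≠ 0) (him : conj κ = -κ) (h1 : k ≠ -κ) :
    transUp v κ k = ((κ - k) / (κ + k)) • 1 := by
  have e1 : k + κ ≠ 0 := fun h => h1 (eq_neg_of_add_eq_zero_left h)
  have e2 : κ + k ≠ 0 := by rwa [add_comm]
  have : 1 + coefUp κ k = fun _ => (κ - k) / (κ + k) := by
    ext j
    have hj : pole κ j = κ := by fin_cases j <;> simp [pole, him]
    rw [Pi.add_apply, Pi.one_apply, coefUp, hj, him, dressCoef, sub_neg_eq_add]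
    field_simp
    ring
  rw [transUp, this, frame_const (unitFrame_unitary hv)]

end formulas

/-! ### Norming constants -/

lemma breatherNorming_eq (γ : Fin 2 → ℂ) (μ κ : ℂ) :
    breatherNorming γ μ κ = rankOne γ ![conj μ, conj κ] := by
  ext i j
  fin_cases j <;> simp [breatherNorming, rankOne, Matrix.vecMulVec_apply, mul_comm]

lemma fundamentalNorming_eq (γ : Fin 2 → ℂ) : fundamentalNorming γ = rankOne γ ![1, 0] := by
  ext i j
  fin_cases j <;> simp [fundamentalNorming, rankOne, Matrix.vecMulVec_apply]

lemma rankOne_mul_rankOne (γ δ : Fin 2 → ℂ) (α β : Fin 2 → ℂ) :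
    rankOne γ δ * rankOne α β = (star δ ⬝ᵥ α) • rankOne γ β := by
  rw [rankOne, rankOne, Matrix.vecMulVec_mul_vecMulVec, Matrix.vecMulVec_smul]
  rfl

lemma fundamentalNorming_mul_normBar (γ : Fin 2 → ℂ) :
    fundamentalNorming γ * normBar (fundamentalNorming γ) = -dyad γ := by
  rw [fundamentalNorming_eq, normBar_rankOne, Matrix.mul_neg, rankOne_mul_rankOne]
  simp [dotProduct, rankOne, dyad]

lemma perp_single : perp ![1, 0] = ![0, 1] := by
  simp [perp]

lemma normTilde_fundamentalNorming_mul (γ : Fin 2 → ℂ) :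
    normTilde (fundamentalNorming γ) * normTilde (normBar (fundamentalNorming γ)) =
      -dyad (perp γ) := by
  rw [fundamentalNorming_eq, normBar_rankOne, normTilde_neg, normTilde_rankOne, normTilde_rankOne,
    neg_neg, Matrix.neg_mul, rankOne_mul_rankOne, perp_single]
  have : star ![(0 : ℂ), 1] ⬝ᵥ ![0, 1] = 1 := by simp [dotProduct]
  rw [this, one_smul]
  rfl

lemma selfSymmNorming_eq (γ : Fin 2 → ℂ) :
    selfSymmNorming γ = rankOne γ ![1, 0] + normTilde (rankOne γ ![1, 0]) := by
  rw [normTilde_rankOne, perp_single]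
  ext i j
  fin_cases j <;> simp [selfSymmNorming, rankOne, Matrix.vecMulVec_apply]

lemma normBar_selfSymmNorming (γ : Fin 2 → ℂ) :
    normBar (selfSymmNorming γ) =
      normBar (rankOne γ ![1, 0]) + normTilde (normBar (rankOne γ ![1, 0])) := by
  have h : normBar (rankOne γ ![1, 0] + -rankOne (perp γ) (perp ![1, 0])) =
      normBar (rankOne γ ![1, 0]) - normBar (rankOne (perp γ) (perp ![1, 0])) := by
    simp [normBar, Matrix.conjTranspose_add, add_comm, sub_eq_add_neg]
  rw [selfSymmNorming_eq, normTilde_rankOne, h, normBar_rankOne, normBar_rankOne, normTilde_neg,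
    normTilde_rankOne]
  abel

/-- A self-symmetric soliton is a fundamental soliton whose two pairs of poles coincide. -/
lemma isSelfSymmetricSoliton_eq {κ : ℂ} (h : conj κ = -κ) (γ : Fin 2 → ℂ) :
    IsSelfSymmetricSoliton κ (selfSymmNorming γ) = IsQuartetSoliton κ (rankOne γ ![1, 0]) := by
  have key : ∀ (ξ t : ℝ) (M₁ M₂ : ℂ → Mat42),
      IsReflectionlessRHP ![κ] ![selfSymmNorming γ] ![conj κ] ![normBar (selfSymmNorming γ)] ξ t
        M₁ M₂ ↔ IsQuartetRHP κ (rankOne γ ![1, 0]) ξ t M₁ M₂ := by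
    intro ξ t M₁ M₂
    -- The two poles of each quartet column are one point, so the exclusions agree and the two
    -- residue terms add up to the single self-symmetric one.
    have e1 : ∀ k : ℂ, (∀ n : Fin 1, k ≠ (![κ] : Fin 1 → ℂ) n) ↔
        ∀ n : Fin 2, k ≠ (![κ, -conj κ] : Fin 2 → ℂ) n := by
      intro k; simp [h]
    have e2 : ∀ k : ℂ, (∀ n : Fin 1, k ≠ (![conj κ] : Fin 1 → ℂ) n) ↔
        ∀ n : Fin 2, k ≠ (![conj κ, -κ] : Fin 2 → ℂ) n := by
      intro k; simp [h]
    constructor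
    · rintro ⟨h1, h2⟩
      constructor
      · intro k hk
        rw [h1 k ((e1 k).2 hk), selfSymmNorming_eq]
        simp [Fin.sum_univ_two, h, Matrix.mul_add]
      · intro k hk
        rw [h2 k ((e2 k).2 hk), normBar_selfSymmNorming]
        simp [Fin.sum_univ_two, h, Matrix.mul_add]
    · rintro ⟨h1, h2⟩
      constructor
      · intro k hk
        rw [h1 k ((e1 k).1 hk), selfSymmNorming_eq]
        simp [Fin.sum_univ_two, h, Matrix.mul_add]
      · intro k hk
        rw [h2 k ((e2 k).1 hk), normBar_selfSymmNorming]
        simp [Fin.sum_univ_two, h, Matrix.mul_add]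
  ext u x
  simp only [IsSelfSymmetricSoliton, IsQuartetSoliton, IsPureSoliton, key]


/-! ### The three soliton families -/

theorem mainTheorem10 :
    -- fundamental solitons
    (∀ (k₁ : ℂ) (γ : Fin 2 → ℂ), 0 < k₁.im → k₁.re ≠ 0 → γ ≠ 0 →
      ∀ (C : Mat2) (p : Fin 2 → ℂ), C = fundamentalNorming γ → p = polarization γ →
      ∃ a abar c cbar : ℂ → Mat2,
        HasTransmissionCoefficients (IsQuartetSoliton k₁ C) a abar c cbar ∧
        (∀ k, a k = Matrix.diagonal ![conj k₁ / k₁ * ((k - k₁) / (k - conj k₁)),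
            k₁ / conj k₁ * ((k + conj k₁) / (k + k₁))]) ∧
        (∀ k, cbar k = Matrix.diagonal ![k₁ / conj k₁ * ((k - conj k₁) / (k - k₁)),
            conj k₁ / k₁ * ((k + k₁) / (k + conj k₁))]) ∧
        (∀ k, abar k = (1
            + (k / conj k₁ * ((conj k₁ - k₁) / (k - k₁)) / (euclNorm γ : ℂ) ^ 2) •
              (C * normBar C)
            + (k / k₁ * ((k₁ - conj k₁) / (k + conj k₁)) / (euclNorm γ : ℂ) ^ 2) •
              (normTilde C * normTilde (normBar C)))) ∧
        (∀ k, c k = (1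
            + (k / k₁ * ((k₁ - conj k₁) / (k - conj k₁)) / (euclNorm γ : ℂ) ^ 2) •
              (C * normBar C)
            + (k / conj k₁ * ((conj k₁ - k₁) / (k + k₁)) / (euclNorm γ : ℂ) ^ 2) •
              (normTilde C * normTilde (normBar C)))) ∧
        (∀ k : ℂ, k ≠ k₁ → k ≠ -k₁ → k ≠ conj k₁ → k ≠ -conj k₁ →
          abar k = (conj k₁ / k₁ * ((k + k₁) / (k + conj k₁))) •
            (1 + (k ^ 2 * (k₁ ^ 2 - conj k₁ ^ 2) / (conj k₁ ^ 2 * (k ^ 2 - k₁ ^ 2))) • polDyad p) ∧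
          c k = (k₁ / conj k₁ * ((k + conj k₁) / (k + k₁))) •
            (1 + (k ^ 2 * (conj k₁ ^ 2 - k₁ ^ 2) / (k₁ ^ 2 * (k ^ 2 - conj k₁ ^ 2))) • polDyad p))) ∧
    -- fundamental breathers
    (∀ (k₁ : ℂ) (γ : Fin 2 → ℂ) (μ κ : ℂ), 0 < k₁.im → k₁.re ≠ 0 → γ ≠ 0 → (μ ≠ 0 ∨ κ ≠ 0) →
      ∀ (δ p q : Fin 2 → ℂ), δ = ![conj μ, conj κ] → p = polarization γ → q = polarization δ →
      ∃ a abar c cbar : ℂ → Mat2,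
        HasTransmissionCoefficients (IsQuartetSoliton k₁ (breatherNorming γ μ κ))
          a abar c cbar ∧
        (∀ k, a k = (1
            - (k / k₁ * ((k₁ - conj k₁) / (k - conj k₁)) / (euclNorm δ : ℂ) ^ 2) • dyad δ
            + (k / conj k₁ * ((k₁ - conj k₁) / (k + k₁)) / (euclNorm δ : ℂ) ^ 2) •
              dyad (perp δ))) ∧
        (∀ k, cbar k = (1
            - (k / conj k₁ * ((conj k₁ - k₁) / (k - k₁)) / (euclNorm δ : ℂ) ^ 2) • dyad δ
            + (k / k₁ * ((conj k₁ - k₁) / (k + conj k₁)) / (euclNorm δ : ℂ) ^ 2) •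
              dyad (perp δ))) ∧
        (∀ k, c k = (1
            - (k / k₁ * ((k₁ - conj k₁) / (k - conj k₁)) / (euclNorm γ : ℂ) ^ 2) • dyad γ
            + (k / conj k₁ * ((k₁ - conj k₁) / (k + k₁)) / (euclNorm γ : ℂ) ^ 2) •
              dyad (perp γ))) ∧
        (∀ k, abar k = (1
            - (k / conj k₁ * ((conj k₁ - k₁) / (k - k₁)) / (euclNorm γ : ℂ) ^ 2) • dyad γ
            + (k / k₁ * ((conj k₁ - k₁) / (k + conj k₁)) / (euclNorm γ : ℂ) ^ 2) •
              dyad (perp γ))) ∧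
        (∀ k : ℂ, k ≠ k₁ → k ≠ -k₁ → k ≠ conj k₁ → k ≠ -conj k₁ →
          a k = (k₁ / conj k₁ * ((k + conj k₁) / (k + k₁))) •
            (1 + (k ^ 2 * (conj k₁ ^ 2 - k₁ ^ 2) / (k₁ ^ 2 * (k ^ 2 - conj k₁ ^ 2))) • polDyad q) ∧
          cbar k = (conj k₁ / k₁ * ((k + k₁) / (k + conj k₁))) •
            (1 + (k ^ 2 * (k₁ ^ 2 - conj k₁ ^ 2) / (conj k₁ ^ 2 * (k ^ 2 - k₁ ^ 2))) • polDyad q) ∧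
          c k = (k₁ / conj k₁ * ((k + conj k₁) / (k + k₁))) •
            (1 + (k ^ 2 * (conj k₁ ^ 2 - k₁ ^ 2) / (k₁ ^ 2 * (k ^ 2 - conj k₁ ^ 2))) • polDyad p) ∧
          abar k = (conj k₁ / k₁ * ((k + k₁) / (k + conj k₁))) •
            (1 + (k ^ 2 * (k₁ ^ 2 - conj k₁ ^ 2) / (conj k₁ ^ 2 * (k ^ 2 - k₁ ^ 2))) • polDyad p))) ∧
    -- self-symmetric solitons
    (∀ (k₁ : ℂ) (γ : Fin 2 → ℂ), 0 < k₁.im → k₁.re = 0 → γ ≠ 0 →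
      ∃ a abar c cbar : ℂ → Mat2,
        HasTransmissionCoefficients (IsSelfSymmetricSoliton k₁ (selfSymmNorming γ))
          a abar c cbar ∧
        (∀ k, a k = ((k₁ - k) / (k₁ + k)) • 1) ∧
        (∀ k, abar k = ((conj k₁ - k) / (conj k₁ + k)) • 1) ∧
        (∀ k, c k = a k) ∧
        (∀ k, cbar k = abar k)) := by
  have hne : ∀ k₁ : ℂ, 0 < k₁.im → k₁ ≠ 0 := by
    rintro _ h rfl
    simp at h
  have hup : ∀ {k₁ k : ℂ}, 0 < k₁.im → 0 ≤ k.im → k ≠ -k₁ ∧ k ≠ conj k₁ := by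
    intro k₁ k h hk
    constructor <;> rintro rfl <;> simp at hk <;> linarith
  have hlo : ∀ {k₁ k : ℂ}, 0 < k₁.im → k.im ≤ 0 → k ≠ k₁ ∧ k ≠ -conj k₁ := by
    intro k₁ k h hk
    constructor <;> rintro rfl
    · linarith
    · simp at hk
      linarith
  have h10 : (![1, 0] : Fin 2 → ℂ) ≠ 0 := by simp
  refine ⟨?_, ?_, ?_⟩
  · intro k₁ γ him hre hγ C p hC hp
    subst hC hp
    -- The two open witnesses are the explicit diagonal matrices. They agree with `transUp ![1, 0]
    -- k₁` and `transLo ![1, 0] k₁` on the closed half planes, which is all that is tested; at poles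
    -- in the opposite half plane their junk values differ.
    refine ⟨_, transLo γ k₁, transUp γ k₁, _, ?_, fun k => rfl, fun k => rfl, fun k => ?_,
      fun k => ?_, fun k h0 h1 h2 h3 => ⟨transLo_eq_polDyad hγ (hne k₁ him) h0 h1 h3,
        transUp_eq_polDyad hγ (hne k₁ him) h1 h2 h3⟩⟩
    · rw [fundamentalNorming_eq]
      exact hasTransmissionCoefficients_rankOne him hγ h10
        (fun k hk => ⟨(transUp_single (hne k₁ him) (hup him hk).1 (hup him hk).2).symm, rfl⟩)
        (fun k hk => ⟨rfl, (transLo_single (hne k₁ him) (hlo him hk).1 (hlo him hk).2).symm⟩)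
    · rw [fundamentalNorming_mul_normBar, normTilde_fundamentalNorming_mul, transLo_eq_dyad hγ,
        smul_neg, ← sub_eq_add_neg, smul_neg, ← neg_smul]
      congr 2
      ring
    · rw [fundamentalNorming_mul_normBar, normTilde_fundamentalNorming_mul, transUp_eq_dyad hγ,
        smul_neg, ← sub_eq_add_neg, smul_neg, ← neg_smul]
      congr 2
      ring
  · intro k₁ γ μ κ him hre hγ hμκ δ p q hδ hp hq
    have hδ0 : δ ≠ 0 := by
      rw [hδ]
      simpa [← not_and_or] using hμκ
    subst hp hq
    refine ⟨transUp δ k₁, transLo γ k₁, transUp γ k₁, transLo δ k₁, ?_, transUp_eq_dyad hδ0 k₁,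
      transLo_eq_dyad hδ0 k₁, transUp_eq_dyad hγ k₁, transLo_eq_dyad hγ k₁,
      fun k h0 h1 h2 h3 => ⟨transUp_eq_polDyad hδ0 (hne k₁ him) h1 h2 h3,
        transLo_eq_polDyad hδ0 (hne k₁ him) h0 h1 h3,
        transUp_eq_polDyad hγ (hne k₁ him) h1 h2 h3,
        transLo_eq_polDyad hγ (hne k₁ him) h0 h1 h3⟩⟩
    rw [breatherNorming_eq, ← hδ]
    exact hasTransmissionCoefficients_rankOne him hγ hδ0 (fun k _ => ⟨rfl, rfl⟩)
      fun k _ => ⟨rfl, rfl⟩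
  · intro k₁ γ him hre hγ
    have hc : conj k₁ = -k₁ := by
      apply Complex.ext <;> simp [hre]
    have hup' : ∀ {v : Fin 2 → ℂ}, v ≠ 0 → ∀ k : ℂ, 0 ≤ k.im →
        ((k₁ - k) / (k₁ + k)) • 1 = transUp v k₁ k := fun hv k hk =>
      (transUp_imag hv (hne k₁ him) hc (hup him hk).1).symm
    have hlo' : ∀ {v : Fin 2 → ℂ}, v ≠ 0 → ∀ k : ℂ, k.im ≤ 0 →
        ((conj k₁ - k) / (conj k₁ + k)) • 1 = transLo v k₁ k := fun hv k hk => by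
      rw [transLo_eq_transUp_conj, transUp_imag hv (by simpa using hne k₁ him) (by simp [hc])
        (hlo him hk).2]
    refine ⟨fun k => ((k₁ - k) / (k₁ + k)) • 1, fun k => ((conj k₁ - k) / (conj k₁ + k)) • 1,
      fun k => ((k₁ - k) / (k₁ + k)) • 1, fun k => ((conj k₁ - k) / (conj k₁ + k)) • 1, ?_,
      fun _ => rfl, fun _ => rfl, fun _ => rfl, fun _ => rfl⟩
    rw [isSelfSymmetricSoliton_eq hc]
    exact hasTransmissionCoefficients_rankOne him hγ h10
      (fun k hk => ⟨hup' h10 k hk, hup' hγ k hk⟩) fun k hk => ⟨hlo' hγ k hk, hlo' h10 k hk⟩
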